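/- Let $B=C[0,1]$ (complex-valued) and let $\tau:B\to\mathbb C$ be integration with respect to Lebesgue measure. For $n\ge1$ let $\mathcal P(n)$ be the set of all set partitions of $\{1,\dots,n\}$; for $\pi\in\mathcal P(n)$ let $S_\pi(j)$ denote the block of $\pi$ containing $j$. For $g_1,\dots,g_n\in B$ put $$\Gamma_\pi(g_1,\dots,g_n)=\Big(\prod_{j\in S_\pi(1)}g_j\Big)\prod_{S\in\pi\setminus\{S_\pi(1)\}}\tau\Big(\prod_{j\in S}g_j\Big)\in B .$$ Let $J_\pi$ be the set of all $j$ that are not the largest element of their block, let $I_\pi(p)=\{j\in\{1,\dots,p\}: S_\pi(j)\text{ contains an element}>p\}\subseteq J_\pi$, and for $t\in[0,1]$ let $$E(\pi,t)=\Big\{(t_j)_{j\in J_\pi}\in\mathbb R^{J_\pi}:\ 0\le t+\sum_{j\in I_\pi(p)}t_j\le1\ \text{ for all }1\le p\le n-1\Big\},$$ $$\Lambda_\pi(g_1,\dots,g_{n-1})(t)=\int_{E(\pi,t)}\ \prod_{p=1}^{n-1}g_p\Big(t+\sum_{j\in I_\pi(p)}t_j\Big)\,d\lambda\big((t_j)_{j\in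 J_\pi}\big),$$ where $\lambda$ is $|J_\pi|$-dimensional Lebesgue measure (if $J_\pi=\emptyset$, this is read as $\Lambda_\pi(g_1,\dots,g_{n-1})=g_1\cdots g_{n-1}$, equal to $1$ if $n=1$). Let $B\langle X,X^*\rangle$ be the $*$-algebra of polynomials in noncommuting variables $X,X^*$ with coefficients in $B$, i.e. the algebraic free product of $B$, $\mathbb C[X]$ and $\mathbb C[X^*]$ with amalgamation over the scalars, with the obvious involution. For $\epsilon\in\{1,*\}^n$ let $\sigma(\epsilon)$ be the partition of $\{1,\dots,n\}$ into the maximal intervals $I$ such that $\epsilon(j)\ne\epsilon(j+1)$ whenever $j,j+1\in I$. For a linear, self-adjoint, $B$-bimodular map $\mathcal E:B\langle X,X^*\rangle\to B$ that is the identity on $B$, the element $X$ is called $B$-valued R-diagonal if $\mathcal E(Xb_1X^*b_2X\cdots b_{2k-1}X^*b_{2k}X)=0$ for all $k\ge0$ and $b_1,\dots,b_{2k}\in B$, and $$\mathcal E\Big(\prod_{I\in\sigma(\epsilon)}\Big(\prod_{j\in I}b_jX^{\epsilon(j)}-\mathcal E\Big(\prod_{j\in I}b_jX^{\epsilon(j)}\Big)\Big)\Big)=0$$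 for all $n\ge1$, $\epsilon\in\{1,*\}^n$ and $b_1,\dots,b_n\in B$ (all products in order of increasing indices). **Theorem.** There is exactly one linear, self-adjoint, $B$-bimodular map $\mathcal E:B\langle X,X^*\rangle\to B$ that is the identity on $B$, with respect to which $X$ is $B$-valued R-diagonal, and such that for all $n\ge1$ and $b_1,\dots,b_{2n}\in B$ $$\mathcal E(b_1X^*b_2Xb_3X^*b_4X\cdots b_{2n-1}X^*b_{2n}X)=\sum_{\pi\in\mathcal P(n)}b_1\,\Lambda_\pi(b_3,b_5,\dots,b_{2n-1})\,\tau\big(\Gamma_\pi(b_2,b_4,\dots,b_{2n})\big),$$ $$\mathcal E(b_1Xb_2X^*b_3Xb_4X^*\cdots b_{2n-1}Xb_{2n}X^*)=\sum_{\pi\in\mathcal P(n)}\Gamma_\pi(b_1,b_3,\dots,b_{2n-1})\,\tau\big(\Lambda_\pi(b_2,b_4,\dots,b_{2n-2})\,b_{2n}\big).$$ For each $N$ let $X_N$ be the random $N\times N$ matrix whose $(i,j)$ entry is $N^{-1/2}\zeta_i^{\,j}$ $(1\le i,j\le N)$, where $\zeta_1,\dots,\zeta_N$ are independent random variables with Haar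 distribution on the unit circle (they may depend on $N$), and for $b\in B$ let $D_N(b)=\mathrm{diag}\big(b(\tfrac1N),b(\tfrac2N),\dots,b(\tfrac NN)\big)$. Let $\mathbb E$ denote expectation and $\mathrm{tr}$ the normalized trace. Then for all $n\ge1$, $\epsilon(1),\dots,\epsilon(n)\in\{1,*\}$ and $b_1,\dots,b_n\in B$, $$\lim_{N\to\infty}\mathbb E\circ\mathrm{tr}\big(D_N(b_1)X_N^{\epsilon(1)}D_N(b_2)X_N^{\epsilon(2)}\cdots D_N(b_n)X_N^{\epsilon(n)}\big)=\tau\circ\mathcal E\big(b_1X^{\epsilon(1)}b_2X^{\epsilon(2)}\cdots b_nX^{\epsilon(n)}\big).$$ -/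

import Mathlib

open MeasureTheory ProbabilityTheory Filter Topology

noncomputable section

namespace RandomVandermonde

/-! ### The `*`-algebra `B⟨X, X*⟩` -/

/-- Generators of `B⟨X, X*⟩`: the elements of `B`, the letter `X` (`Sum.inr false`) and the
letter `X*` (`Sum.inr true`). -/
abbrev Gen (B : Type*) := B ⊕ Bool

/-- The relations making `b ↦ b` a unital homomorphism of complex algebras. -/
inductive Rel (B : Type*) [Ring B] [Algebra ℂ B] :
    FreeAlgebra ℂ (Gen B) → FreeAlgebra ℂ (Gen B) → Prop
  | add (b c : B) : Rel B (FreeAlgebra.ι ℂ (Sum.inl (b + c)))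
      (FreeAlgebra.ι ℂ (Sum.inl b) + FreeAlgebra.ι ℂ (Sum.inl c))
  | mul (b c : B) : Rel B (FreeAlgebra.ι ℂ (Sum.inl (b * c)))
      (FreeAlgebra.ι ℂ (Sum.inl b) * FreeAlgebra.ι ℂ (Sum.inl c))
  | scalar (r : ℂ) : Rel B (FreeAlgebra.ι ℂ (Sum.inl (algebraMap ℂ B r)))
      (algebraMap ℂ (FreeAlgebra ℂ (Gen B)) r)

/-- `B⟨X, X*⟩`, the algebraic free product of `B`, `ℂ[X]` and `ℂ[X*]` with amalgamation over the
scalars, presented by generators and relations: the polynomials in noncommuting variables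
`X`, `X*` with coefficients in `B`. -/
def NCPoly (B : Type*) [Ring B] [Algebra ℂ B] : Type _ := RingQuot (Rel B)

namespace NCPoly

section Construction

variable {B : Type*} [Ring B] [Algebra ℂ B]

instance : Ring (NCPoly B) := inferInstanceAs (Ring (RingQuot (Rel B)))

instance : Algebra ℂ (NCPoly B) := inferInstanceAs (Algebra ℂ (RingQuot (Rel B)))

/-- The quotient map from the free algebra. -/
def mk : FreeAlgebra ℂ (Gen B) →ₐ[ℂ] NCPoly B := RingQuot.mkAlgHom ℂ (Rel B)

/-- The image of a generator. -/
def gen (g : Gen B) : NCPoly B := mk (FreeAlgebra.ι ℂ g)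

/-- The inclusion of `B`, as a homomorphism of algebras. -/
def inclAlg : B →ₐ[ℂ] NCPoly B where
  toFun b := gen (Sum.inl b)
  map_one' := by
    have h := RingQuot.mkAlgHom_rel ℂ (Rel.scalar (B := B) 1)
    rw [map_one, map_one, map_one] at h
    exact h
  map_mul' b c := by
    have h := RingQuot.mkAlgHom_rel ℂ (Rel.mul b c)
    rw [map_mul] at h
    exact h
  map_zero' := by
    have h := RingQuot.mkAlgHom_rel ℂ (Rel.scalar (B := B) 0)
    rw [map_zero, map_zero, map_zero] at h
    exact h
  map_add' b c := by
    have h := RingQuot.mkAlgHom_rel ℂ (Rel.add b c)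
    rw [map_add] at h
    exact h
  commutes' r := by
    have h := RingQuot.mkAlgHom_rel ℂ (Rel.scalar (B := B) r)
    rw [AlgHom.commutes] at h
    exact h

theorem gen_inl (b : B) : gen (Sum.inl b) = inclAlg b := rfl

/-- Universal property: a homomorphism out of `B` together with images of `X` and `X*`. -/
def lift {A : Type*} [Ring A] [Algebra ℂ A] (f : B →ₐ[ℂ] A) (x : Bool → A) :
    NCPoly B →ₐ[ℂ] A :=
  RingQuot.liftAlgHom ℂ ⟨FreeAlgebra.lift ℂ (Sum.elim f x), by
    intro u v h
    cases h <;> simp⟩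

theorem lift_gen {A : Type*} [Ring A] [Algebra ℂ A] (f : B →ₐ[ℂ] A) (x : Bool → A) (g : Gen B) :
    lift f x (gen g) = Sum.elim (⇑f) x g := by
  have h := RingQuot.liftAlgHom_mkAlgHom_apply ℂ (FreeAlgebra.lift ℂ (Sum.elim (⇑f) x))
    (s := Rel B) (by intro u v h; cases h <;> simp) (FreeAlgebra.ι ℂ g)
  rw [FreeAlgebra.lift_ι_apply] at h
  exact h

theorem hom_ext {A : Type*} [Ring A] [Algebra ℂ A] {f g : NCPoly B →ₐ[ℂ] A}
    (h : ∀ x : Gen B, f (gen x) = g (gen x)) : f = g := by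
  refine RingQuot.ringQuot_ext' ℂ f g (FreeAlgebra.hom_ext ?_)
  funext x
  exact h x

end Construction

section Star

variable {B : Type*} [Ring B] [StarRing B] [Algebra ℂ B] [StarModule ℂ B]

/-- The opposite algebra with the complex conjugate scalar multiplication: the target of the
involution viewed as a homomorphism of algebras. -/
def ConjOp (A : Type*) : Type _ := Aᵐᵒᵖ

instance (A : Type*) [Ring A] : Ring (ConjOp A) := inferInstanceAs (Ring Aᵐᵒᵖ)

instance (A : Type*) [Ring A] [Algebra ℂ A] : Algebra ℂ (ConjOp A) :=
  Algebra.compHom (Aᵐᵒᵖ) (starRingEnd ℂ)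

/-- The element `a`, viewed in the conjugate opposite algebra. -/
def toConj {A : Type*} (a : A) : ConjOp A := MulOpposite.op a

/-- The inverse of `toConj`. -/
def ofConj {A : Type*} (a : ConjOp A) : A := MulOpposite.unop a

theorem algebraMap_conjOp (A : Type*) [Ring A] [Algebra ℂ A] (r : ℂ) :
    algebraMap ℂ (ConjOp A) r = toConj (algebraMap ℂ A (star r)) := rfl

/-- `b ↦ b*`, from `B` to the conjugate opposite of `B⟨X, X*⟩`. -/
def starB : B →ₐ[ℂ] ConjOp (NCPoly B) where
  toFun b := toConj (inclAlg (star b))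
  map_one' := by rw [star_one, map_one]; rfl
  map_mul' b c := by rw [star_mul, map_mul]; rfl
  map_zero' := by rw [star_zero, map_zero]; rfl
  map_add' b c := by rw [star_add, map_add]; rfl
  commutes' r := by
    rw [algebraMap_conjOp, ← algebraMap_star_comm, AlgHom.commutes]

/-- The involution as a homomorphism into the conjugate opposite algebra: `b ↦ b*`, and the
letters `X`, `X*` are exchanged. -/
def starHom : NCPoly B →ₐ[ℂ] ConjOp (NCPoly B) :=
  lift starB (fun s => toConj (gen (Sum.inr (!s))))

instance : Star (NCPoly B) := ⟨fun a => ofConj (starHom a)⟩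

theorem star_def (a : NCPoly B) : star a = ofConj (starHom a) := rfl

theorem star_gen_inl (b : B) :
    star (gen (Sum.inl b) : NCPoly B) = gen (Sum.inl (star b)) := by
  rw [star_def, starHom, lift_gen]; rfl

theorem star_gen_inr (s : Bool) :
    star (gen (Sum.inr s) : NCPoly B) = gen (Sum.inr (!s)) := by
  rw [star_def, starHom, lift_gen]; rfl

theorem star_mul_aux (a b : NCPoly B) : star (a * b) = star b * star a := by
  rw [star_def, map_mul]; rfl

theorem star_add_aux (a b : NCPoly B) : star (a + b) = star a + star b := by
  rw [star_def, map_add]; rfl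

theorem star_algebraMap_aux (r : ℂ) :
    star (algebraMap ℂ (NCPoly B) r) = algebraMap ℂ (NCPoly B) (star r) := by
  rw [star_def, AlgHom.commutes]; rfl

/-- The square of the involution, as an endomorphism. -/
def starSq : NCPoly B →ₐ[ℂ] NCPoly B where
  toFun a := star (star a)
  map_one' := by
    have h := star_algebraMap_aux (B := B) 1
    rw [star_one, map_one] at h
    rw [h, h]
  map_mul' a b := by rw [star_mul_aux, star_mul_aux]
  map_zero' := by
    have h := star_algebraMap_aux (B := B) 0
    rw [star_zero, map_zero] at h
    rw [h, h]
  map_add' a b := by rw [star_add_aux, star_add_aux]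
  commutes' r := by rw [star_algebraMap_aux, star_algebraMap_aux, star_star]

theorem starSq_eq : (starSq : NCPoly B →ₐ[ℂ] NCPoly B) = AlgHom.id ℂ (NCPoly B) := by
  refine hom_ext ?_
  rintro (b | s)
  · change star (star (gen (Sum.inl b))) = gen (Sum.inl b)
    rw [star_gen_inl, star_gen_inl, star_star]
  · change star (star (gen (Sum.inr s) : NCPoly B)) = gen (Sum.inr s)
    rw [star_gen_inr, star_gen_inr, Bool.not_not]

instance : StarRing (NCPoly B) where
  star_involutive := fun a => DFunLike.congr_fun (starSq_eq (B := B)) a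
  star_mul := star_mul_aux
  star_add := star_add_aux

instance : StarModule ℂ (NCPoly B) where
  star_smul r a := by
    rw [Algebra.smul_def, star_mul_aux, star_algebraMap_aux, Algebra.smul_def]
    exact (Algebra.commutes (star r) (star a)).symm

/-- The inclusion `B ⊆ B⟨X, X*⟩`. -/
def incl : B →⋆ₐ[ℂ] NCPoly B where
  __ := inclAlg
  map_star' b := (star_gen_inl b).symm

/-- The variable `X`; the variable `X*` is `star X`. -/
def X : NCPoly B := gen (Sum.inr false)

end Star

end NCPoly

/-! ### `B`-valued R-diagonal elements -/

/-- `a^ε` for `ε ∈ {1, *}`, where `*` is encoded by `true` and `1` by `false`. -/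
def starPow {A : Type*} [Star A] (a : A) (ε : Bool) : A := if ε then star a else a

/-- The maximal alternating interval partition `σ(ε)`: the list, in increasing order, of the
maximal intervals (each listed in increasing order) on which consecutive values of `ε` differ. -/
def altIntervals {n : ℕ} (ε : Fin n → Bool) : List (List (Fin n)) :=
  (List.finRange n).splitBy (fun i j => ε i != ε j)

section RDiagonal

variable {A B : Type*} [Ring A] [StarRing A] [Algebra ℂ A] [Ring B] [StarRing B] [Algebra ℂ B]

/-- `E : A → B` is a self-adjoint `B`-bimodular linear map restricting to the identity on `B`,
where `B` is regarded as a subalgebra of `A` through `i`. -/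
structure IsCondExpectation (i : B →⋆ₐ[ℂ] A) (E : A →ₗ[ℂ] B) : Prop where
  map_incl : ∀ b, E (i b) = b
  bimodular : ∀ b a c, E (i b * a * i c) = b * E a * c
  map_star : ∀ a, E (star a) = star (E a)

/-- The word `∏_{j ∈ I} b_j a^{ε(j)}`, in increasing order of the indices in the list `I`. -/
def word (i : B →⋆ₐ[ℂ] A) (a : A) {n : ℕ} (b : Fin n → B) (ε : Fin n → Bool)
    (I : List (Fin n)) : A :=
  (I.map fun j => i (b j) * starPow a (ε j)).prod

/-- `a` is `B`-valued R-diagonal with respect to `E`. In the first condition the coefficients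
`b₁, b₂, …, b_{2k}` are listed as `c 0, d 0, …, c (k-1), d (k-1)`. -/
structure IsRDiagonal (i : B →⋆ₐ[ℂ] A) (E : A →ₗ[ℂ] B) (a : A) : Prop where
  odd_alternating : ∀ (k : ℕ) (c d : Fin k → B),
    E (a * (List.ofFn fun j => i (c j) * star a * i (d j) * a).prod) = 0
  centered : ∀ (n : ℕ), 1 ≤ n → ∀ (ε : Fin n → Bool) (b : Fin n → B),
    E ((altIntervals ε).map fun I => word i a b ε I - i (E (word i a b ε I))).prod = 0

end RDiagonal

/-! ### The functions `Γ_π` and `Λ_π` -/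

/-- The C*-algebra `C[0,1]`. -/
abbrev CI := C(unitInterval, ℂ)

/-- Integration over `[0,1]` with respect to Lebesgue measure. -/
def tau (f : unitInterval → ℂ) : ℂ := ∫ t, f t

/-- The set partitions of an `n`-element set, the points `1, …, n` being numbered `0, …, n-1`. -/
abbrev SetPartition (n : ℕ) := Finpartition (Finset.univ : Finset (Fin n))

/-- `Γ_π(g₁, …, g_n)`, where `n = m + 1` and `g_{j+1}` is `g j`. -/
def Gam {m : ℕ} (π : SetPartition (m + 1)) (g : Fin (m + 1) → CI) : CI :=
  (∏ S ∈ π.parts.erase (π.part 0), tau (∏ j ∈ S, g j)) • ∏ j ∈ π.part 0, g j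

/-- `J_π`: the points that are not the largest element of their block. -/
def J {n : ℕ} (π : SetPartition n) : Finset (Fin n) :=
  {j | ∃ k ∈ π.part j, j < k}

/-- `I_π(p)`: the points `j ≤ p` whose block contains some element greater than `p`. -/
def I {n : ℕ} (π : SetPartition n) (p : Fin n) : Finset (Fin n) :=
  {j | j ≤ p ∧ ∃ k ∈ π.part j, p < k}

/-- `t + ∑_{j ∈ I_π(p)} t_j` (note `I_π(p) ⊆ J_π`). -/
def shifted {n : ℕ} (π : SetPartition n) (t : ℝ) (x : ↥(J π) → ℝ) (p : Fin n) : ℝ :=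
  t + ∑ j : ↥(J π), if (j : Fin n) ∈ I π p then x j else 0

/-- The polytope `E(π, t)` of all `(t_j)_{j ∈ J_π}` with `t + ∑_{j ∈ I_π(p)} t_j ∈ [0,1]` for
`p = 1, …, n - 1`, where `n = m + 1`. The closed interval is used so that `t = 0` needs no separate
treatment. -/
def polytope {m : ℕ} (π : SetPartition (m + 1)) (t : ℝ) : Set (↥(J π) → ℝ) :=
  {x | ∀ p : Fin m, shifted π t x p.castSucc ∈ unitInterval}

/-- `Λ_π(g₁, …, g_{n-1})(t)`, where `n = m + 1` and `g_{p+1}` is `g p`. The extension of `g p` to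
the real line is only evaluated inside `[0,1]`. If `J_π` is empty, the integral is over a one-point
space with unit mass and the value is `∏ p, g p t`. -/
def Lam {m : ℕ} (π : SetPartition (m + 1)) (g : Fin m → CI) (t : unitInterval) : ℂ :=
  ∫ x in polytope π t, ∏ p : Fin m, Set.IccExtend zero_le_one (g p) (shifted π t x p.castSucc)

/-! ### The limiting `C[0,1]`-valued distribution -/

/-- `E : B⟨X, X*⟩ → B`, with `B = C[0,1]`, is linear, self-adjoint, `B`-bimodular, the identity on
`B`, makes `X` a `B`-valued R-diagonal element, and has the prescribed even alternating moments.
In the moments, `n = m + 1`, and `b₁, b₂, …, b_{2n}` are listed as `c 0, d 0, …, c m, d m`. -/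
structure IsLimitDistribution (E : NCPoly CI →ₗ[ℂ] CI) : Prop where
  condExp : IsCondExpectation NCPoly.incl E
  rDiagonal : IsRDiagonal NCPoly.incl E NCPoly.X
  moment_star_one : ∀ (m : ℕ) (c d : Fin (m + 1) → CI) (t : unitInterval),
    E (List.ofFn fun j => NCPoly.incl (c j) * star NCPoly.X * NCPoly.incl (d j) * NCPoly.X).prod t
      = ∑ π : SetPartition (m + 1), c 0 t * Lam π (fun p => c p.succ) t * tau (Gam π d)
  moment_one_star : ∀ (m : ℕ) (c d : Fin (m + 1) → CI) (t : unitInterval),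
    E (List.ofFn fun j => NCPoly.incl (c j) * NCPoly.X * NCPoly.incl (d j) * star NCPoly.X).prod t
      = ∑ π : SetPartition (m + 1),
          Gam π c t * tau (fun s => Lam π (fun p => d p.castSucc) s * d (Fin.last m) s)

/-! ### Random Vandermonde matrices -/

instance : MeasurableSpace Circle := borel Circle

instance : BorelSpace Circle := ⟨rfl⟩

/-- Normalized Haar measure on the unit circle. -/
def circleHaar : Measure Circle := Measure.haarMeasure ⊤

/-- The `N × N` Vandermonde matrix with `(i, j)` entry `N^{-1/2} z_i^j`, `1 ≤ i, j ≤ N` (so that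
the zero-based column index is increased by one). -/
def vandermonde {N : ℕ} (z : Fin N → Circle) : Matrix (Fin N) (Fin N) ℂ :=
  Matrix.of fun i j => ((Real.sqrt N : ℝ) : ℂ)⁻¹ * (z i : ℂ) ^ (j.val + 1)

/-- The point `(j + 1) / N` of `[0,1]`. -/
def gridPoint {N : ℕ} (j : Fin N) : unitInterval :=
  ⟨((j.val + 1 : ℕ) : ℝ) / N, by positivity,
    div_le_one_of_le₀ (by exact_mod_cast j.isLt) (by positivity)⟩

/-- `D_N(b) = diag(b(1/N), b(2/N), …, b(N/N))`. -/
def sampleDiag (N : ℕ) (b : CI) : Matrix (Fin N) (Fin N) ℂ :=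
  Matrix.diagonal fun j => b (gridPoint j)

/-- The normalized trace. -/
def ntrace {N : ℕ} (M : Matrix (Fin N) (Fin N) ℂ) : ℂ := (N : ℂ)⁻¹ * M.trace

end RandomVandermonde

end

/-! Both halves of the theorem rest on the filtration of `B⟨X, X*⟩` by word length. Cutting a word
into its maximal alternating intervals and centering each interval changes the word only by shorter
words (`prod_centered_sub_mem`). An R-diagonal functional kills the centered product, so its value
on a word is determined by its values on shorter words and on alternating words; the latter are
prescribed in even length and vanish in odd length. This gives uniqueness
(`IsLimitDistribution.unique`).

The functional is not built algebraically but obtained from the matrices, as a weak limit: `HasLim a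
f` tests the evaluations of `a` against all diagonal matrices. The function `f` is unique because
`tau` is faithful, and linearity, bimodularity and self-adjointness pass to the limit. The asserted
convergence then holds by construction. What remains is that every `a` has a limit, and that the
limits of alternating words and of centered products are the right ones.

Alternating words: an entry is a sum over paths that alternate between row indices of the
Vandermonde matrix (bases, selecting a variable) and column indices (exponents). Integration over
the torus keeps the paths with trivial monomial. If the bases have kernel `π`, this means that the
increments of the exponents add up to zero on every block of `π`. The sum over the bases tends to
`Γ_π`; the exponents, parametrized by their increments on `J π`, form a Riemann sum for `Λ_π`. Both
limits are uniform along the diagonal (`hasDiag_oneStar`, `hasDiag_starOne`). In odd length no path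
is balanced (`altDeg_ne_zero_of_odd`).

Centered products (`tendsto_ntrace_centered`): each factor is expanded into paths and a centering
term, and a factor is called isolated if its bases are disjoint from those of all other factors.
Families without isolated factor are counted by linear algebra (`card_flow_le`, `card_noniso_le`)
and contribute `O(√N)` before the division by `N`. If a factor is isolated, its balance equation
separates from the rest, and by centering its partial sums are at most `δ` on the diagonal plus `C /
N` in every entry (`HasDiag.hasSymbol`). Replacing the factor by this bound and all other weights by
their absolute values leaves two quantities: `δ` times the normalized trace of a shorter product,
which is bounded by induction, and a multiple of `N⁻²` times the sum of all entries of such a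
product. The latter tends to zero (`tendsto_sum_entries`), because the sum of the entries of a
matrix is at most `N` times its operator norm, and the even moments bound the expectation of any
power of the norm by a multiple of `√N`. -/

namespace RandomVandermonde

/-! ### Words in `B⟨X, X*⟩` -/

namespace NCPoly

section Words

variable {B : Type*} [Ring B] [StarRing B] [Algebra ℂ B] [StarModule ℂ B]

/-- The word `b₁ X^{ε₁} ⋯ b_n X^{ε_n}` given by a list of coefficients and letters. -/
noncomputable def letterWord (L : List (B × Bool)) : NCPoly B :=
  (L.map fun p => incl p.1 * starPow X p.2).prod

@[simp] theorem letterWord_nil : letterWord ([] : List (B × Bool)) = 1 := rfl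

@[simp] theorem letterWord_cons (p : B × Bool) (L : List (B × Bool)) :
    letterWord (p :: L) = incl p.1 * starPow X p.2 * letterWord L := by
  simp [letterWord]

theorem letterWord_append (L L' : List (B × Bool)) :
    letterWord (L ++ L') = letterWord L * letterWord L' := by
  simp [letterWord]

theorem starPow_X (ε : Bool) : starPow (X : NCPoly B) ε = gen (Sum.inr ε) := by
  cases ε
  · rfl
  · exact star_gen_inr false

/-- The span of the words with fewer than `n` letters. -/
noncomputable def shortWords (B : Type*) [Ring B] [StarRing B] [Algebra ℂ B] [StarModule ℂ B]
    (n : ℕ) : Submodule ℂ (NCPoly B) :=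
  Submodule.span ℂ {a | ∃ (L : List (B × Bool)) (c : B), L.length < n ∧ a = letterWord L * incl c}

theorem letterWord_mul_incl_mem {n : ℕ} {L : List (B × Bool)} (h : L.length < n) (c : B) :
    letterWord L * incl c ∈ shortWords B n :=
  Submodule.subset_span ⟨L, c, h, rfl⟩

theorem letterWord_mem {n : ℕ} {L : List (B × Bool)} (h : L.length < n) :
    letterWord L ∈ shortWords B n := by
  simpa using letterWord_mul_incl_mem h 1

theorem incl_mem {n : ℕ} (h : 0 < n) (c : B) : incl c ∈ shortWords B n := by
  simpa using letterWord_mul_incl_mem (L := []) h c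

theorem shortWords_mono {m n : ℕ} (h : m ≤ n) : shortWords B m ≤ shortWords B n :=
  Submodule.span_mono fun _ ⟨L, c, hL, ha⟩ => ⟨L, c, hL.trans_le h, ha⟩

/-- The coefficient in the middle is absorbed into the first coefficient of the second word, so no
letter is gained. -/
theorem word_mul_word_mem {n : ℕ} {L L' : List (B × Bool)} (h : L.length + L'.length < n)
    (c c' : B) : letterWord L * incl c * (letterWord L' * incl c') ∈ shortWords B n := by
  cases L' with
  | nil =>
    have := letterWord_mul_incl_mem (n := n) (L := L) (by simpa using h) (c * c')
    simpa [mul_assoc] using this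
  | cons p L' =>
    have := letterWord_mul_incl_mem (n := n) (L := L ++ (c * p.1, p.2) :: L') (by simpa using h) c'
    simpa [letterWord_append, mul_assoc] using this

theorem mul_mem_shortWords {m n k : ℕ} (h : m + n ≤ k + 1) {a b : NCPoly B}
    (ha : a ∈ shortWords B m) (hb : b ∈ shortWords B n) : a * b ∈ shortWords B k := by
  have := Submodule.mul_mem_mul ha hb
  rw [shortWords, shortWords, Submodule.span_mul_span] at this
  refine Submodule.span_le.2 ?_ this
  rintro _ ⟨_, ⟨L, c, hL, rfl⟩, _, ⟨L', c', hL', rfl⟩, rfl⟩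
  exact word_mul_word_mem (by omega) c c'

/-- The filtration by length is exhaustive, which is what makes induction on it a proof about all
elements. -/
theorem exists_mem_shortWords (a : NCPoly B) : ∃ n, a ∈ shortWords B n := by
  obtain ⟨x, rfl⟩ : ∃ x, mk x = a := RingQuot.mkAlgHom_surjective ℂ (Rel B) a
  induction x using FreeAlgebra.induction with
  | grade0 r =>
    refine ⟨1, ?_⟩
    rw [AlgHom.commutes, Algebra.algebraMap_eq_smul_one]
    exact Submodule.smul_mem _ _ (letterWord_mem (L := []) one_pos)
  | grade1 g =>
    refine ⟨2, ?_⟩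
    rcases g with b | s
    · exact incl_mem two_pos b
    · have := letterWord_mem (B := B) (n := 2) (L := [(1, s)]) (by simp)
      rwa [letterWord_cons, letterWord_nil, map_one, one_mul, mul_one, starPow_X] at this
  | mul x y hx hy =>
    obtain ⟨m, hm⟩ := hx
    obtain ⟨n, hn⟩ := hy
    rw [map_mul]
    exact ⟨m + n, mul_mem_shortWords (by omega) hm hn⟩
  | add x y hx hy =>
    obtain ⟨m, hm⟩ := hx
    obtain ⟨n, hn⟩ := hy
    rw [map_add]
    exact ⟨m + n, Submodule.add_mem _ (shortWords_mono (by omega) hm)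
      (shortWords_mono (by omega) hn)⟩

/-- A product of centered words differs from the product of the words by shorter words. -/
theorem prod_centered_sub_mem (f : List (B × Bool) → B) (Ls : List (List (B × Bool)))
    (h : [] ∉ Ls) :
    (Ls.map fun L => letterWord L - incl (f L)).prod - letterWord Ls.flatten
      ∈ shortWords B Ls.flatten.length := by
  induction Ls with
  | nil => simp
  | cons L Ls ih =>
    have hL : L ≠ [] := fun h' => h (by simp [h'])
    have hlen : 0 < L.length := List.length_pos_of_ne_nil hL
    have ih := ih (fun h' => h (by simp [h']))
    set W := letterWord Ls.flatten with hW
    set Q := (Ls.map fun L => letterWord L - incl (f L)).prod with hQ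
    have hQm : Q ∈ shortWords B (Ls.flatten.length + 1) := by
      have := Submodule.add_mem _ (shortWords_mono (Nat.le_succ _) ih)
        (letterWord_mem (n := Ls.flatten.length + 1) (L := Ls.flatten) (by simp))
      rwa [← hW, sub_add_cancel] at this
    rw [List.flatten_cons, letterWord_append, List.map_cons, List.prod_cons, ← hW, ← hQ,
      List.length_append]
    -- The first term on the right replaces the tail by shorter words. The second loses all letters
    -- of `L`, and there is at least one since `L` is nonempty.
    have e : (letterWord L - incl (f L)) * Q - letterWord L * W
        = letterWord L * (Q - W) - incl (f L) * Q := by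
      rw [sub_mul, mul_sub]; abel
    rw [e]
    refine Submodule.sub_mem _ ?_ ?_
    · exact mul_mem_shortWords (m := L.length + 1) (by omega) (letterWord_mem (by omega)) ih
    · exact mul_mem_shortWords (m := 1) (by omega) (incl_mem one_pos _) hQm

/-- The alternating word with letters `X*, X, X*, …, X`. -/
noncomputable def starOneWord (P : List (B × B)) : NCPoly B :=
  (P.map fun p => incl p.1 * star X * incl p.2 * X).prod

/-- The alternating word with letters `X, X*, X, …, X*`. -/
noncomputable def oneStarWord (P : List (B × B)) : NCPoly B :=
  (P.map fun p => incl p.1 * X * incl p.2 * star X).prod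

@[simp] theorem starOneWord_nil : starOneWord ([] : List (B × B)) = 1 := rfl

@[simp] theorem oneStarWord_nil : oneStarWord ([] : List (B × B)) = 1 := rfl

@[simp] theorem starOneWord_cons (p : B × B) (P : List (B × B)) :
    starOneWord (p :: P) = incl p.1 * star X * incl p.2 * X * starOneWord P := by
  simp [starOneWord]

@[simp] theorem oneStarWord_cons (p : B × B) (P : List (B × B)) :
    oneStarWord (p :: P) = incl p.1 * X * incl p.2 * star X * oneStarWord P := by
  simp [oneStarWord]

/-- The consecutive letters of the word are different. -/
def IsAlternating (L : List (B × Bool)) : Prop := L.IsChain fun p q => p.2 ≠ q.2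

/-- Alternating words are sorted by first letter and parity of the length, two letters being peeled
off at a time. The even types are those with prescribed moments; the odd types are brought into the
shape in which R-diagonality makes them vanish. -/
theorem alternating_cases (T : List (B × Bool)) : ∀ (b : B) (ε : Bool),
    IsAlternating ((b, ε) :: T) →
    (ε = true →
      (∃ P, P ≠ [] ∧ T.length + 1 = 2 * P.length ∧ letterWord ((b, ε) :: T) = starOneWord P) ∨
      ∃ P c, T.length + 1 = 2 * P.length + 1 ∧
        letterWord ((b, ε) :: T) = starOneWord P * (incl c * star X)) ∧
    (ε = false →
      (∃ P, P ≠ [] ∧ T.length + 1 = 2 * P.length ∧ letterWord ((b, ε) :: T) = oneStarWord P) ∨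
      ∃ P c, T.length + 1 = 2 * P.length + 1 ∧
        letterWord ((b, ε) :: T) = incl c * (X * starOneWord P)) := by
  induction hn : T.length using Nat.strong_induction_on generalizing T with
  | _ n ih =>
  intro b ε h
  match T, hn, h with
  | [], hn, h =>
    subst hn
    refine ⟨?_, ?_⟩
    · rintro rfl
      exact Or.inr ⟨[], b, by simp, by simp [starPow]⟩
    · rintro rfl
      exact Or.inr ⟨[], b, by simp, by simp [starPow]⟩
  | [(b', ε')], hn, h =>
    have hε : ε ≠ ε' := by simpa [IsAlternating] using h
    refine ⟨?_, ?_⟩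
    · rintro rfl
      obtain rfl : ε' = false := by simpa using hε.symm
      refine Or.inl ⟨[(b, b')], by simp, by subst hn; simp, ?_⟩
      simp [starPow, mul_assoc]
    · rintro rfl
      obtain rfl : ε' = true := by simpa using hε.symm
      refine Or.inl ⟨[(b, b')], by simp, by subst hn; simp, ?_⟩
      simp [starPow, mul_assoc]
  | (b', ε') :: (b'', ε'') :: T, hn, h =>
    obtain ⟨hε, hε', h'⟩ : ε ≠ ε' ∧ ε' ≠ ε'' ∧ IsAlternating ((b'', ε'') :: T) := by
      simpa [IsAlternating] using h
    have hn' : T.length < n := by subst hn; simp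
    obtain ⟨h1, h2⟩ := ih T.length hn' T rfl b'' ε'' h'
    refine ⟨?_, ?_⟩
    · rintro rfl
      obtain rfl : ε' = false := by simpa using hε.symm
      obtain rfl : ε'' = true := by simpa using hε'.symm
      rcases h1 rfl with ⟨P, _, hl, hP⟩ | ⟨P, c, hl, hP⟩
      · refine Or.inl ⟨(b, b') :: P, by simp, by subst hn; simp at hl ⊢; omega, ?_⟩
        rw [letterWord_cons, letterWord_cons, hP]
        simp [starPow, mul_assoc]
      · refine Or.inr ⟨(b, b') :: P, c, by subst hn; simp at hl ⊢; omega, ?_⟩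
        rw [letterWord_cons, letterWord_cons, hP]
        simp [starPow, mul_assoc]
    · rintro rfl
      obtain rfl : ε' = true := by simpa using hε.symm
      obtain rfl : ε'' = false := by simpa using hε'.symm
      rcases h2 rfl with ⟨P, _, hl, hP⟩ | ⟨P, c, hl, hP⟩
      · refine Or.inl ⟨(b, b') :: P, by simp, by subst hn; simp at hl ⊢; omega, ?_⟩
        rw [letterWord_cons, letterWord_cons, hP]
        simp [starPow, mul_assoc]
      · refine Or.inr ⟨(b', c) :: P, b, by subst hn; simp at hl ⊢; omega, ?_⟩
        rw [letterWord_cons, letterWord_cons, hP]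
        simp [starPow, mul_assoc]

theorem starOneWord_append (P Q : List (B × B)) :
    starOneWord (P ++ Q) = starOneWord P * starOneWord Q := by
  simp [starOneWord]

/-- R-diagonality lists only the odd words that begin and end with `X`. Those that begin and end
with `X*` are reduced to them by the involution. -/
theorem star_starOneWord_mul (P : List (B × B)) (c : B) :
    ∃ Q e, star (starOneWord P * (incl c * star X)) = X * starOneWord Q * incl e := by
  induction P with
  | nil => exact ⟨[], star c, by simp [← map_star]⟩
  | cons p P ih =>
    obtain ⟨Q, e, h⟩ := ih
    refine ⟨Q ++ [(e, star p.2)], star p.1, ?_⟩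
    rw [starOneWord_cons, mul_assoc, star_mul, h, starOneWord_append]
    simp [mul_assoc, ← map_star]

theorem starOneWord_eq_ofFn (P : List (B × B)) :
    starOneWord P = (List.ofFn fun j : Fin P.length =>
      incl (P.get j).1 * star X * incl (P.get j).2 * X).prod := by
  conv_lhs => rw [starOneWord, ← List.ofFn_get P, List.map_ofFn]
  rfl

theorem oneStarWord_eq_ofFn (P : List (B × B)) :
    oneStarWord P = (List.ofFn fun j : Fin P.length =>
      incl (P.get j).1 * X * incl (P.get j).2 * star X).prod := by
  conv_lhs => rw [oneStarWord, ← List.ofFn_get P, List.map_ofFn]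
  rfl

theorem isCondExpectation_mul {E : NCPoly B →ₗ[ℂ] B} (h : IsCondExpectation incl E)
    (a : NCPoly B) (c : B) : E (a * incl c) = E a * c := by
  simpa using h.bimodular 1 a c

theorem isCondExpectation_incl_mul {E : NCPoly B →ₗ[ℂ] B} (h : IsCondExpectation incl E)
    (a : NCPoly B) (c : B) : E (incl c * a) = c * E a := by
  simpa using h.bimodular c a 1

/-- The first identity is the vanishing condition up to a left coefficient; the second follows from
it because `E` is self-adjoint. -/
theorem condExp_oddAlternating {E : NCPoly B →ₗ[ℂ] B} (h : IsCondExpectation incl E)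
    (hR : IsRDiagonal incl E X) (P : List (B × B)) (c : B) :
    E (incl c * (X * starOneWord P)) = 0 ∧ E (starOneWord P * (incl c * star X)) = 0 := by
  have key : ∀ P : List (B × B), E (X * starOneWord P) = 0 := fun P => by
    rw [starOneWord_eq_ofFn]
    exact hR.odd_alternating _ _ _
  refine ⟨by rw [isCondExpectation_incl_mul h, key, mul_zero], ?_⟩
  obtain ⟨Q, e, hQ⟩ := star_starOneWord_mul P c
  rw [← star_star (starOneWord P * (incl c * star X)), h.map_star, hQ, isCondExpectation_mul h,
    key, zero_mul, star_zero]

/-- The alternating intervals of a word. -/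
def intervals {n : ℕ} (b : Fin n → B) (ε : Fin n → Bool) : List (List (B × Bool)) :=
  (altIntervals ε).map fun I => I.map fun j => (b j, ε j)

theorem letterWord_map {n : ℕ} (b : Fin n → B) (ε : Fin n → Bool) (I : List (Fin n)) :
    letterWord (I.map fun j => (b j, ε j)) = word incl X b ε I := by
  simp [letterWord, word, Function.comp_def]

theorem prod_centered_intervals (E : NCPoly B →ₗ[ℂ] B) {n : ℕ} (b : Fin n → B)
    (ε : Fin n → Bool) :
    ((altIntervals ε).map fun I => word incl X b ε I - incl (E (word incl X b ε I))).prod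
      = ((intervals b ε).map fun L => letterWord L - incl (E (letterWord L))).prod := by
  rw [intervals, List.map_map]
  congr 2
  funext I
  simp [letterWord_map]

theorem flatten_intervals {B : Type*} {n : ℕ} (b : Fin n → B) (ε : Fin n → Bool) :
    (intervals b ε).flatten = List.ofFn fun j => (b j, ε j) := by
  rw [intervals, ← List.map_flatten, altIntervals, List.flatten_splitBy, List.ofFn_eq_map]

theorem nil_notMem_intervals {B : Type*} {n : ℕ} (b : Fin n → B) (ε : Fin n → Bool) :
    [] ∉ intervals b ε := by
  intro h
  obtain ⟨I, hI, h⟩ := List.mem_map.1 h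
  rw [List.map_eq_nil_iff] at h
  subst h
  exact List.nil_notMem_splitBy _ _ hI

theorem isAlternating_of_mem_intervals {B : Type*} {n : ℕ} {b : Fin n → B} {ε : Fin n → Bool}
    {L : List (B × Bool)} (h : L ∈ intervals b ε) : IsAlternating L := by
  obtain ⟨I, hI, rfl⟩ := List.mem_map.1 h
  have := List.isChain_of_mem_splitBy hI
  rw [IsAlternating, List.isChain_map]
  exact this.imp fun i j hij => by simpa using hij

theorem letterWord_ofFn {n : ℕ} (b : Fin n → B) (ε : Fin n → Bool) :
    letterWord (List.ofFn fun j => (b j, ε j))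
      = (List.ofFn fun j => incl (b j) * starPow X (ε j)).prod := by
  rw [letterWord, List.map_ofFn]; rfl

end Words

end NCPoly

/-! ### Uniqueness of the limiting distribution -/

open NCPoly

/-- In even length both sides are given by the same moment formula, and in odd length both are zero.
-/
theorem IsLimitDistribution.letterWord_eq {E E' : NCPoly CI →ₗ[ℂ] CI}
    (hE : IsLimitDistribution E) (hE' : IsLimitDistribution E') {L : List (CI × Bool)}
    (hL : IsAlternating L) (hne : L ≠ []) : E (letterWord L) = E' (letterWord L) := by
  obtain ⟨⟨b, ε⟩, T, rfl⟩ := List.exists_cons_of_ne_nil hne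
  obtain ⟨h1, h2⟩ := alternating_cases T b ε hL
  cases ε
  · rcases h2 rfl with ⟨P, hP, -, h⟩ | ⟨P, c, -, h⟩
    · rw [h, oneStarWord_eq_ofFn]
      obtain ⟨m, hm⟩ : ∃ m, P.length = m + 1 :=
        Nat.exists_eq_succ_of_ne_zero (by simpa using hP)
      generalize P.get = g
      revert g
      rw [hm]
      intro g
      ext t
      rw [hE.moment_one_star, hE'.moment_one_star]
    · rw [h, (condExp_oddAlternating hE.condExp hE.rDiagonal P c).1,
        (condExp_oddAlternating hE'.condExp hE'.rDiagonal P c).1]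
  · rcases h1 rfl with ⟨P, hP, -, h⟩ | ⟨P, c, -, h⟩
    · rw [h, starOneWord_eq_ofFn]
      obtain ⟨m, hm⟩ : ∃ m, P.length = m + 1 :=
        Nat.exists_eq_succ_of_ne_zero (by simpa using hP)
      generalize P.get = g
      revert g
      rw [hm]
      intro g
      ext t
      rw [hE.moment_star_one, hE'.moment_star_one]
    · rw [h, (condExp_oddAlternating hE.condExp hE.rDiagonal P c).2,
        (condExp_oddAlternating hE'.condExp hE'.rDiagonal P c).2]

/-- Induction on the length: a word is a centered product, which is annihilated, minus a combination
of shorter words. -/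
theorem IsLimitDistribution.unique {E E' : NCPoly CI →ₗ[ℂ] CI}
    (hE : IsLimitDistribution E) (hE' : IsLimitDistribution E') : E = E' := by
  have key : ∀ n, ∀ a ∈ shortWords CI n, E a = E' a := by
    intro n
    induction n with
    | zero =>
      intro a ha
      have : a ∈ (⊥ : Submodule ℂ (NCPoly CI)) := by simpa [shortWords] using ha
      rw [(Submodule.mem_bot ℂ).1 this, map_zero, map_zero]
    | succ n ih =>
      intro a ha
      induction ha using Submodule.span_induction with
      | zero => rw [map_zero, map_zero]
      | add x y _ _ hx hy => rw [map_add, map_add, hx, hy]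
      | smul r x _ hx => rw [map_smul, map_smul, hx]
      | mem x hx =>
        obtain ⟨L, c, hL, rfl⟩ := hx
        rw [isCondExpectation_mul hE.condExp, isCondExpectation_mul hE'.condExp]
        congr 1
        rcases Nat.lt_succ_iff_lt_or_eq.1 hL with hL | hL
        · exact ih _ (letterWord_mem hL)
        rcases Nat.eq_zero_or_pos n with rfl | hn
        · rw [List.length_eq_zero_iff] at hL
          subst hL
          have h1 := hE.condExp.map_incl 1
          have h2 := hE'.condExp.map_incl 1
          rw [map_one] at h1 h2
          rw [letterWord_nil, h1, h2]
        · obtain ⟨b, ε, rfl⟩ : ∃ (b : Fin n → CI) (ε : Fin n → Bool),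
              L = List.ofFn fun j => (b j, ε j) := by
            subst hL
            exact ⟨fun j => (L.get j).1, fun j => (L.get j).2, (List.ofFn_get L).symm⟩
          have h1 := hE.rDiagonal.centered n hn ε b
          have h2 := hE'.rDiagonal.centered n hn ε b
          rw [prod_centered_intervals] at h1 h2
          have hmem := prod_centered_sub_mem (fun L => E (letterWord L)) (intervals b ε)
            (nil_notMem_intervals b ε)
          -- The centering constants of `E` and `E'` agree since the intervals are alternating.
          -- Hence both functionals vanish on one and the same product.
          have heq : ((intervals b ε).map fun L => letterWord L - incl (E (letterWord L)))
              = (intervals b ε).map fun L => letterWord L - incl (E' (letterWord L)) := by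
            refine List.map_congr_left fun L hL => ?_
            rw [hE.letterWord_eq hE' (isAlternating_of_mem_intervals hL)]
            rintro rfl
            exact nil_notMem_intervals b ε hL
          rw [flatten_intervals, List.length_ofFn] at hmem
          have := ih _ hmem
          rw [map_sub, map_sub, h1, heq, h2] at this
          simpa using this
  ext1 a
  obtain ⟨n, hn⟩ := exists_mem_shortWords a
  exact key n a hn

/-! ### Laurent monomials on the torus -/

instance : IsProbabilityMeasure circleHaar :=
  ⟨by
    have h := Measure.haarMeasure_self (K₀ := (⊤ : TopologicalSpace.PositiveCompacts Circle))
    rwa [TopologicalSpace.PositiveCompacts.coe_top] at h⟩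

instance : circleHaar.IsMulLeftInvariant :=
  inferInstanceAs (Measure.haarMeasure _).IsMulLeftInvariant

/-- The law of `N` independent Haar distributed points of the unit circle. -/
noncomputable def torusHaar (N : ℕ) : Measure (Fin N → Circle) := Measure.pi fun _ => circleHaar

instance (N : ℕ) : IsProbabilityMeasure (torusHaar N) := by
  unfold torusHaar; infer_instance

theorem integrable_torus {N : ℕ} {E : Type*} [NormedAddCommGroup E] {f : (Fin N → Circle) → E}
    (hf : Continuous f) : Integrable f (torusHaar N) :=
  hf.integrable_of_hasCompactSupport (HasCompactSupport.of_compactSpace f)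

/-- For `n ≠ 0`, translation by a point whose `n`-th power is `-1` preserves Haar measure and
changes the sign of the integral. -/
theorem integral_circle_zpow (n : ℤ) :
    ∫ z, ((z ^ n : Circle) : ℂ) ∂circleHaar = if n = 0 then 1 else 0 := by
  split_ifs with hn
  · subst hn; simp
  · set w : Circle := Circle.exp (Real.pi / n)
    have hw : ((w ^ n : Circle) : ℂ) = -1 := by
      rw [← Circle.exp_zsmul, zsmul_eq_mul, mul_div_cancel₀ _ (by exact_mod_cast hn)]
      simp
    have h := integral_mul_left_eq_self (μ := circleHaar)
      (fun z : Circle => ((z ^ n : Circle) : ℂ)) w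
    simp only [mul_zpow, Circle.coe_mul, hw] at h
    rw [integral_const_mul] at h
    have h2 : (2 : ℂ) * ∫ z, ((z ^ n : Circle) : ℂ) ∂circleHaar = 0 := by linear_combination -h
    simpa using h2

/-- The Laurent monomial with exponents `α`. -/
noncomputable def monom {N : ℕ} (z : Fin N → Circle) (α : Fin N → ℤ) : ℂ :=
  ∏ y, ((z y ^ α y : Circle) : ℂ)

theorem monom_zero {N : ℕ} (z : Fin N → Circle) : monom z 0 = 1 := by simp [monom]

theorem monom_add {N : ℕ} (z : Fin N → Circle) (α β : Fin N → ℤ) :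
    monom z (α + β) = monom z α * monom z β := by
  simp [monom, zpow_add, Finset.prod_mul_distrib]

theorem monom_sum {N : ℕ} {ι : Type*} (z : Fin N → Circle) (s : Finset ι) (α : ι → Fin N → ℤ) :
    monom z (∑ i ∈ s, α i) = ∏ i ∈ s, monom z (α i) := by
  classical
  induction s using Finset.induction_on with
  | empty => simp [monom_zero]
  | insert a s ha ih => rw [Finset.sum_insert ha, Finset.prod_insert ha, monom_add, ih]

theorem monom_single {N : ℕ} (z : Fin N → Circle) (y : Fin N) (n : ℤ) :
    monom z (Pi.single y n) = ((z y ^ n : Circle) : ℂ) := by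
  rw [monom, Finset.prod_eq_single y]
  · simp
  · intro x _ hx; simp [hx]
  · simp

theorem continuous_monom {N : ℕ} (α : Fin N → ℤ) :
    Continuous fun z : Fin N → Circle => monom z α := by
  unfold monom
  refine continuous_finsetProd _ fun y _ => ?_
  have h : Continuous fun z : Fin N → Circle => z y ^ α y := (continuous_apply y).zpow _
  exact Continuous.comp (g := fun w : Circle => (w : ℂ)) (by fun_prop) h

theorem integral_monom {N : ℕ} (α : Fin N → ℤ) :
    ∫ z, monom z α ∂torusHaar N = if α = 0 then 1 else 0 := by
  unfold monom torusHaar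
  rw [integral_fintype_prod_eq_prod (fun (y : Fin N) (w : Circle) => ((w ^ α y : Circle) : ℂ))]
  simp_rw [integral_circle_zpow]
  rw [Finset.prod_ite_zero]
  simp [funext_iff]

/-- Orthogonality of monomials turns expectations into counting problems: after the product is
expanded, only families with total exponent zero survive. -/
theorem integral_prod_terms {N : ℕ} {ι : Type*} [Fintype ι] [DecidableEq ι] {Θ : ι → Type*}
    [∀ i, Fintype (Θ i)]
    (p : ∀ i, Θ i → Prop) [∀ i, DecidablePred (p i)] (wt : ∀ i, Θ i → ℂ)
    (α : ∀ i, Θ i → Fin N → ℤ) :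
    ∫ z, ∏ i, ∑ θ : Θ i, (if p i θ then wt i θ * monom z (α i θ) else 0) ∂torusHaar N
      = ∑ θ : ∀ i, Θ i, if (∀ i, p i (θ i)) ∧ ∑ i, α i (θ i) = 0 then ∏ i, wt i (θ i) else 0 := by
  have h1 : ∀ z, (∏ i, ∑ θ : Θ i, (if p i θ then wt i θ * monom z (α i θ) else 0))
      = ∑ θ : ∀ i, Θ i, (if ∀ i, p i (θ i) then ∏ i, wt i (θ i) else 0)
          * monom z (∑ i, α i (θ i)) := by
    intro z
    rw [Finset.prod_univ_sum]
    simp only [Fintype.piFinset_univ]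
    refine Finset.sum_congr rfl fun θ _ => ?_
    rw [monom_sum, Finset.prod_ite_zero]
    simp only [Finset.mem_univ, true_imp_iff]
    split_ifs
    · rw [Finset.prod_mul_distrib]
    · rw [zero_mul]
  simp_rw [h1]
  rw [integral_finsetSum _ fun θ _ =>
    (integrable_torus (continuous_monom _)).const_mul _]
  refine Finset.sum_congr rfl fun θ _ => ?_
  rw [integral_const_mul, integral_monom]
  split_ifs <;> simp_all

/-! ### Evaluation at random Vandermonde matrices -/

/-- The entry formula for a product of matrices, as a sum over paths. -/
theorem prod_ofFn_apply {R ι : Type*} [CommSemiring R] [Fintype ι] [DecidableEq ι] {m : ℕ}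
    (M : Fin m → Matrix ι ι R) (k l : ι) :
    (List.ofFn M).prod k l = ∑ K : Fin (m + 1) → ι,
      if K 0 = k ∧ K (Fin.last m) = l then ∏ j : Fin m, M j (K j.castSucc) (K j.succ) else 0 := by
  induction m generalizing k with
  | zero =>
    simp only [List.ofFn_zero, List.prod_nil, Matrix.one_apply]
    rw [← Equiv.sum_comp (Equiv.funUnique (Fin 1) ι).symm]
    simp only [Equiv.funUnique_symm_apply, uniqueElim_const, Fin.last_zero,
      Finset.univ_eq_empty, Finset.prod_empty]
    by_cases h : k = l
    · subst h; simp
    · rw [if_neg h, Finset.sum_eq_zero]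
      intro x _
      rw [if_neg]
      rintro ⟨rfl, rfl⟩
      exact h rfl
  | succ m ih =>
    rw [List.ofFn_succ, List.prod_cons, Matrix.mul_apply]
    simp_rw [ih]
    have h1 : ∀ x, M 0 k x * (∑ K : Fin (m + 1) → ι, if K 0 = x ∧ K (Fin.last m) = l then
          ∏ j : Fin m, M j.succ (K j.castSucc) (K j.succ) else 0)
        = ∑ K : Fin (m + 1) → ι, if K 0 = x then (if K (Fin.last m) = l then
          M 0 k (K 0) * ∏ j : Fin m, M j.succ (K j.castSucc) (K j.succ) else 0) else 0 := by
      intro x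
      rw [Finset.mul_sum]
      refine Finset.sum_congr rfl fun K _ => ?_
      by_cases hx : K 0 = x
      · simp [hx]
      · simp [hx]
    simp_rw [h1]
    rw [Finset.sum_comm, ← Equiv.sum_comp (Fin.consEquiv fun _ : Fin (m + 2) => ι),
      Fintype.sum_prod_type_right]
    refine Finset.sum_congr rfl fun K _ => ?_
    rw [Finset.sum_ite_eq, if_pos (Finset.mem_univ _), Finset.sum_eq_single k]
    · rw [Fin.prod_univ_succ]
      simp [Fin.consEquiv, ← Fin.succ_last]
    · intro x _ hx
      simp [Fin.consEquiv, hx]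
    · simp

/-- `b ↦ D_N(b)` as a homomorphism of algebras. -/
noncomputable def sampleHom (N : ℕ) : CI →ₐ[ℂ] Matrix (Fin N) (Fin N) ℂ where
  toFun b := sampleDiag N b
  map_one' := by ext i j; simp [sampleDiag]
  map_mul' b c := by simp [sampleDiag]
  map_zero' := by simp [sampleDiag]
  map_add' b c := by simp [sampleDiag, Matrix.diagonal_add]
  commutes' r := by ext i j; simp [sampleDiag, Matrix.algebraMap_matrix_apply, Matrix.diagonal_apply]

/-- Evaluation of `B⟨X, X*⟩` at the Vandermonde matrix of `z`. -/
noncomputable def evalAt {N : ℕ} (z : Fin N → Circle) :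
    NCPoly CI →ₐ[ℂ] Matrix (Fin N) (Fin N) ℂ :=
  NCPoly.lift (sampleHom N) fun s => starPow (vandermonde z) s

theorem evalAt_incl {N : ℕ} (z : Fin N → Circle) (b : CI) :
    evalAt z (incl b) = sampleDiag N b :=
  lift_gen _ _ (Sum.inl b)

theorem evalAt_starPow {N : ℕ} (z : Fin N → Circle) (ε : Bool) :
    evalAt z (starPow X ε) = starPow (vandermonde z) ε := by
  rw [starPow_X]; exact lift_gen _ _ (Sum.inr ε)

theorem evalAt_word {N m : ℕ} (z : Fin N → Circle) (b : Fin m → CI) (ε : Fin m → Bool) :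
    evalAt z (List.ofFn fun j => incl (b j) * starPow X (ε j)).prod
      = (List.ofFn fun j => sampleDiag N (b j) * starPow (vandermonde z) (ε j)).prod := by
  rw [map_list_prod, List.map_ofFn]
  congr 2
  funext j
  simp [evalAt_incl, evalAt_starPow]

theorem star_sampleDiag (N : ℕ) (b : CI) : star (sampleDiag N b) = sampleDiag N (star b) := by
  rw [sampleDiag, Matrix.star_eq_conjTranspose, Matrix.diagonal_conjTranspose]
  rfl

theorem evalAt_star {N : ℕ} (z : Fin N → Circle) (a : NCPoly CI) :
    evalAt z (star a) = star (evalAt z a) := by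
  obtain ⟨x, rfl⟩ : ∃ x, NCPoly.mk x = a := RingQuot.mkAlgHom_surjective ℂ (Rel CI) a
  induction x using FreeAlgebra.induction with
  | grade0 r =>
    rw [AlgHom.commutes, star_algebraMap_aux, AlgHom.commutes, AlgHom.commutes,
      algebraMap_star_comm]
  | grade1 g =>
    rcases g with b | s
    · change evalAt z (star (gen (Sum.inl b))) = star (evalAt z (gen (Sum.inl b)))
      rw [star_gen_inl]
      change evalAt z (incl (star b)) = star (evalAt z (incl b))
      rw [evalAt_incl, evalAt_incl, star_sampleDiag]
    · change evalAt z (star (gen (Sum.inr s))) = star (evalAt z (gen (Sum.inr s)))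
      rw [star_gen_inr, ← starPow_X, ← starPow_X, evalAt_starPow, evalAt_starPow]
      cases s <;> simp [starPow]
  | mul x y hx hy => rw [map_mul, star_mul, map_mul, map_mul, star_mul, hx, hy]
  | add x y hx hy => rw [map_add, star_add, map_add, map_add, star_add, hx, hy]

theorem continuous_vandermonde (N : ℕ) :
    Continuous fun z : Fin N → Circle => vandermonde z := by
  refine continuous_matrix fun i j => ?_
  simp only [vandermonde, Matrix.of_apply]
  fun_prop

theorem continuous_evalAt {N : ℕ} (a : NCPoly CI) :
    Continuous fun z : Fin N → Circle => evalAt z a := by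
  obtain ⟨x, rfl⟩ : ∃ x, NCPoly.mk x = a := RingQuot.mkAlgHom_surjective ℂ (Rel CI) a
  induction x using FreeAlgebra.induction with
  | grade0 r => simp_rw [AlgHom.commutes]; exact continuous_const
  | grade1 g =>
    rcases g with b | s
    · change Continuous fun z : Fin N → Circle => evalAt z (incl b)
      simp_rw [evalAt_incl]
      exact continuous_const
    · change Continuous fun z : Fin N → Circle => evalAt z (gen (Sum.inr s))
      simp_rw [← starPow_X, evalAt_starPow]
      cases s
      · exact continuous_vandermonde N
      · exact (continuous_vandermonde N).star
  | mul x y hx hy => simp_rw [map_mul]; exact hx.mul hy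
  | add x y hx hy => simp_rw [map_add]; exact hx.add hy

/-- The exponents of the monomial that a path contributes to a word. -/
def pathDeg {N m : ℕ} (ε : Fin m → Bool) (K : Fin (m + 1) → Fin N) : Fin N → ℤ :=
  ∑ j, if ε j then -Pi.single (K j.succ) ((K j.castSucc : ℤ) + 1)
    else Pi.single (K j.castSucc) ((K j.succ : ℤ) + 1)

/-- In an entry of `X` the row index is the base and the column index the exponent; for the adjoint
the roles are exchanged and the exponent changes sign. -/
theorem starPow_vandermonde_apply {N : ℕ} (z : Fin N → Circle) (ε : Bool) (k l : Fin N) :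
    starPow (vandermonde z) ε k l = ((Real.sqrt N : ℝ) : ℂ)⁻¹ *
      monom z (if ε then -Pi.single l ((k : ℤ) + 1) else Pi.single k ((l : ℤ) + 1)) := by
  cases ε
  · simp only [starPow, vandermonde, Bool.false_eq_true, if_false, Matrix.of_apply, monom_single]
    norm_cast
  · simp only [starPow, vandermonde, if_true, Matrix.star_apply, Matrix.of_apply]
    rw [← Pi.single_neg, monom_single, star_mul', zpow_neg, ← inv_zpow]
    simp only [RCLike.star_def, map_inv₀, Complex.conj_ofReal, map_pow, ← Circle.coe_inv_eq_conj]
    norm_cast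

theorem evalAt_word_apply {N m : ℕ} (z : Fin N → Circle) (b : Fin m → CI) (ε : Fin m → Bool)
    (k l : Fin N) :
    evalAt z (List.ofFn fun j => incl (b j) * starPow X (ε j)).prod k l
      = ∑ K : Fin (m + 1) → Fin N, if K 0 = k ∧ K (Fin.last m) = l then
        (((Real.sqrt N : ℝ) : ℂ)⁻¹ ^ m * ∏ j, b j (gridPoint (K j.castSucc)))
          * monom z (pathDeg ε K) else 0 := by
  rw [evalAt_word, prod_ofFn_apply]
  refine Finset.sum_congr rfl fun K _ => ?_
  congr 1
  rw [pathDeg, monom_sum, mul_right_comm, ← Fin.prod_const, ← Finset.prod_mul_distrib,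
    ← Finset.prod_mul_distrib]
  refine Finset.prod_congr rfl fun j _ => ?_
  rw [sampleDiag, Matrix.diagonal_mul, starPow_vandermonde_apply]
  ring

/-! ### Block equations and their parametrization -/

section Blocks

variable {m : ℕ} (π : SetPartition (m + 1))

/-- The index set is a union of whole blocks, and each block sums to zero. -/
theorem sum_filter_part_le (d : Fin (m + 1) → ℤ) (hd : ∀ S ∈ π.parts, ∑ j ∈ S, d j = 0)
    (p : Fin (m + 1)) :
    ∑ j ∈ Finset.univ.filter (fun j => ∀ k ∈ π.part j, k ≤ p), d j = 0 := by
  rw [← Finset.sum_fiberwise_of_maps_to (g := π.part) (t := π.parts)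
    (fun j _ => π.part_mem.2 (Finset.mem_univ j))]
  refine Finset.sum_eq_zero fun S hS => ?_
  rw [Finset.filter_filter]
  by_cases h : ∀ k ∈ S, k ≤ p
  · rw [← hd S hS]
    refine Finset.sum_congr ?_ fun _ _ => rfl
    ext j
    simp only [Finset.mem_filter, Finset.mem_univ, true_and]
    constructor
    · rintro ⟨-, rfl⟩
      exact π.mem_part (Finset.mem_univ j)
    · intro hj
      have := π.part_eq_of_mem hS hj
      exact ⟨by rwa [this], this⟩
  · rw [Finset.filter_false_of_mem, Finset.sum_empty]
    rintro j - ⟨h1, rfl⟩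
    exact h h1

/-- Blocks that are complete by `p` cancel. Only the points of blocks still open at `p` are left,
which is the origin of the sets `I π p` in the definition of `Λ_π`. -/
theorem sum_Iic_eq (d : Fin (m + 1) → ℤ) (hd : ∀ S ∈ π.parts, ∑ j ∈ S, d j = 0)
    (p : Fin (m + 1)) :
    ∑ j ∈ Finset.Iic p, d j = ∑ j ∈ I π p, d j := by
  have h0 := sum_filter_part_le π d hd p
  have h1 : Finset.Iic p = I π p ∪ Finset.univ.filter (fun j => ∀ k ∈ π.part j, k ≤ p) := by
    ext j
    simp only [Finset.mem_Iic, I, Finset.mem_union, Finset.mem_filter, Finset.mem_univ, true_and]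
    constructor
    · intro hj
      by_cases h : ∀ k ∈ π.part j, k ≤ p
      · exact Or.inr h
      · push Not at h
        exact Or.inl ⟨hj, h⟩
    · rintro (h | h)
      · exact h.1
      · exact h j (π.mem_part (Finset.mem_univ j))
  rw [h1, Finset.sum_union, h0, add_zero]
  rw [I, Finset.disjoint_filter]
  rintro j - ⟨_, k, hk, hpk⟩ h
  exact absurd (h k hk) (not_le.2 hpk)

theorem I_subset_J (p : Fin (m + 1)) : I π p ⊆ J π := by
  intro j hj
  simp only [I, J, Finset.mem_filter, Finset.mem_univ, true_and] at hj ⊢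
  obtain ⟨h, k, hk, hpk⟩ := hj
  exact ⟨k, hk, h.trans_lt hpk⟩

theorem sum_J_ite {A : Type*} [AddCommMonoid A] (p : Fin (m + 1)) (d : Fin (m + 1) → A) :
    ∑ j : ↥(J π), (if (j : Fin (m + 1)) ∈ I π p then d j else 0) = ∑ j ∈ I π p, d j := by
  rw [Finset.sum_coe_sort (J π) (fun j => if j ∈ I π p then d j else 0), Finset.sum_ite_mem,
    Finset.inter_eq_right.2 (I_subset_J π p)]

/-- The increments of a cyclic sequence. -/
def diff (e : Fin (m + 1) → ℤ) (j : Fin (m + 1)) : ℤ := e j - e (j - 1)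

/-- A telescoping sum; by the cyclic convention the increment at `0` starts from the value at
`Fin.last m`. -/
theorem sum_Iic_diff (e : Fin (m + 1) → ℤ) (p : Fin (m + 1)) :
    ∑ j ∈ Finset.Iic p, diff e j = e p - e (Fin.last m) := by
  induction p using Fin.induction with
  | zero =>
    have h1 : Finset.Iic (0 : Fin (m + 1)) = {0} := by ext j; simp
    have : (0 : Fin (m + 1)) - 1 = Fin.last m := by
      rw [sub_eq_iff_eq_add]; simp
    rw [h1, Finset.sum_singleton, diff, this]
  | succ p ih =>
    have h1 : Finset.Iic p.succ = insert p.succ (Finset.Iic p.castSucc) := by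
      ext j
      simp only [Finset.mem_Iic, Finset.mem_insert, Fin.le_def, Fin.ext_iff, Fin.val_succ,
        Fin.val_castSucc]
      omega
    have : p.succ - 1 = p.castSucc := by
      rw [sub_eq_iff_eq_add]; simp
    rw [h1, Finset.sum_insert (by simp [Fin.le_def]), ih, diff, this]
    ring

/-- This is the discrete form of `shifted`: a solution of the block equations is recovered from its
last value and its increments on `J π`. -/
theorem eq_add_sum_diff (e : Fin (m + 1) → ℤ) (he : ∀ S ∈ π.parts, ∑ j ∈ S, diff e j = 0)
    (p : Fin (m + 1)) :
    e p = e (Fin.last m) +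
      ∑ j : ↥(J π), (if (j : Fin (m + 1)) ∈ I π p then diff e j else 0) := by
  rw [sum_J_ite, ← sum_Iic_eq π _ he, sum_Iic_diff]
  ring

/-- The block equations can be solved for the increment at the largest element of each block, while
all other increments are free. -/
theorem exists_increments (x : ↥(J π) → ℤ) (k : ℤ) :
    ∃ e : Fin (m + 1) → ℤ, e (Fin.last m) = k ∧ (∀ S ∈ π.parts, ∑ j ∈ S, diff e j = 0) ∧
      ∀ j : ↥(J π), diff e j = x j := by
  set d : Fin (m + 1) → ℤ := fun j => if h : j ∈ J π then x ⟨j, h⟩ else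
    -∑ i ∈ (π.part j).erase j, (if h : i ∈ J π then x ⟨i, h⟩ else 0) with hd
  have hS : ∀ S ∈ π.parts, ∑ j ∈ S, d j = 0 := by
    intro S hS
    obtain ⟨M, hM, hmax⟩ := S.exists_max_image id (π.nonempty_of_mem_parts hS)
    have hMp : π.part M = S := π.part_eq_of_mem hS hM
    have hMJ : M ∉ J π := by
      simp only [J, Finset.mem_filter, Finset.mem_univ, true_and, hMp]
      rintro ⟨k, hk, hlt⟩
      exact absurd (hmax k hk) (not_le.2 hlt)
    rw [← Finset.add_sum_erase _ _ hM]
    simp only [hd, dif_neg hMJ, hMp]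
    rw [neg_add_eq_zero]
    refine Finset.sum_congr rfl fun i hi => ?_
    have hiJ : i ∈ J π := by
      obtain ⟨hne, hi⟩ := Finset.mem_erase.1 hi
      simp only [J, Finset.mem_filter, Finset.mem_univ, true_and, π.part_eq_of_mem hS hi]
      exact ⟨M, hM, lt_of_le_of_ne (hmax i hi) hne⟩
    rw [dif_pos hiJ, dif_pos hiJ]
  -- Without this the partial sums would not close up cyclically and the increment at `0` would be
  -- wrong.
  have htot : ∑ j, d j = 0 := by
    rw [← sum_filter_part_le π d hS (Fin.last m)]
    refine Finset.sum_congr ?_ fun _ _ => rfl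
    ext j
    simp [Fin.le_last]
  have hdiff : ∀ j, diff (fun p => k + ∑ j ∈ Finset.Iic p, d j) j = d j := by
    intro j
    rcases Fin.eq_zero_or_eq_succ j with rfl | ⟨i, rfl⟩
    · have h1 : Finset.Iic (0 : Fin (m + 1)) = {0} := by ext j; simp
      have h2 : (0 : Fin (m + 1)) - 1 = Fin.last m := by
        rw [sub_eq_iff_eq_add]; simp
      have h3 : Finset.Iic (Fin.last m) = Finset.univ := by ext j; simp [Fin.le_last]
      simp only [diff, h1, h2, h3, htot, Finset.sum_singleton]
      ring
    · have h1 : Finset.Iic i.succ = insert i.succ (Finset.Iic i.castSucc) := by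
        ext j
        simp only [Finset.mem_Iic, Finset.mem_insert, Fin.le_def, Fin.ext_iff, Fin.val_succ,
          Fin.val_castSucc]
        omega
      have h2 : i.succ - 1 = i.castSucc := by
        rw [sub_eq_iff_eq_add]; simp
      simp only [diff, h1, h2]
      rw [Finset.sum_insert (by simp [Fin.le_def])]
      ring
  refine ⟨fun p => k + ∑ j ∈ Finset.Iic p, d j, ?_, ?_, ?_⟩
  · have h3 : Finset.Iic (Fin.last m) = Finset.univ := by ext j; simp [Fin.le_last]
    simp only [h3, htot, add_zero]
  · intro S hS'
    simp only [hdiff, hS S hS']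
  · intro j
    rw [hdiff, hd]
    simp

/-- If `p` lies in `J π`, no block closes at `p`, so the shifted point at `p` is the preceding one
plus the coordinate at `p`. The coordinate is therefore a difference of two points of the unit
interval; for `p = 0` the preceding point is `t`. Boundedness of the polytope provides the
dominating function later. -/
theorem abs_le_one_of_shifted_mem {t : ℝ} (ht : t ∈ unitInterval) {x : ↥(J π) → ℝ}
    (hx : x ∈ polytope π t) (j : ↥(J π)) : |x j| ≤ 1 := by
  obtain ⟨j, hj⟩ := j
  have hj' : ∃ k ∈ π.part j, j < k := by simpa [J] using hj
  obtain ⟨p, rfl⟩ : ∃ p : Fin m, j = p.castSucc := by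
    obtain ⟨k, -, hk⟩ := hj'
    exact ⟨j.castLT (by have := k.2; have : (j : ℕ) < k := hk; omega), by ext; simp⟩
  have key : ∃ s ∈ unitInterval, shifted π t x p.castSucc = s + x ⟨p.castSucc, hj⟩ := by
    set y : Fin (m + 1) → ℝ := fun j => if h : j ∈ J π then x ⟨j, h⟩ else 0 with hy
    have hsh : ∀ q, shifted π t x q = t + ∑ j ∈ I π q, y j := by
      intro q
      rw [shifted, ← sum_J_ite π q y]
      congr 1
      refine Finset.sum_congr rfl fun j _ => ?_
      simp [hy]
    have hyp : y p.castSucc = x ⟨p.castSucc, hj⟩ := by simp only [hy, dif_pos hj]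
    rw [← hyp]
    by_cases hp : (p : ℕ) = 0
    · refine ⟨t, ht, ?_⟩
      rw [hsh]
      have : I π p.castSucc = {p.castSucc} := by
        ext i
        simp only [I, Finset.mem_filter, Finset.mem_univ, true_and, Finset.mem_singleton]
        constructor
        · rintro ⟨h, -⟩
          have h : (i : ℕ) ≤ p := h
          exact Fin.ext (by simp; omega)
        · rintro rfl
          exact ⟨le_rfl, hj'⟩
      rw [this, Finset.sum_singleton]
    · set q : Fin m := ⟨p - 1, by omega⟩ with hq
      refine ⟨shifted π t x q.castSucc, hx q, ?_⟩
      rw [hsh, hsh]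
      have : I π p.castSucc = insert p.castSucc (I π q.castSucc) := by
        ext i
        simp only [I, Finset.mem_filter, Finset.mem_univ, true_and, Finset.mem_insert]
        constructor
        · rintro ⟨h, k, hk, hlt⟩
          by_cases hi : i = p.castSucc
          · exact Or.inl hi
          · have h1 : (i : ℕ) ≤ p := h
            have h2 : (i : ℕ) ≠ p := fun h' => hi (Fin.ext h')
            have h3 : (p : ℕ) < k := hlt
            refine Or.inr ⟨?_, k, hk, ?_⟩
            · rw [Fin.le_def]; simp [hq]; omega
            · rw [Fin.lt_def]; simp [hq]; omega
        · rintro (rfl | ⟨h, k, hk, hlt⟩)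
          · exact ⟨le_rfl, hj'⟩
          · have h1 : (i : ℕ) ≤ p - 1 := h
            have h2 : (p : ℕ) - 1 < k := hlt
            refine ⟨?_, ?_⟩
            · rw [Fin.le_def]; simp; omega
            -- A block witnessed to be open at `p - 1` only by `p` itself is the block of `p`, which
            -- extends beyond `p`.
            by_cases hpk : (k : ℕ) = p
            · have hk' : k = p.castSucc := Fin.ext hpk
              subst hk'
              rw [π.part_eq_of_mem (π.part_mem.2 (Finset.mem_univ i)) hk] at hj'
              exact hj'
            · exact ⟨k, hk, by rw [Fin.lt_def]; simp; omega⟩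
      rw [this, Finset.sum_insert]
      · ring
      · simp only [I, Finset.mem_filter, Finset.mem_univ, true_and, not_and]
        intro h
        have h : (p : ℕ) ≤ p - 1 := h
        omega
  obtain ⟨s, hs, he⟩ := key
  have h1 := hx p
  rw [he] at h1
  rw [abs_le]
  constructor <;> linarith [hs.1, hs.2, h1.1, h1.2]

end Blocks

/-! ### Riemann sums and the continuity of `Λ_π` -/

/-- The integrand is constant on the half-open cubes of side `1 / N`. Lattice sums thereby become
integrals, to which dominated convergence applies. -/
theorem integral_floor {ι : Type*} [Fintype ι] {N : ℕ} (hN : 1 ≤ N) (F : (ι → ℤ) → ℂ)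
    (s : Finset (ι → ℤ)) (h : ∀ x, x ∉ s → F x = 0) :
    ∫ y : ι → ℝ, F (fun j => ⌊(N : ℝ) * y j⌋) = ((N : ℂ) ^ Fintype.card ι)⁻¹ * ∑ x ∈ s, F x := by
  classical
  have hNr : (0 : ℝ) < N := by exact_mod_cast hN
  set box : (ι → ℤ) → Set (ι → ℝ) := fun x =>
    Set.univ.pi fun j => Set.Ico ((x j : ℝ) / N) (((x j : ℝ) + 1) / N) with hbox
  have hmem : ∀ x y, y ∈ box x ↔ (fun j => ⌊(N : ℝ) * y j⌋) = x := by
    intro x y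
    simp only [hbox, Set.mem_pi, Set.mem_univ, true_imp_iff, Set.mem_Ico, funext_iff,
      Int.floor_eq_iff, div_le_iff₀' hNr, lt_div_iff₀' hNr]
  have hmeas : ∀ x, MeasurableSet (box x) := fun x =>
    MeasurableSet.univ_pi fun _ => measurableSet_Ico
  have hvol : ∀ x, volume.real (box x) = ((N : ℝ) ^ Fintype.card ι)⁻¹ := by
    intro x
    rw [measureReal_def, hbox, Real.volume_pi_Ico, ENNReal.toReal_prod]
    have : ∀ j, (ENNReal.ofReal (((x j : ℝ) + 1) / N - (x j : ℝ) / N)).toReal = (N : ℝ)⁻¹ := by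
      intro j
      rw [← sub_div, add_sub_cancel_left, one_div, ENNReal.toReal_ofReal (by positivity)]
    simp [this]
  have h1 : ∀ y : ι → ℝ, F (fun j => ⌊(N : ℝ) * y j⌋)
      = ∑ x ∈ s, (box x).indicator (fun _ => F x) y := by
    intro y
    simp only [Set.indicator_apply, hmem]
    rw [Finset.sum_ite_eq]
    split_ifs with hs
    · rfl
    · exact h _ hs
  simp_rw [h1]
  rw [integral_finsetSum _ fun x _ => ?_, Finset.mul_sum]
  · refine Finset.sum_congr rfl fun x _ => ?_
    rw [integral_indicator_const _ (hmeas x), hvol, Complex.real_smul]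
    push_cast
    rfl
  · refine (integrable_indicator_iff (hmeas x)).2 (integrableOn_const ?_)
    rw [hbox, Real.volume_pi_Ico]
    exact ENNReal.prod_ne_top fun _ _ => ENNReal.ofReal_ne_top

section Limits

variable {m : ℕ} (π : SetPartition (m + 1))

/-- A nonempty `I π p` makes the linear part nonzero, so the set is a proper affine subspace. For
empty `I π p` the shifted point is the constant `t` and the claim would fail at `c = t`. -/
theorem volume_shifted_eq (t c : ℝ) (p : Fin (m + 1)) (hp : (I π p).Nonempty) :
    volume {x : ↥(J π) → ℝ | shifted π t x p = c} = 0 := by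
  classical
  obtain ⟨i, hi⟩ := hp
  set L : (↥(J π) → ℝ) →ₗ[ℝ] ℝ :=
    ∑ j : ↥(J π), (if (j : Fin (m + 1)) ∈ I π p then LinearMap.proj j else 0) with hL
  have hLx : ∀ x, shifted π t x p = t + L x := by
    intro x
    rw [shifted, hL, LinearMap.sum_apply]
    congr 1
    refine Finset.sum_congr rfl fun j _ => ?_
    split_ifs <;> simp
  have hL1 : L (Pi.single ⟨i, I_subset_J π p hi⟩ 1) = 1 := by
    rw [hL, LinearMap.sum_apply, Finset.sum_eq_single ⟨i, I_subset_J π p hi⟩]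
    · simp [hi]
    · intro j _ hj
      split_ifs <;> simp [hj]
    · simp
  have hmin : {x : ↥(J π) → ℝ | shifted π t x p = c}
      = ((AffineSubspace.mk' (c - t) (⊥ : Submodule ℝ ℝ)).comap L.toAffineMap :
        AffineSubspace ℝ (↥(J π) → ℝ)) := by
    ext x
    rw [Set.mem_ofPred_eq, hLx]
    simp [AffineSubspace.mem_mk', sub_eq_zero]
    constructor <;> intro h <;> linarith
  rw [hmin]
  refine Measure.addHaar_affineSubspace _ _ ?_
  intro htop
  have h1 : ∀ x, shifted π t x p = c := by
    intro x
    have : x ∈ ({x : ↥(J π) → ℝ | shifted π t x p = c}) := by rw [hmin, htop]; trivial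
    exact this
  have h2 := h1 0
  have h3 := h1 (Pi.single ⟨i, I_subset_J π p hi⟩ 1)
  rw [hLx] at h2 h3
  rw [hL1] at h3
  rw [map_zero] at h2
  linarith

theorem continuous_shifted (p : Fin (m + 1)) :
    Continuous fun q : ℝ × (↥(J π) → ℝ) => shifted π q.1 q.2 p := by
  unfold shifted
  refine continuous_fst.add (continuous_finsetSum _ fun j _ => ?_)
  split_ifs
  · exact (continuous_apply j).comp continuous_snd
  · exact continuous_const

theorem measurableSet_polytope (t : ℝ) : MeasurableSet (polytope π t) := by
  have : polytope π t = ⋂ p : Fin m, (fun x => shifted π t x p.castSucc) ⁻¹' unitInterval := by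
    ext x; simp [polytope]
  rw [this]
  refine MeasurableSet.iInter fun p => ?_
  exact ((continuous_shifted π p.castSucc).comp
    (Continuous.prodMk_right t)).measurable measurableSet_Icc

/-- The integrand of `Λ_π` without the constraint. -/
noncomputable def integrand (g : Fin m → CI) (t : ℝ) (x : ↥(J π) → ℝ) : ℂ :=
  ∏ p : Fin m, Set.IccExtend zero_le_one (g p) (shifted π t x p.castSucc)

theorem continuous_integrand (g : Fin m → CI) :
    Continuous fun q : ℝ × (↥(J π) → ℝ) => integrand π g q.1 q.2 := by
  unfold integrand
  refine continuous_finsetProd _ fun p _ => ?_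
  exact ((g p).continuous.Icc_extend' (h := zero_le_one)).comp (continuous_shifted π _)

theorem norm_integrand_le (g : Fin m → CI) (t : ℝ) (x : ↥(J π) → ℝ) :
    ‖integrand π g t x‖ ≤ ∏ p, ‖g p‖ := by
  rw [integrand, norm_prod]
  refine Finset.prod_le_prod (fun _ _ => norm_nonneg _) fun p _ => ?_
  exact (g p).norm_coe_le_norm _

/-- Approximations of the integral defining `Λ_π` converge. -/
theorem tendsto_integral_Lam (g : Fin m → CI) (u : ℕ → unitInterval) (v : unitInterval)
    (hu : Tendsto u atTop (𝓝 v)) (r : ℕ → (↥(J π) → ℝ) → (↥(J π) → ℝ))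
    (hrm : ∀ n, Measurable (r n)) (hr : ∀ y, Tendsto (fun n => r n y) atTop (𝓝 y))
    (hr1 : ∀ n y j, |r n y j - y j| ≤ 1) (P : ℕ → Set (↥(J π) → ℝ))
    (hPm : ∀ n, MeasurableSet (P n))
    (hP : ∀ n y, y ∈ P n → r n y ∈ polytope π (u n))
    (hP' : ∀ n y, (∀ p : Fin m, (I π p.castSucc).Nonempty →
      shifted π (u n) (r n y) p.castSucc ∈ Set.Ioo (0 : ℝ) 1) → y ∈ P n) :
    Tendsto (fun n => ∫ y in P n, integrand π g (u n) (r n y)) atTop (𝓝 (Lam π g v)) := by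
  have hu' : Tendsto (fun n => (u n : ℝ)) atTop (𝓝 (v : ℝ)) :=
    (continuous_subtype_val.tendsto v).comp hu
  have hlim : Lam π g v = ∫ y, (polytope π v).indicator (integrand π g v) y := by
    rw [integral_indicator (measurableSet_polytope π v)]; rfl
  have hlhs : ∀ n, ∫ y in P n, integrand π g (u n) (r n y)
      = ∫ y, (P n).indicator (fun y => integrand π g (u n) (r n y)) y := fun n =>
    (integral_indicator (hPm n)).symm
  simp_rw [hlhs]
  rw [hlim]
  have hcont : ∀ n, Continuous (integrand π g (u n)) := fun n =>
    (continuous_integrand π g).comp (Continuous.prodMk_right (u n : ℝ))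
  -- Where the integrand is nonzero, `r n y` lies in the polytope and has coordinates of modulus at
  -- most `1`. As `r n y` is within `1` of `y`, the box of radius `2` suffices.
  refine tendsto_integral_of_dominated_convergence
    ((Set.Icc (fun _ => -2) (fun _ => 2) : Set (↥(J π) → ℝ)).indicator fun _ => ∏ p, ‖g p‖)
    ?_ ?_ ?_ ?_
  · intro n
    exact (((hcont n).measurable.comp (hrm n)).indicator (hPm n)).aestronglyMeasurable
  · exact (integrable_indicator_iff measurableSet_Icc).2
      (integrableOn_const (by exact isCompact_Icc.measure_ne_top))
  · intro n
    refine Eventually.of_forall fun y => ?_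
    by_cases hy : y ∈ P n
    · rw [Set.indicator_of_mem hy, Set.indicator_of_mem]
      · exact norm_integrand_le π g _ _
      · have h1 := fun j => abs_le_one_of_shifted_mem π (u n).2 (hP n y hy) j
        have h2 := fun j => hr1 n y j
        constructor <;> intro j <;>
          linarith [abs_le.1 (h1 j) |>.1, abs_le.1 (h1 j) |>.2, abs_le.1 (h2 j) |>.1,
            abs_le.1 (h2 j) |>.2]
    · rw [Set.indicator_of_notMem hy, norm_zero]
      exact Set.indicator_nonneg (fun _ _ => Finset.prod_nonneg fun _ _ => norm_nonneg _) _
  -- The indicators converge at every point that is not on a bounding hyperplane. Constraints with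
  -- empty `I π p` have no hyperplane and always hold, since they only involve the base point.
  · have hae : ∀ᵐ y : ↥(J π) → ℝ, ∀ p : Fin m, (I π p.castSucc).Nonempty →
        shifted π v y p.castSucc ≠ 0 ∧ shifted π v y p.castSucc ≠ 1 := by
      rw [ae_all_iff]
      intro p
      by_cases hp : (I π p.castSucc).Nonempty
      · have h0 := measure_eq_zero_iff_ae_notMem.1 (volume_shifted_eq π v 0 _ hp)
        have h1 := measure_eq_zero_iff_ae_notMem.1 (volume_shifted_eq π v 1 _ hp)
        filter_upwards [h0, h1] with y h0 h1 _
        exact ⟨h0, h1⟩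
      · exact Eventually.of_forall fun y h => absurd h hp
    filter_upwards [hae] with y hy
    have hpair : Tendsto (fun n => ((u n : ℝ), r n y)) atTop (𝓝 ((v : ℝ), y)) :=
      hu'.prodMk_nhds (hr y)
    have hsh : ∀ p : Fin m, Tendsto (fun n => shifted π (u n) (r n y) p.castSucc) atTop
        (𝓝 (shifted π v y p.castSucc)) := fun p =>
      ((continuous_shifted π p.castSucc).tendsto ((v : ℝ), y)).comp hpair
    have hint : Tendsto (fun n => integrand π g (u n) (r n y)) atTop (𝓝 (integrand π g v y)) := by
      have h := ((continuous_integrand π g).tendsto ((v : ℝ), y)).comp hpair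
      rw [Function.comp_def] at h
      exact h
    by_cases hyP : y ∈ polytope π v
    · rw [Set.indicator_of_mem hyP]
      refine hint.congr' ?_
      have : ∀ᶠ n in atTop, ∀ p : Fin m, (I π p.castSucc).Nonempty →
          shifted π (u n) (r n y) p.castSucc ∈ Set.Ioo (0 : ℝ) 1 := by
        rw [eventually_all]
        intro p
        by_cases hp : (I π p.castSucc).Nonempty
        · have h1 := hy p hp
          have h2 := hyP p
          have h3 : shifted π v y p.castSucc ∈ Set.Ioo (0 : ℝ) 1 :=
            ⟨lt_of_le_of_ne h2.1 h1.1.symm, lt_of_le_of_ne h2.2 h1.2⟩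
          filter_upwards [(hsh p).eventually (isOpen_Ioo.mem_nhds h3)] with n hn _
          exact hn
        · exact Eventually.of_forall fun n h => absurd h hp
      filter_upwards [this] with n hn
      rw [Set.indicator_of_mem (hP' n y hn)]
    · rw [Set.indicator_of_notMem hyP]
      obtain ⟨p, hp⟩ : ∃ p : Fin m, shifted π v y p.castSucc ∉ unitInterval := by
        by_contra h
        push Not at h
        exact hyP h
      refine tendsto_const_nhds.congr' ?_
      filter_upwards [(hsh p).eventually (isClosed_Icc.isOpen_compl.mem_nhds hp)] with n hn
      rw [Set.indicator_of_notMem]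
      intro hyn
      exact hn (hP n y hyn p)

/-- The same convergence argument with no discretization, only the base point moving. -/
theorem continuous_Lam (g : Fin m → CI) : Continuous (Lam π g) := by
  refine continuous_iff_seqContinuous.2 fun u v hu => ?_
  have := tendsto_integral_Lam π g u v hu (fun _ => id) (fun _ => measurable_id)
    (fun y => tendsto_const_nhds) (by simp) (fun n => polytope π (u n))
    (fun n => measurableSet_polytope π _) (fun n y hy => hy) ?_
  · exact this
  · intro n y hy p
    by_cases hp : (I π p.castSucc).Nonempty
    · exact Set.Ioo_subset_Icc_self (hy p hp)
    · rw [Finset.not_nonempty_iff_eq_empty] at hp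
      simp only [shifted, hp, Finset.notMem_empty, if_false, Finset.sum_const_zero, add_zero]
      exact (u n).2

/-- The sum over exponents, ending at `k`, that satisfy the block equations of `π`. -/
noncomputable def blockSum (g : Fin m → CI) {N : ℕ} (k : Fin N) : ℂ :=
  ((N : ℂ) ^ (J π).card)⁻¹ * ∑ e : Fin (m + 1) → Fin N,
    if e (Fin.last m) = k ∧ ∀ S ∈ π.parts, ∑ j ∈ S, diff (fun i => (e i : ℤ)) j = 0 then
      ∏ p : Fin m, g p (gridPoint (e p.castSucc)) else 0

/-- Taking increments on `J π` identifies the solutions of the block equations that end at `k` with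
lattice points, and rescaling by `1 / N` turns exponents into grid points. -/
theorem blockSum_eq_integral (g : Fin m → CI) {N : ℕ} (k : Fin N) :
    blockSum π g k = ∫ y in {y : ↥(J π) → ℝ | ∀ p : Fin m,
        shifted π (gridPoint k) (fun j => (⌊(N : ℝ) * y j⌋ : ℝ) / N) p.castSucc ∈ Set.Ioc (0 : ℝ) 1},
      integrand π g (gridPoint k) (fun j => (⌊(N : ℝ) * y j⌋ : ℝ) / N) := by
  classical
  have hN : 1 ≤ N := by have := k.2; omega
  have hNr : (0 : ℝ) < N := by exact_mod_cast hN
  -- The half-open interval `Ioc 0 1` is exact: a point `(e + 1) / N` with `e` an integer lies in it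
  -- precisely if `0 ≤ e < N`.
  set F : (↥(J π) → ℤ) → ℂ := fun x =>
    if ∀ p : Fin m, shifted π (gridPoint k) (fun j => (x j : ℝ) / N) p.castSucc ∈ Set.Ioc (0 : ℝ) 1
    then integrand π g (gridPoint k) (fun j => (x j : ℝ) / N) else 0 with hF
  set V : Finset (Fin (m + 1) → Fin N) := Finset.univ.filter fun e =>
    e (Fin.last m) = k ∧ ∀ S ∈ π.parts, ∑ j ∈ S, diff (fun i => (e i : ℤ)) j = 0 with hV
  set D : (Fin (m + 1) → Fin N) → (↥(J π) → ℤ) := fun e j => diff (fun i => (e i : ℤ)) j with hD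
  have hshift : ∀ (e : Fin (m + 1) → ℤ) (x : ↥(J π) → ℤ), e (Fin.last m) = (k : ℤ) →
      (∀ S ∈ π.parts, ∑ j ∈ S, diff e j = 0) → (∀ j : ↥(J π), diff e j = x j) →
      ∀ p, shifted π (gridPoint k) (fun j => (x j : ℝ) / N) p = ((e p : ℝ) + 1) / N := by
    intro e x hk he hx p
    have h1 := eq_add_sum_diff π e he p
    rw [hk] at h1
    have h2 : (e p : ℝ) = (k : ℝ) + ∑ j : ↥(J π),
        (if (j : Fin (m + 1)) ∈ I π p then (x j : ℝ) else 0) := by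
      have h3 : (e p : ℝ) = (((k : ℤ) + ∑ j : ↥(J π),
        (if (j : Fin (m + 1)) ∈ I π p then diff e j else 0) : ℤ) : ℝ) := by exact_mod_cast h1
      rw [h3]
      push_cast
      congr 1
      refine Finset.sum_congr rfl fun j _ => ?_
      rw [hx]
    have h4 : ((gridPoint k : unitInterval) : ℝ) = ((k : ℝ) + 1) / N := by
      simp [gridPoint]
    rw [shifted, h2, h4]
    have h5 : ∀ j : ↥(J π), (if (j : Fin (m + 1)) ∈ I π p then (x j : ℝ) / N else 0)
        = (if (j : Fin (m + 1)) ∈ I π p then (x j : ℝ) else 0) / N := by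
      intro j; split_ifs <;> simp
    simp_rw [h5]
    rw [← Finset.sum_div]
    ring
  have hinj : Set.InjOn D V := by
    intro e he e' he' hee
    rw [Finset.mem_coe, hV, Finset.mem_filter] at he he'
    funext p
    have h1 := eq_add_sum_diff π _ he.2.2 p
    have h2 := eq_add_sum_diff π _ he'.2.2 p
    have h3 : ∀ j : ↥(J π), diff (fun i => (e i : ℤ)) j = diff (fun i => (e' i : ℤ)) j :=
      fun j => congr_fun hee j
    simp only [h3, he.2.1] at h1
    simp only [he'.2.1] at h2
    exact Fin.ext (by exact_mod_cast h1.trans h2.symm)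
  -- An admissible lattice point comes from an integer solution, and the constraints say that this
  -- solution takes values in `Fin N`.
  have hzero : ∀ x, x ∉ V.image D → F x = 0 := by
    intro x hx
    rw [hF]
    refine if_neg fun hcon => hx ?_
    obtain ⟨e, hk, he, hxe⟩ := exists_increments π x k
    have hrange : ∀ p, 0 ≤ e p ∧ e p < N := by
      intro p
      rcases Fin.eq_castSucc_or_eq_last p with ⟨i, rfl⟩ | rfl
      · have h1 := hcon i
        rw [hshift e x hk he hxe, Set.mem_Ioc, div_le_one hNr] at h1
        have h2 : (0 : ℝ) < (e i.castSucc : ℝ) + 1 := by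
          by_contra h
          exact absurd h1.1 (not_lt.2 (div_nonpos_of_nonpos_of_nonneg (not_lt.1 h) hNr.le))
        have h3 : (0 : ℤ) < e i.castSucc + 1 := by exact_mod_cast h2
        have h4 : e i.castSucc + 1 ≤ (N : ℤ) := by exact_mod_cast h1.2
        omega
      · rw [hk]
        have := k.2
        omega
    set e' : Fin (m + 1) → Fin N := fun p => ⟨(e p).toNat, by have := hrange p; omega⟩ with he'
    have hee : (fun i => ((e' i : ℕ) : ℤ)) = e := by
      funext i
      have := hrange i
      simp only [he']
      omega
    refine Finset.mem_image.2 ⟨e', ?_, ?_⟩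
    · rw [hV, Finset.mem_filter]
      refine ⟨Finset.mem_univ _, ?_, ?_⟩
      · refine Fin.ext ?_
        have := congr_fun hee (Fin.last m)
        rw [hk] at this
        exact_mod_cast this
      · rw [hee]; exact he
    · funext j
      simp only [hD, hee]
      exact hxe j
  have hFe : ∀ e ∈ V, F (D e) = ∏ p : Fin m, g p (gridPoint (e p.castSucc)) := by
    intro e he
    rw [hV, Finset.mem_filter] at he
    have hs := hshift (fun i => (e i : ℤ)) (D e) (by simp [he.2.1]) he.2.2 (fun j => rfl)
    have hg : ∀ p : Fin m, shifted π (gridPoint k) (fun j => (D e j : ℝ) / N) p.castSucc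
        = (gridPoint (e p.castSucc) : ℝ) := by
      intro p
      rw [hs]
      simp [gridPoint]
    rw [hF]
    simp only
    rw [if_pos]
    · rw [integrand]
      refine Finset.prod_congr rfl fun p _ => ?_
      rw [hg, Set.IccExtend_val]
    · intro p
      rw [hg]
      refine ⟨?_, (gridPoint (e p.castSucc)).2.2⟩
      simp only [gridPoint]
      positivity
  have hset : MeasurableSet {y : ↥(J π) → ℝ | ∀ p : Fin m,
      shifted π (gridPoint k) (fun j => (⌊(N : ℝ) * y j⌋ : ℝ) / N) p.castSucc
        ∈ Set.Ioc (0 : ℝ) 1} := by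
    have : {y : ↥(J π) → ℝ | ∀ p : Fin m,
      shifted π (gridPoint k) (fun j => (⌊(N : ℝ) * y j⌋ : ℝ) / N) p.castSucc
        ∈ Set.Ioc (0 : ℝ) 1} = ⋂ p : Fin m, (fun y : ↥(J π) → ℝ =>
        shifted π (gridPoint k) (fun j => (⌊(N : ℝ) * y j⌋ : ℝ) / N) p.castSucc) ⁻¹'
          Set.Ioc (0 : ℝ) 1 := by ext; simp
    rw [this]
    refine MeasurableSet.iInter fun p => ?_
    refine (((continuous_shifted π p.castSucc).comp
      (Continuous.prodMk_right _)).measurable.comp ?_) measurableSet_Ioc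
    fun_prop
  rw [← integral_indicator hset]
  have h1 : ∀ y : ↥(J π) → ℝ, Set.indicator {y : ↥(J π) → ℝ | ∀ p : Fin m,
      shifted π (gridPoint k) (fun j => (⌊(N : ℝ) * y j⌋ : ℝ) / N) p.castSucc ∈ Set.Ioc (0 : ℝ) 1}
      (fun y => integrand π g (gridPoint k) (fun j => (⌊(N : ℝ) * y j⌋ : ℝ) / N)) y
      = F (fun j => ⌊(N : ℝ) * y j⌋) := by
    intro y
    rw [Set.indicator_apply]
    rfl
  simp_rw [h1]
  rw [integral_floor hN F (V.image D) hzero, Finset.sum_image hinj, Finset.sum_congr rfl hFe,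
    Fintype.card_coe, blockSum, hV, Finset.sum_filter]

/-- Riemann sums for `Λ_π` converge uniformly. -/
theorem tendsto_blockSum (g : Fin m → CI) {δ : ℝ} (hδ : 0 < δ) :
    ∀ᶠ N : ℕ in atTop, ∀ k : Fin N, ‖blockSum π g k - Lam π g (gridPoint k)‖ ≤ δ := by
  by_contra hcon
  rw [not_eventually] at hcon
  obtain ⟨φ, hφ, hbad⟩ := extraction_of_frequently_atTop hcon
  push Not at hbad
  choose k hk using hbad
  -- Uniformity by compactness: if it failed, the bad base points would accumulate at some `v`, and
  -- along that subsequence both the block sums and `Lam` would converge to the value of `Lam` at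
  -- `v`.
  obtain ⟨v, -, ψ, hψ, hv⟩ := isCompact_univ.tendsto_subseq
    (x := fun n => gridPoint (k n)) (fun _ => Set.mem_univ _)
  have hN : ∀ n, (0 : ℝ) < φ n := fun n => by
    have := (k n).2
    exact_mod_cast (Nat.zero_le _).trans_lt this
  have hφψ : Tendsto (fun n => (φ (ψ n) : ℝ)) atTop atTop :=
    tendsto_natCast_atTop_atTop.comp ((hφ.tendsto_atTop).comp hψ.tendsto_atTop)
  have hfl : ∀ n (y : ℝ), |(⌊(φ n : ℝ) * y⌋ : ℝ) / φ n - y| ≤ 1 / φ n := by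
    intro n y
    have h1 := Int.floor_le ((φ n : ℝ) * y)
    have h2 := Int.lt_floor_add_one ((φ n : ℝ) * y)
    have h3 : (⌊(φ n : ℝ) * y⌋ : ℝ) / φ n - y = ((⌊(φ n : ℝ) * y⌋ : ℝ) - φ n * y) / φ n := by
      have := (hN n).ne'
      field_simp
    rw [h3, abs_div, abs_of_pos (hN n)]
    refine div_le_div_of_nonneg_right ?_ (hN n).le
    rw [abs_le]
    constructor <;> linarith
  have hone : ∀ n, 1 / (φ n : ℝ) ≤ 1 := fun n => by
    rw [div_le_one (hN n)]
    have : 0 < φ n := by exact_mod_cast hN n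
    exact_mod_cast this
  have h1 : Tendsto (fun n => blockSum π g (k (ψ n))) atTop (𝓝 (Lam π g v)) := by
    have hbs := fun n => blockSum_eq_integral π g (k (ψ n))
    simp_rw [hbs]
    refine tendsto_integral_Lam π g (fun n => gridPoint (k (ψ n))) v hv
      (fun n y j => (⌊(φ (ψ n) : ℝ) * y j⌋ : ℝ) / φ (ψ n)) ?_ ?_ ?_ _ ?_ ?_ ?_
    · intro n; fun_prop
    · intro y
      rw [tendsto_pi_nhds]
      intro j
      rw [tendsto_iff_norm_sub_tendsto_zero]
      refine squeeze_zero (fun _ => norm_nonneg _) (fun n => hfl (ψ n) (y j)) ?_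
      simp only [one_div]
      exact hφψ.inv_tendsto_atTop
    · intro n y j
      exact (hfl _ _).trans (hone _)
    · intro n
      have : {y : ↥(J π) → ℝ | ∀ p : Fin m,
        shifted π (gridPoint (k (ψ n))) (fun j => (⌊(φ (ψ n) : ℝ) * y j⌋ : ℝ) / φ (ψ n)) p.castSucc
          ∈ Set.Ioc (0 : ℝ) 1} = ⋂ p : Fin m, (fun y : ↥(J π) → ℝ =>
          shifted π (gridPoint (k (ψ n))) (fun j => (⌊(φ (ψ n) : ℝ) * y j⌋ : ℝ) / φ (ψ n))
            p.castSucc) ⁻¹' Set.Ioc (0 : ℝ) 1 := by ext; simp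
      rw [this]
      refine MeasurableSet.iInter fun p => ?_
      refine (((continuous_shifted π p.castSucc).comp
        (Continuous.prodMk_right _)).measurable.comp ?_) measurableSet_Ioc
      fun_prop
    · intro n y hy p
      exact Set.Ioc_subset_Icc_self (hy p)
    · intro n y hy p
      by_cases hp : (I π p.castSucc).Nonempty
      · exact Set.Ioo_subset_Ioc_self (hy p hp)
      · rw [Finset.not_nonempty_iff_eq_empty] at hp
        simp only [shifted, hp, Finset.notMem_empty, if_false, Finset.sum_const_zero, add_zero]
        refine ⟨?_, (gridPoint (k (ψ n))).2.2⟩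
        have := hN (ψ n)
        simp only [gridPoint]
        positivity
  have h2 : Tendsto (fun n => Lam π g (gridPoint (k (ψ n)))) atTop (𝓝 (Lam π g v)) :=
    ((continuous_Lam π g).tendsto v).comp hv
  have h3 := (h1.sub h2).norm
  rw [sub_self, norm_zero] at h3
  have h4 := h3.eventually (gt_mem_nhds hδ)
  obtain ⟨n, hn⟩ := h4.exists
  exact absurd (hk (ψ n)) (not_lt.2 hn.le)

end Limits

/-! ### Counting solutions of flow equations -/

/-- The points joined by an edge. -/
def EdgeRel {E V : Type*} (a b : E → V) (y y' : V) : Prop := ∃ e, a e = y ∧ b e = y'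

/-- The rank of the incidence matrix is used twice. Choosing a basis among its columns, the values
on the remaining edges determine `x`, so a large rank means few solutions. Conversely, every vertex
of `D` is connected to a root, so its unit vector lies in the column space plus the span of the
roots, and the rank is at least `D.card` minus the number of roots. -/
theorem card_flow_le {N : ℕ} {E C : Type*} [Fintype E] [DecidableEq E] [Fintype C]
    (a b : E → Fin N) (D : Finset (Fin N)) (ρ : C → Fin N)
    (h : ∀ y ∈ D, ∃ c, Relation.EqvGen (EdgeRel a b) y (ρ c)) (S : Finset (E → Fin N))
    (hS : ∀ x ∈ S, ∀ x' ∈ S, ∑ e, ((x e : ℤ) - (x' e : ℤ)) •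
      (Pi.single (a e) 1 - Pi.single (b e) 1 : Fin N → ℤ) = 0) :
    S.card * N ^ D.card ≤ N ^ (Fintype.card E + Fintype.card C) := by
  classical
  set col : E → Fin N → ℚ := fun e => Pi.single (a e) 1 - Pi.single (b e) 1 with hcol
  -- Here `κ` indexes a set of columns that forms a basis of the column space; its cardinality is
  -- the rank.
  obtain ⟨κ, f, hinj, hspan, hli⟩ := exists_linearIndependent' ℚ col
  have : Finite κ := Finite.of_injective f hinj
  have : Fintype κ := Fintype.ofFinite κ
  have hκ : Fintype.card κ ≤ Fintype.card E := Fintype.card_le_of_injective f hinj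
  have hScard : S.card ≤ N ^ (Fintype.card E - Fintype.card κ) := by
    have hcard : Fintype.card ({e // e ∉ Set.range f} → Fin N)
        = N ^ (Fintype.card E - Fintype.card κ) := by
      rw [Fintype.card_fun, Fintype.card_fin, Fintype.card_subtype_compl]
      congr 2
      exact (Fintype.card_congr (Equiv.ofInjective f hinj)).symm
    rw [← hcard, ← Finset.card_univ]
    refine Finset.card_le_card_of_injOn (fun x e => x e) (fun _ _ => Finset.mem_univ _) ?_
    intro x hx x' hx' hxx
    have hoff : ∀ e, e ∉ Set.range f → x e = x' e := fun e he => congr_fun hxx ⟨e, he⟩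
    have hsum : ∑ i, ((x (f i) : ℚ) - (x' (f i) : ℚ)) • col (f i) = 0 := by
      have h0 : ∑ e, ((x e : ℚ) - (x' e : ℚ)) • col e = 0 := by
        funext y
        have := congr_fun (hS x hx x' hx') y
        simp only [Finset.sum_apply, Pi.smul_apply, smul_eq_mul, Pi.sub_apply, Pi.zero_apply,
          Pi.single_apply, hcol] at this ⊢
        exact_mod_cast this
      rw [← h0, ← Finset.sum_subset (Finset.subset_univ (Finset.univ.image f)),
        Finset.sum_image hinj.injOn]
      intro e _ he
      rw [hoff e (by simpa using he), sub_self, zero_smul]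
    have hz := Fintype.linearIndependent_iff.1 hli _ hsum
    funext e
    by_cases he : e ∈ Set.range f
    · obtain ⟨i, rfl⟩ := he
      have := sub_eq_zero.1 (hz i)
      exact Fin.ext (by exact_mod_cast this)
    · exact hoff e he
  have hD : D.card ≤ Fintype.card κ + Fintype.card C := by
    set U := Submodule.span ℚ (Set.range col) with hU
    set T := Submodule.span ℚ (Set.range fun c => (Pi.single (ρ c) 1 : Fin N → ℚ)) with hT
    have hUr : Module.finrank ℚ U ≤ Fintype.card κ := by
      rw [← hspan]
      exact finrank_range_le_card _
    have hTr : Module.finrank ℚ T ≤ Fintype.card C := finrank_range_le_card _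
    have hrel : ∀ y y', Relation.EqvGen (EdgeRel a b) y y' →
        (Pi.single y 1 - Pi.single y' 1 : Fin N → ℚ) ∈ U := by
      intro y y' hy
      induction hy with
      | rel y y' hy =>
        obtain ⟨e, rfl, rfl⟩ := hy
        exact Submodule.subset_span ⟨e, rfl⟩
      | refl y => simp
      | symm y y' _ ih => simpa using Submodule.neg_mem _ ih
      | trans y y' y'' _ _ ih1 ih2 => simpa using Submodule.add_mem _ ih1 ih2
    have hli' : LinearIndependent ℚ (fun y : D => (Pi.single (y : Fin N) 1 : Fin N → ℚ)) := by
      have := (Pi.basisFun ℚ (Fin N)).linearIndependent.comp (fun y : D => (y : Fin N))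
        Subtype.val_injective
      convert this using 2 with y
      simp
    have hle : Submodule.span ℚ (Set.range fun y : D => (Pi.single (y : Fin N) 1 : Fin N → ℚ))
        ≤ U ⊔ T := by
      rw [Submodule.span_le]
      rintro _ ⟨⟨y, hy⟩, rfl⟩
      obtain ⟨c, hc⟩ := h y hy
      have := Submodule.add_mem_sup (hrel _ _ hc) (Submodule.subset_span (R := ℚ)
        (s := Set.range fun c => (Pi.single (ρ c) 1 : Fin N → ℚ)) ⟨c, rfl⟩)
      simpa using this
    have h1 := finrank_span_eq_card hli'
    have h2 := Submodule.finrank_mono hle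
    have h3 := Submodule.finrank_add_le_finrank_add_finrank U T
    rw [Fintype.card_coe] at h1
    omega
  rcases Nat.eq_zero_or_pos N with rfl | hN
  · have : IsEmpty E := ⟨fun e => (a e).elim0⟩
    have : IsEmpty C := ⟨fun e => (ρ e).elim0⟩
    have : D = ∅ := Finset.eq_empty_of_isEmpty D
    simp only [Fintype.card_eq_zero, zero_le, Nat.sub_eq_zero_of_le, pow_zero] at hScard
    simpa [this] using hScard
  · calc S.card * N ^ D.card
        ≤ N ^ (Fintype.card E - Fintype.card κ) * N ^ (Fintype.card κ + Fintype.card C) :=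
          Nat.mul_le_mul hScard (Nat.pow_le_pow_right hN hD)
      _ = N ^ (Fintype.card E + Fintype.card C) := by
          rw [← pow_add]; congr 1; omega

/-! ### Summing the counts over all base values -/

/-- Functions whose image contains `Y`, weighted by the size of the image. -/
theorem sum_image_le (β : Type*) [Fintype β] [DecidableEq β] {N : ℕ} (hN : 1 ≤ N)
    (Y : Finset (Fin N)) :
    ∑ v : β → Fin N, (if Y ⊆ Finset.univ.image v then
        ((N : ℝ) ^ (Finset.univ.image v).card)⁻¹ else 0)
      ≤ ((Fintype.card β + 1) * Fintype.card β ^ Fintype.card β : ℕ) * ((N : ℝ) ^ Y.card)⁻¹ := by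
  classical
  set b := Fintype.card β
  have hNr : (0 : ℝ) < N := by exact_mod_cast hN
  have himg : ∀ v : β → Fin N, (Finset.univ.image v).card ∈ Finset.range (b + 1) := fun v =>
    Finset.mem_range.2 (Nat.lt_succ_of_le Finset.card_image_le)
  rw [← Finset.sum_filter, ← Finset.sum_fiberwise_of_maps_to
    (g := fun v : β → Fin N => (Finset.univ.image v).card) (t := Finset.range (b + 1))
    (fun v _ => himg v)]
  have key : ∀ d ∈ Finset.range (b + 1),
      ∑ v ∈ Finset.univ.filter (fun v : β → Fin N => Y ⊆ Finset.univ.image v) with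
        (Finset.univ.image v).card = d, ((N : ℝ) ^ (Finset.univ.image v).card)⁻¹
      ≤ (b ^ b : ℕ) * ((N : ℝ) ^ Y.card)⁻¹ := by
    intro d hd
    have hd' : d ≤ b := Nat.lt_succ_iff.1 (Finset.mem_range.1 hd)
    set F := (Finset.univ.filter (fun v : β → Fin N => Y ⊆ Finset.univ.image v)).filter
      (fun v => (Finset.univ.image v).card = d) with hF
    rw [Finset.sum_congr rfl (g := fun _ => ((N : ℝ) ^ d)⁻¹) (fun v hv => by
      rw [(Finset.mem_filter.1 hv).2]), Finset.sum_const, nsmul_eq_mul]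
    by_cases hYd : Y.card ≤ d
    -- An image `D` of size `d` containing `Y` is determined by `D \ Y`, and at most `d ^ b`
    -- functions take values in `D`. Against the weight `N ^ (-d)` this leaves `N ^ (-Y.card)` for
    -- each of the `b + 1` possible sizes.
    · have hcard : F.card ≤ b ^ b * N ^ (d - Y.card) := by
        have h1 : (F.image fun v => Finset.univ.image v).card ≤ N ^ (d - Y.card) := by
          have : (F.image fun v => Finset.univ.image v).card
              ≤ (Finset.powersetCard (d - Y.card) (Finset.univ : Finset (Fin N))).card := by
            refine Finset.card_le_card_of_injOn (fun D => D \ Y) ?_ ?_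
            · intro D hD
              simp only [Finset.coe_image, Set.mem_image, Finset.mem_coe, hF, Finset.mem_filter,
                Finset.mem_univ, true_and] at hD
              obtain ⟨v, ⟨hv, hc⟩, rfl⟩ := hD
              rw [Finset.mem_coe, Finset.mem_powersetCard]
              exact ⟨Finset.subset_univ _, by rw [Finset.card_sdiff_of_subset hv, hc]⟩
            · intro D hD D' hD' hDD
              simp only [Finset.coe_image, Set.mem_image, Finset.mem_coe, hF, Finset.mem_filter,
                Finset.mem_univ, true_and] at hD hD'
              obtain ⟨v, ⟨hv, hc⟩, rfl⟩ := hD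
              obtain ⟨v', ⟨hv', hc'⟩, rfl⟩ := hD'
              have hDD : Finset.univ.image v \ Y = Finset.univ.image v' \ Y := hDD
              rw [← Finset.sdiff_union_of_subset hv, ← Finset.sdiff_union_of_subset hv', hDD]
          refine this.trans ?_
          rw [Finset.card_powersetCard, Finset.card_univ, Fintype.card_fin]
          exact Nat.choose_le_pow _ _
        refine (Finset.card_le_mul_card_image (f := fun v : β → Fin N => Finset.univ.image v) F
          (b ^ b) ?_).trans (Nat.mul_le_mul_left _ h1)
        intro D hD
        obtain ⟨v, hv, rfl⟩ := Finset.mem_image.1 hD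
        have hc : (Finset.univ.image v).card = d := (Finset.mem_filter.1 hv).2
        have : (F.filter fun w => Finset.univ.image w = Finset.univ.image v).card
            ≤ (Fintype.piFinset fun _ : β => Finset.univ.image v).card := by
          refine Finset.card_le_card ?_
          intro w hw
          rw [Fintype.mem_piFinset]
          intro x
          rw [← (Finset.mem_filter.1 hw).2]
          exact Finset.mem_image_of_mem _ (Finset.mem_univ _)
        refine this.trans ?_
        rw [Fintype.card_piFinset, Finset.prod_const, hc, Finset.card_univ]
        exact Nat.pow_le_pow_left hd' _
      have : (F.card : ℝ) ≤ (b ^ b : ℕ) * (N : ℝ) ^ (d - Y.card) := by exact_mod_cast hcard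
      refine (mul_le_mul_of_nonneg_right this (by positivity)).trans (le_of_eq ?_)
      rw [mul_assoc]
      congr 1
      rw [← div_eq_mul_inv, div_eq_iff (by positivity), inv_mul_eq_div,
        eq_div_iff (by positivity), ← pow_add]
      congr 1
      omega
    · have : F = ∅ := by
        refine Finset.filter_eq_empty_iff.2 ?_
        intro v hv hc
        have := Finset.card_le_card (Finset.mem_filter.1 hv).2
        omega
      rw [this]
      simp only [Finset.card_empty, Nat.cast_zero, zero_mul]
      positivity
  refine (Finset.sum_le_sum key).trans (le_of_eq ?_)
  rw [Finset.sum_const, Finset.card_range, nsmul_eq_mul]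
  push_cast
  ring

/-- A choice of base values with `d` distinct values is weighted by `N ^ (A - d)`, which balances
the roughly `N ^ d` such choices. Prescribing `Y` among the values gains a factor `N` for each of
its elements. -/
theorem sum_card_fibers_le {N : ℕ} (hN : 1 ≤ N) {β κ : Type*} [Fintype β] [DecidableEq β]
    (𝒦 : Finset κ) (base : κ → β → Fin N) (Y : Finset (Fin N)) (A : ℕ)
    (hY : ∀ K ∈ 𝒦, Y ⊆ Finset.univ.image (base K))
    (h : ∀ K₀ ∈ 𝒦, ∀ S ⊆ 𝒦, (∀ K ∈ S, base K = base K₀) →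
      S.card * N ^ (Finset.univ.image (base K₀)).card ≤ N ^ A) :
    (𝒦.card : ℝ) * (N : ℝ) ^ Y.card
      ≤ ((Fintype.card β + 1) * Fintype.card β ^ Fintype.card β : ℕ) * (N : ℝ) ^ A := by
  classical
  have hNr : (0 : ℝ) < N := by exact_mod_cast hN
  have h1 : (𝒦.card : ℝ) ≤ (N : ℝ) ^ A * ∑ v : β → Fin N, (if Y ⊆ Finset.univ.image v then
        ((N : ℝ) ^ (Finset.univ.image v).card)⁻¹ else 0) := by
    rw [Finset.card_eq_sum_card_fiberwise (f := base) (t := Finset.univ)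
      (fun _ _ => Finset.mem_univ _), Finset.mul_sum]
    push_cast
    refine Finset.sum_le_sum fun v _ => ?_
    rcases (𝒦.filter fun K => base K = v).eq_empty_or_nonempty with he | ⟨K₀, hK₀⟩
    · rw [he]
      simp only [Finset.card_empty, Nat.cast_zero]
      positivity
    · obtain ⟨hK, rfl⟩ := Finset.mem_filter.1 hK₀
      rw [if_pos (hY K₀ hK), ← div_eq_mul_inv, le_div_iff₀ (by positivity)]
      exact_mod_cast h K₀ hK _ (Finset.filter_subset _ _) fun K hK => (Finset.mem_filter.1 hK).2
  have h2 := h1.trans (mul_le_mul_of_nonneg_left (sum_image_le β hN Y) (by positivity))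
  calc (𝒦.card : ℝ) * (N : ℝ) ^ Y.card
      ≤ ((N : ℝ) ^ A * (((Fintype.card β + 1) * Fintype.card β ^ Fintype.card β : ℕ)
        * ((N : ℝ) ^ Y.card)⁻¹)) * (N : ℝ) ^ Y.card :=
        mul_le_mul_of_nonneg_right h2 (by positivity)
    _ = _ := by field_simp

/-! ### Alternating paths -/

/-- In an alternating path, the points with base role and the points with exponent role alternate;
`t` says whether the first point has base role. -/
def isBase (t : Bool) (j : ℕ) : Bool := xor t j.bodd

@[simp] theorem isBase_zero (t : Bool) : isBase t 0 = t := by simp [isBase]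

@[simp] theorem isBase_succ (t : Bool) (j : ℕ) : isBase t (j + 1) = !isBase t j := by
  simp [isBase]

/-- The exponents of the monomial contributed by an alternating path. -/
def altDeg {N m : ℕ} (t : Bool) (K : Fin (m + 1) → Fin N) : Fin N → ℤ :=
  pathDeg (fun j : Fin m => !isBase t j) K

/-- The values at the points with base role. -/
def baseSet {N m : ℕ} (t : Bool) (K : Fin (m + 1) → Fin N) : Finset (Fin N) :=
  {j : Fin (m + 1) | isBase t j = true}.toFinset.image K

theorem mem_baseSet {N m : ℕ} {t : Bool} {K : Fin (m + 1) → Fin N} {y : Fin N} :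
    y ∈ baseSet t K ↔ ∃ j : Fin (m + 1), isBase t j = true ∧ K j = y := by
  simp [baseSet]

/-- The interior points with exponent role. -/
abbrev InnerPos (m : ℕ) (t : Bool) :=
  {j : Fin (m + 1) // isBase t j = false ∧ 0 < (j : ℕ) ∧ (j : ℕ) < m}

/-- The points with base role. -/
abbrev BasePos (m : ℕ) (t : Bool) := {j : Fin (m + 1) // isBase t j = true}

/-- The preceding point of a path. -/
def prevPos {m : ℕ} (p : Fin (m + 1)) : Fin (m + 1) := ⟨p - 1, by omega⟩

/-- The following point of a path. -/
def nextPos {m : ℕ} (p : Fin (m + 1)) : Fin (m + 1) := ⟨min (p + 1) m, by omega⟩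

/-- The first point with base role. -/
def firstPos (m : ℕ) (t : Bool) : Fin (m + 1) := if t then 0 else ⟨min 1 m, by omega⟩

/-- Each of the `m` letters touches exactly one point with exponent role. Interior points of this
kind are touched by two letters, end points by one. The excluded case is a single exponent point,
which is both ends at once. -/
theorem card_innerPos (m : ℕ) (t : Bool) (h : 1 ≤ m ∨ t = true) :
    2 * Fintype.card (InnerPos m t) + (!t).toNat + (!isBase t m).toNat = m := by
  have h1 : Fintype.card (InnerPos m t)
      = ((Finset.range m).filter fun j => isBase t j = false ∧ 0 < j).card := by
    rw [Fintype.card_subtype]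
    refine Finset.card_bij (fun j _ => (j : ℕ)) ?_ ?_ ?_
    · intro j hj
      simp at hj ⊢
      tauto
    · intro i _ j _ hij
      exact Fin.ext hij
    · intro j hj
      simp at hj
      exact ⟨⟨j, by omega⟩, by simp; tauto, rfl⟩
  rw [h1]
  clear h1
  induction m with
  | zero => simp at h; simp [h]
  | succ m ih =>
    rw [Finset.range_add_one, Finset.filter_insert]
    rcases Nat.eq_zero_or_pos m with rfl | hm
    · cases t <;> simp
    · have ih := ih (Or.inl hm)
      rcases hb : isBase t m with _ | _
      · rw [if_pos ⟨rfl, hm⟩, Finset.card_insert_of_notMem (by simp)]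
        rw [hb] at ih
        simp [hb] at ih ⊢
        omega
      · rw [if_neg (by simp)]
        rw [hb] at ih
        simp [hb] at ih ⊢
        omega

/-- With bases and ends fixed, the degree is affine in the interior exponents. Each exponent enters
with a plus sign at the preceding base and a minus sign at the following one, so it acts as the flow
along an edge between the two. -/
theorem altDeg_sub {N m : ℕ} (t : Bool) (K K' : Fin (m + 1) → Fin N)
    (hb : ∀ j : Fin (m + 1), isBase t j = true → K j = K' j) (h0 : K 0 = K' 0)
    (h1 : K (Fin.last m) = K' (Fin.last m)) :
    altDeg t K - altDeg t K' = ∑ p : InnerPos m t, ((K p : ℤ) - (K' p : ℤ)) •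
      (Pi.single (K (prevPos p)) 1 - Pi.single (K (nextPos p)) 1 : Fin N → ℤ) := by
  set G₁ : Fin (m + 1) → Fin N → ℤ := fun p => if isBase t p then 0 else
    ((K p : ℤ) - (K' p : ℤ)) • (Pi.single (K (prevPos p)) 1 : Fin N → ℤ) with hG₁
  set G₂ : Fin (m + 1) → Fin N → ℤ := fun p => if isBase t p then 0 else
    ((K p : ℤ) - (K' p : ℤ)) • (Pi.single (K (nextPos p)) 1 : Fin N → ℤ) with hG₂
  have e1 : ∑ p, G₁ p = ∑ j : Fin m, G₁ j.succ := by
    rw [Fin.sum_univ_succ, show G₁ 0 = 0 by simp [hG₁, h0], zero_add]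
  have e2 : ∑ p, G₂ p = ∑ j : Fin m, G₂ j.castSucc := by
    rw [Fin.sum_univ_castSucc, show G₂ (Fin.last m) = 0 by simp [hG₂, h1], add_zero]
  have e3 : altDeg t K - altDeg t K' = ∑ p, G₁ p - ∑ p, G₂ p := by
    rw [e1, e2, altDeg, altDeg, pathDeg, pathDeg, ← Finset.sum_sub_distrib,
      ← Finset.sum_sub_distrib]
    refine Finset.sum_congr rfl fun j _ => ?_
    have hp : prevPos j.succ = j.castSucc := by ext; simp [prevPos]
    have hn : nextPos j.castSucc = j.succ := by
      ext; simp only [nextPos, Fin.val_castSucc, Fin.val_succ]; omega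
    rcases hj : isBase t j with _ | _
    · have := hb j.succ (by simp [hj])
      simp only [hG₁, hG₂, hn, Fin.val_succ, isBase_succ, Fin.val_castSucc, hj, Bool.not_false,
        if_true, Bool.false_eq_true, if_false, this]
      ext y
      simp only [Pi.sub_apply, Pi.neg_apply, Pi.smul_apply, Pi.single_apply, smul_eq_mul,
        Pi.zero_apply]
      split_ifs <;> ring
    · have := hb j.castSucc (by simp [hj])
      simp only [hG₁, hG₂, hp, Fin.val_succ, isBase_succ, Fin.val_castSucc, hj, Bool.not_true,
        if_true, Bool.false_eq_true, if_false, this]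
      ext y
      simp only [Pi.sub_apply, Pi.smul_apply, Pi.single_apply, smul_eq_mul, Pi.zero_apply]
      split_ifs <;> ring
  rw [e3, ← Finset.sum_sub_distrib]
  have e4 := Finset.sum_subtype_of_mem (s := Finset.univ.filter fun j : Fin (m + 1) =>
    isBase t j = false ∧ 0 < (j : ℕ) ∧ (j : ℕ) < m) (p := fun j : Fin (m + 1) =>
    isBase t j = false ∧ 0 < (j : ℕ) ∧ (j : ℕ) < m) (f := fun p : Fin (m + 1) =>
    ((K p : ℤ) - (K' p : ℤ)) •
      (Pi.single (K (prevPos p)) 1 - Pi.single (K (nextPos p)) 1 : Fin N → ℤ)) (by simp)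
  rw [Finset.subtype_eq_univ.2 (by simp)] at e4
  rw [e4, Finset.sum_filter]
  refine Finset.sum_congr rfl fun p _ => ?_
  rcases hp : isBase t p with _ | _
  · simp only [hG₁, hG₂, hp, Bool.false_eq_true, if_false, true_and]
    rw [← smul_sub]
    split_ifs with h
    · rfl
    · have : K p = K' p := by
        rcases Nat.eq_zero_or_pos (p : ℕ) with h' | h'
        · rw [show p = 0 from Fin.ext h', h0]
        · rw [show p = Fin.last m from Fin.ext (by simp; omega), h1]
      rw [this, sub_self, zero_smul]
  · simp [hG₁, hG₂, hp]

/-! ### Systems of alternating paths as flow networks -/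

section System

variable {ι : Type*} {N : ℕ} (m : ι → ℕ) (t : ι → Bool)

/-- The tails of the edges of a system of alternating paths. -/
def tail (K : ∀ i, Fin (m i + 1) → Fin N) (e : Σ i, InnerPos (m i) (t i)) : Fin N :=
  K e.1 (prevPos e.2)

/-- The heads of the edges of a system of alternating paths. -/
def head (K : ∀ i, Fin (m i + 1) → Fin N) (e : Σ i, InnerPos (m i) (t i)) : Fin N :=
  K e.1 (nextPos e.2)

/-- The values of a system of paths at the points with base role. -/
def baseValues (K : ∀ i, Fin (m i + 1) → Fin N) (p : Σ i, BasePos (m i) (t i)) : Fin N :=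
  K p.1 p.2

/-- Two consecutive base points are joined by the edge of the exponent between them, so all bases of
one path lie in one component. -/
theorem eqvGen_firstPos (K : ∀ i, Fin (m i + 1) → Fin N) (i : ι) :
    ∀ (j : ℕ) (hj : j < m i + 1), isBase (t i) j = true →
    Relation.EqvGen (EdgeRel (tail m t K) (head m t K)) (K i ⟨j, hj⟩) (K i (firstPos (m i) (t i)))
  | 0, hj, h => by
    have h : t i = true := by simpa using h
    have : (⟨0, hj⟩ : Fin (m i + 1)) = firstPos (m i) (t i) := by
      ext; simp [firstPos, h]
    rw [this]
    exact Relation.EqvGen.refl _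
  | 1, hj, h => by
    have h : t i = false := by simpa [isBase] using h
    have : (⟨1, hj⟩ : Fin (m i + 1)) = firstPos (m i) (t i) := by
      ext; simp [firstPos, h]; omega
    rw [this]
    exact Relation.EqvGen.refl _
  | j + 2, hj, h => by
    refine Relation.EqvGen.trans _ _ _ (Relation.EqvGen.symm _ _ (Relation.EqvGen.rel _ _
      ⟨⟨i, ⟨⟨j + 1, by omega⟩, ?_⟩⟩, rfl, ?_⟩)) (eqvGen_firstPos K i j (by omega) ?_)
    · simp at h ⊢
      exact ⟨h, by omega⟩
    · simp only [head, nextPos]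
      congr 2
      omega
    · simpa using h

/-- For fixed bases and ends, the interior exponents satisfy a flow equation on the graph of bases,
and `card_flow_le` applies. The roots need only meet every component, so overlaps between paths save
factors of `N`. -/
theorem card_fiber_le [Fintype ι] [DecidableEq ι]
    (K₀ : ∀ i, Fin (m i + 1) → Fin N)
    (S : Finset (∀ i, Fin (m i + 1) → Fin N))
    (hbase : ∀ K ∈ S, baseValues m t K = baseValues m t K₀)
    (hend : ∀ K ∈ S, ∀ K' ∈ S, ∀ i, K i 0 = K' i 0 ∧ K i (Fin.last _) = K' i (Fin.last _))
    (hdeg : ∀ K ∈ S, ∑ i, altDeg (t i) (K i) = 0) {C : Type*} [Fintype C] (ρ : C → Fin N)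
    (h : ∀ i, ∃ c, Relation.EqvGen (EdgeRel (tail m t K₀) (head m t K₀))
      (K₀ i (firstPos (m i) (t i))) (ρ c)) :
    S.card * N ^ (Finset.univ.image (baseValues m t K₀)).card
      ≤ N ^ (∑ i, Fintype.card (InnerPos (m i) (t i)) + Fintype.card C) := by
  classical
  have hb : ∀ K ∈ S, ∀ i, ∀ j : Fin (m i + 1), isBase (t i) j = true → K i j = K₀ i j :=
    fun K hK i j hj => congr_fun (hbase K hK) ⟨i, ⟨j, hj⟩⟩
  set r : (∀ i, Fin (m i + 1) → Fin N) → (Σ i, InnerPos (m i) (t i)) → Fin N :=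
    fun K e => K e.1 e.2 with hr
  have hinj : Set.InjOn r S := by
    intro K hK K' hK' hKK
    funext i j
    rcases hj : isBase (t i) j with _ | _
    · by_cases h' : 0 < (j : ℕ) ∧ (j : ℕ) < m i
      · exact congr_fun hKK ⟨i, ⟨j, hj, h'⟩⟩
      · rcases Nat.eq_zero_or_pos (j : ℕ) with h'' | h''
        · rw [show j = 0 from Fin.ext h'']
          exact (hend K hK K' hK' i).1
        · rw [show j = Fin.last _ from Fin.ext (by simp; omega)]
          exact (hend K hK K' hK' i).2
    · rw [hb K hK i j hj, hb K' hK' i j hj]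
  have key := card_flow_le (tail m t K₀) (head m t K₀) (Finset.univ.image (baseValues m t K₀)) ρ
    ?_ (S.image r) ?_
  · rwa [Finset.card_image_of_injOn hinj, Fintype.card_sigma] at key
  · intro y hy
    obtain ⟨⟨i, j, hj⟩, -, rfl⟩ := Finset.mem_image.1 hy
    obtain ⟨c, hc⟩ := h i
    exact ⟨c, (eqvGen_firstPos m t K₀ i j j.2 hj).trans _ _ _ hc⟩
  · intro x hx x' hx'
    obtain ⟨K, hK, rfl⟩ := Finset.mem_image.1 hx
    obtain ⟨K', hK', rfl⟩ := Finset.mem_image.1 hx'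
    rw [Fintype.sum_sigma]
    have : ∑ i, (altDeg (t i) (K i) - altDeg (t i) (K' i)) = 0 := by
      rw [Finset.sum_sub_distrib, hdeg K hK, hdeg K' hK', sub_zero]
    rw [← this]
    refine Finset.sum_congr rfl fun i _ => ?_
    rw [altDeg_sub (t i) (K i) (K' i) (fun j hj => by rw [hb K hK i j hj, hb K' hK' i j hj])
      (hend K hK K' hK' i).1 (hend K hK K' hK' i).2]
    refine Finset.sum_congr rfl fun p _ => ?_
    obtain ⟨j, hj1, hj2, hj3⟩ := p
    have e1 : isBase (t i) (prevPos j) = true := by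
      simp only [prevPos]
      have := isBase_succ (t i) (j - 1)
      rw [Nat.sub_add_cancel hj2, hj1] at this
      simpa using this.symm
    have e2 : isBase (t i) (nextPos j) = true := by
      simp only [nextPos]
      rw [min_eq_left (by omega), isBase_succ, hj1]
      rfl
    simp only [hr, tail, head, hb K hK i _ e1, hb K hK i _ e2]

end System

/-- Single alternating paths with given ends, whose base values include `Y`. -/
theorem card_path_le (m : ℕ) (t : Bool) : ∃ C : ℝ, 0 ≤ C ∧
    ∀ (N : ℕ) (_ : 1 ≤ N) (k l : Fin N) (Y : Finset (Fin N))
      (S : Finset (Fin (m + 1) → Fin N)),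
      (∀ K ∈ S, K 0 = k ∧ K (Fin.last m) = l ∧ altDeg t K = 0 ∧ Y ⊆ baseSet t K) →
      (S.card : ℝ) * (N : ℝ) ^ Y.card ≤ C * (N : ℝ) ^ (Fintype.card (InnerPos m t) + 1) := by
  refine ⟨_, by positivity, fun N hN k l Y S hS => sum_card_fibers_le (β := Σ _ : Unit, BasePos m t)
    hN S (fun K => baseValues (fun _ : Unit => m) (fun _ => t) fun _ => K) Y _ ?_ ?_⟩
  · intro K hK y hy
    obtain ⟨j, hj, rfl⟩ := mem_baseSet.1 ((hS K hK).2.2.2 hy)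
    exact Finset.mem_image.2 ⟨⟨(), ⟨j, hj⟩⟩, Finset.mem_univ _, rfl⟩
  · intro K₀ hK₀ S' hS' hb
    -- A single path is connected, so one root suffices; it accounts for the `+ 1` in the exponent.
    have := card_fiber_le (fun _ : Unit => m) (fun _ => t) (fun _ => K₀)
      (S'.map ⟨fun K _ => K, fun K K' h => congr_fun h ()⟩) ?_ ?_ ?_ (C := Unit)
      (fun _ => K₀ (firstPos m t)) (fun _ => ⟨(), Relation.EqvGen.refl _⟩)
    · simpa using this
    · intro K' hK'
      obtain ⟨K, hK, rfl⟩ := Finset.mem_map.1 hK'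
      exact hb K hK
    · intro L hL L' hL' _
      obtain ⟨K, hK, rfl⟩ := Finset.mem_map.1 hL
      obtain ⟨K', hK', rfl⟩ := Finset.mem_map.1 hL'
      have h1 := hS K (hS' hK)
      have h2 := hS K' (hS' hK')
      exact ⟨h1.1.trans h2.1.symm, h1.2.1.trans h2.2.1.symm⟩
    · intro K' hK'
      obtain ⟨K, hK, rfl⟩ := Finset.mem_map.1 hK'
      rw [Finset.univ_unique, Finset.sum_singleton]
      exact (hS K (hS' hK)).2.2.1

/-- Every class has at least two elements. -/
theorem two_mul_card_quotient_le {ι : Type*} [Fintype ι] (r : Setoid ι)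
    [Fintype (Quotient r)] (h : ∀ i, ∃ i', i' ≠ i ∧ r i i') :
    2 * Fintype.card (Quotient r) ≤ Fintype.card ι := by
  classical
  rw [← Finset.card_univ (α := ι), Finset.card_eq_sum_card_fiberwise (f := Quotient.mk r)
    (t := Finset.univ) (fun _ _ => Finset.mem_univ _), mul_comm, ← smul_eq_mul,
    ← Finset.card_univ]
  refine Finset.card_nsmul_le_sum _ _ _ fun q _ => ?_
  obtain ⟨i, rfl⟩ := Quotient.exists_rep q
  obtain ⟨i', hne, hr⟩ := h i
  refine Finset.one_lt_card.2 ⟨i, by simp, i', ?_, hne.symm⟩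
  simp only [Finset.mem_filter, Finset.mem_univ, true_and]
  exact Quotient.sound (r.symm hr)

/-- The chains of alternating paths, closed up cyclically, that have total degree zero and in
which every path shares a base value with another one. The types `T` of the joints are such that
every joint has base role on exactly one side. -/
theorem card_noniso_le {s : ℕ} (m : Fin (s + 1) → ℕ) (t : Fin (s + 1) → Bool)
    (hm : ∀ i, 1 ≤ m i ∨ t i = true) (T : Fin (s + 2) → Bool)
    (hT : ∀ i, T i.castSucc = t i) (hT' : ∀ i, isBase (t i) (m i) = !T i.succ) :
    ∃ C : ℝ, 0 ≤ C ∧ ∀ (N : ℕ) (_ : 1 ≤ N) (𝒦 : Finset (∀ i, Fin (m i + 1) → Fin N)),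
      (∀ K ∈ 𝒦, (∃ κ : Fin (s + 2) → Fin N, κ 0 = κ (Fin.last _) ∧
          ∀ i, K i 0 = κ i.castSucc ∧ K i (Fin.last _) = κ i.succ) ∧
        ∑ i, altDeg (t i) (K i) = 0 ∧
        ∀ i, ∃ i', i' ≠ i ∧ ¬Disjoint (baseSet (t i) (K i)) (baseSet (t i') (K i'))) →
      (𝒦.card : ℝ) ≤ C * Real.sqrt N ^ (∑ i, m i + 1) := by
  classical
  -- The closing joint has exponent role on both sides exactly in this case. Its value is then not
  -- among the bases and costs a further factor `N`.
  set u : ℕ := if T 0 = false ∧ T (Fin.last _) = true then 1 else 0 with hu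
  set E := ∑ i, Fintype.card (InnerPos (m i) (t i)) with hE
  set A := u + (E + (s + 1) / 2) with hA
  -- By `card_innerPos` the total length is `2 * E` plus the number of exponent ends. Each of the
  -- `s` inner joints contributes one such end, and the closing joint contributes at least `2 * u`.
  have h2A : 2 * A ≤ ∑ i, m i + 1 := by
    have h1 : ∑ i, m i = ∑ i, (2 * Fintype.card (InnerPos (m i) (t i)) + (!t i).toNat
        + (!isBase (t i) (m i)).toNat) :=
      Finset.sum_congr rfl fun i _ => (card_innerPos _ _ (hm i)).symm
    rw [Finset.sum_add_distrib, Finset.sum_add_distrib, ← Finset.mul_sum] at h1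
    have h2 : ∑ i : Fin (s + 1), (!t i).toNat + ∑ i : Fin (s + 1), (!isBase (t i) (m i)).toNat
        = (!T 0).toNat + (T (Fin.last _)).toNat + s := by
      have e1 : ∑ i : Fin (s + 1), (!t i).toNat
          = (!T 0).toNat + ∑ i : Fin s, (!T i.succ.castSucc).toNat := by
        simp_rw [← hT]
        rw [Fin.sum_univ_succ]; rfl
      have e2 : ∑ i : Fin (s + 1), (!isBase (t i) (m i)).toNat
          = ∑ i : Fin s, (T i.succ.castSucc).toNat + (T (Fin.last _)).toNat := by
        simp_rw [hT', Bool.not_not]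
        rw [Fin.sum_univ_castSucc]; rfl
      have e3 : ∑ i : Fin s, (!T i.succ.castSucc).toNat + ∑ i : Fin s, (T i.succ.castSucc).toNat
          = s := by
        rw [← Finset.sum_add_distrib]
        have : ∀ b : Bool, (!b).toNat + b.toNat = 1 := by decide
        simp [this]
      omega
    have h3 : 2 * u ≤ (!T 0).toNat + (T (Fin.last _)).toNat := by
      rw [hu]
      split_ifs with h
      · simp [h.1, h.2]
      · omega
    omega
  refine ⟨_, Nat.cast_nonneg ((Fintype.card (Σ i, BasePos (m i) (t i)) + 1) *
    Fintype.card (Σ i, BasePos (m i) (t i)) ^ Fintype.card (Σ i, BasePos (m i) (t i))),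
    fun N hN 𝒦 h𝒦 => ?_⟩
  have hNr : (0 : ℝ) < N := by exact_mod_cast hN
  have key := sum_card_fibers_le hN 𝒦 (baseValues m t) ∅ A (by simp) ?_
  · rw [Finset.card_empty, pow_zero, mul_one] at key
    refine key.trans (mul_le_mul_of_nonneg_left ?_ (by positivity))
    have h1 : (N : ℝ) ^ A = Real.sqrt N ^ (2 * A) := by
      rw [pow_mul, Real.sq_sqrt hNr.le]
    rw [h1]
    exact pow_le_pow_right₀ (Real.one_le_sqrt.2 (by exact_mod_cast hN)) h2A
  intro K₀ hK₀ S hS hbS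
  -- An inner joint has base role on one of its two sides, so it is read off the base values. Only
  -- the closing joint can escape this.
  have hends : ∀ K ∈ S, ∀ K' ∈ S, (u = 0 ∨ K 0 0 = K' 0 0) →
      ∀ i, K i 0 = K' i 0 ∧ K i (Fin.last _) = K' i (Fin.last _) := by
    intro K hK K' hK' hu'
    obtain ⟨κ, hc, hκ⟩ := (h𝒦 K (hS hK)).1
    obtain ⟨κ', hc', hκ'⟩ := (h𝒦 K' (hS hK')).1
    have hb : ∀ i, ∀ j : Fin (m i + 1), isBase (t i) j = true → K i j = K' i j :=
      fun i j hj => congr_fun ((hbS K hK).trans (hbS K' hK').symm) ⟨i, ⟨j, hj⟩⟩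
    have hl : ∀ i : Fin (s + 1), T i.castSucc = true → κ i.castSucc = κ' i.castSucc := fun i hi => by
      rw [← (hκ i).1, ← (hκ' i).1]
      exact hb i 0 (by rw [hT] at hi; simpa using hi)
    have hr : ∀ i : Fin (s + 1), T i.succ = false → κ i.succ = κ' i.succ := fun i hi => by
      rw [← (hκ i).2, ← (hκ' i).2]
      exact hb i (Fin.last _) (by rw [Fin.val_last, hT', hi]; rfl)
    have h0 : κ 0 = κ' 0 := by
      rcases h : T 0 with _ | _
      · rcases h' : T (Fin.last _) with _ | _
        · rw [hc, hc']
          exact hr (Fin.last _) h'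
        · rcases hu' with hu' | hu'
          · simp [hu, h, h'] at hu'
          · have e1 := (hκ 0).1
            have e2 := (hκ' 0).1
            rw [Fin.castSucc_zero] at e1 e2
            rw [← e1, ← e2, hu']
      · exact hl 0 h
    have hall : ∀ p, κ p = κ' p := by
      intro p
      rcases Fin.eq_castSucc_or_eq_last p with ⟨i, rfl⟩ | rfl
      · rcases h : T i.castSucc with _ | _
        · rcases Fin.eq_zero_or_eq_succ i.castSucc with hi | ⟨i', hi⟩
          · rw [hi, h0]
          · rw [hi] at h ⊢
            exact hr i' h
        · exact hl i h
      · rw [← hc, ← hc', h0]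
    intro i
    rw [(hκ i).1, (hκ i).2, (hκ' i).1, (hκ' i).2]
    exact ⟨hall _, hall _⟩
  set R : Fin (s + 1) → Fin N := fun i => K₀ i (firstPos (m i) (t i))
  set rel := Relation.EqvGen (EdgeRel (tail m t K₀) (head m t K₀))
  let r : Setoid (Fin (s + 1)) := (Relation.EqvGen.setoid (EdgeRel (tail m t K₀)
    (head m t K₀))).comap R
  -- Paths sharing a base lie in the same component, so every component contains at least two of the
  -- `s + 1` paths.
  have hcardQ : Fintype.card (Quotient r) ≤ (s + 1) / 2 := by
    have := two_mul_card_quotient_le r ?_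
    · rw [Fintype.card_fin] at this
      omega
    · intro i
      obtain ⟨i', hne, hd⟩ := (h𝒦 K₀ hK₀).2.2 i
      refine ⟨i', hne, ?_⟩
      obtain ⟨y, hy, hy'⟩ := Finset.not_disjoint_iff.1 hd
      obtain ⟨j, hj, rfl⟩ := mem_baseSet.1 hy
      obtain ⟨j', hj', e⟩ := mem_baseSet.1 hy'
      have e1 := eqvGen_firstPos m t K₀ i j j.2 hj
      have e2 := eqvGen_firstPos m t K₀ i' j' j'.2 hj'
      simp only [Fin.eta] at e1 e2
      rw [e] at e2
      exact (e1.symm _ _).trans _ _ _ e2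
  have hS' : ∀ S' ⊆ S, (∀ K ∈ S', ∀ K' ∈ S', u = 0 ∨ K 0 0 = K' 0 0) →
      S'.card * N ^ (Finset.univ.image (baseValues m t K₀)).card ≤ N ^ (E + (s + 1) / 2) := by
    intro S' hsub hu'
    refine (card_fiber_le m t K₀ S' (fun K hK => hbS K (hsub hK))
      (fun K hK K' hK' => hends K (hsub hK) K' (hsub hK') (hu' K hK K' hK'))
      (fun K hK => (h𝒦 K (hS (hsub hK))).2.1) (C := Quotient r) (fun q => R q.out) ?_).trans ?_
    · intro i
      refine ⟨Quotient.mk r i, ?_⟩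
      exact r.symm (Quotient.exact (Quotient.out_eq (Quotient.mk r i)))
    · exact Nat.pow_le_pow_right hN (by omega)
  rcases Nat.eq_zero_or_pos u with hu0 | hu0
  · have := hS' S subset_rfl fun _ _ _ _ => Or.inl hu0
    rwa [hA, hu0, zero_add]
  · have hu1 : u = 1 := by
      rw [hu] at hu0 ⊢
      split_ifs at hu0 ⊢ <;> simp_all
    rw [Finset.card_eq_sum_card_fiberwise (f := fun K => K 0 0) (t := Finset.univ)
      (fun _ _ => Finset.mem_univ _), Finset.sum_mul]
    refine (Finset.sum_le_card_nsmul _ _ (N ^ (E + (s + 1) / 2)) fun w _ => ?_).trans ?_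
    · refine hS' _ (Finset.filter_subset _ _) fun K hK K' hK' => Or.inr ?_
      rw [(Finset.mem_filter.1 hK).2, (Finset.mem_filter.1 hK').2]
    · rw [Finset.card_univ, Fintype.card_fin, smul_eq_mul, hA, hu1, pow_add N 1, pow_one]

/-! ### Averages over the grid -/

/-- The average of a function over the grid points. -/
noncomputable def gridMean (N : ℕ) (f : unitInterval → ℂ) : ℂ :=
  (N : ℂ)⁻¹ * ∑ k : Fin N, f (gridPoint k)

theorem tau_eq_interval (f : CI) :
    tau f = ∫ x in (0 : ℝ)..1, Set.IccExtend zero_le_one f x := by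
  rw [tau, intervalIntegral.integral_of_le zero_le_one, ← integral_Icc_eq_integral_Ioc,
    ← integral_subtype_comap measurableSet_Icc]
  refine integral_congr_ae (Eventually.of_forall fun x => ?_)
  exact (Set.IccExtend_val zero_le_one f x).symm

/-- Right-endpoint Riemann sums: uniform continuity bounds the error on each of the `N` cells by `ε
/ (2 * N)`. -/
theorem tendsto_gridMean (f : CI) : Tendsto (fun N => gridMean N f) atTop (𝓝 (tau f)) := by
  rw [Metric.tendsto_atTop]
  intro ε hε
  obtain ⟨δ, hδ, huc⟩ := Metric.uniformContinuous_iff.1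
    (CompactSpace.uniformContinuous_of_continuous f.continuous) (ε / 2) (half_pos hε)
  obtain ⟨n₀, hn₀⟩ := exists_nat_one_div_lt hδ
  refine ⟨n₀ + 1, fun N hN => ?_⟩
  have hNpos : 0 < N := by omega
  have hNr : (0 : ℝ) < N := by exact_mod_cast hNpos
  have hNδ : 1 / (N : ℝ) < δ := by
    refine lt_of_le_of_lt ?_ hn₀
    exact one_div_le_one_div_of_le (by positivity) (by exact_mod_cast hN)
  set F : ℝ → ℂ := Set.IccExtend zero_le_one f with hF
  have hFc : Continuous F := f.continuous.Icc_extend'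
  set a : ℕ → ℝ := fun k => (k : ℝ) / N with ha
  have h1 : tau f = ∑ k ∈ Finset.range N, ∫ x in a k..a (k + 1), F x := by
    rw [intervalIntegral.sum_integral_adjacent_intervals fun k _ => hFc.intervalIntegrable _ _,
      tau_eq_interval]
    simp [ha, hNr.ne', hF]
  have h2 : gridMean N f = ∑ k ∈ Finset.range N, ∫ x in a k..a (k + 1), F (a (k + 1)) := by
    rw [gridMean, Finset.mul_sum, Finset.sum_range]
    refine Finset.sum_congr rfl fun k _ => ?_
    rw [intervalIntegral.integral_const]
    have e1 : a (k + 1) - a k = (N : ℝ)⁻¹ := by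
      simp only [ha]; push_cast; field_simp; ring
    have e2 : F (a (k + 1)) = f (gridPoint k) := by
      rw [hF, ← Set.IccExtend_val zero_le_one f (gridPoint k)]
      rfl
    rw [e1, e2, Complex.real_smul]
    push_cast
    rfl
  rw [dist_eq_norm, h1, h2, ← Finset.sum_sub_distrib]
  have h3 : ∀ k ∈ Finset.range N, ‖(∫ x in a k..a (k + 1), F (a (k + 1)))
      - ∫ x in a k..a (k + 1), F x‖ ≤ ε / 2 * (N : ℝ)⁻¹ := by
    intro k hk
    have hk : k + 1 ≤ N := Finset.mem_range.1 hk
    have hle : a k ≤ a (k + 1) := by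
      simp only [ha]; push_cast; gcongr; linarith
    have e1 : a (k + 1) - a k = (N : ℝ)⁻¹ := by
      simp only [ha]; push_cast; field_simp; ring
    rw [← intervalIntegral.integral_sub (by simp) (hFc.intervalIntegrable _ _)]
    refine (intervalIntegral.norm_integral_le_of_norm_le_const (C := ε / 2) ?_).trans ?_
    · intro x hx
      rw [Set.uIoc_of_le hle] at hx
      have hx0 : x ∈ Set.Icc (0 : ℝ) 1 := by
        refine ⟨le_trans (by simp only [ha]; positivity) hx.1.le, hx.2.trans ?_⟩
        simp only [ha]
        rw [div_le_one hNr]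
        exact_mod_cast hk
      have hy0 : a (k + 1) ∈ Set.Icc (0 : ℝ) 1 := by
        refine ⟨by simp only [ha]; positivity, ?_⟩
        simp only [ha]
        rw [div_le_one hNr]
        exact_mod_cast hk
      rw [hF, Set.IccExtend_of_mem _ _ hx0, Set.IccExtend_of_mem _ _ hy0, ← dist_eq_norm]
      refine (huc ?_).le
      rw [Subtype.dist_eq, Real.dist_eq, abs_of_nonneg (by linarith [hx.2])]
      have := hx.1
      rw [inv_eq_one_div] at e1
      simp only at this ⊢
      linarith
    · rw [e1, abs_of_pos (by positivity)]
  refine (norm_sum_le_of_le _ h3).trans_lt ?_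
  rw [Finset.sum_const, Finset.card_range, nsmul_eq_mul]
  have : (N : ℝ) * (ε / 2 * (N : ℝ)⁻¹) = ε / 2 := by field_simp
  rw [this]
  linarith

theorem tendsto_gridMean_of_uniform (a : ∀ N, Fin N → ℂ) (f : CI)
    (h : ∀ δ : ℝ, 0 < δ → ∀ᶠ N : ℕ in atTop, ∀ k : Fin N, ‖a N k - f (gridPoint k)‖ ≤ δ) :
    Tendsto (fun N : ℕ => (N : ℂ)⁻¹ * ∑ k, a N k) atTop (𝓝 (tau f)) := by
  have h0 : Tendsto (fun N : ℕ => (N : ℂ)⁻¹ * ∑ k, a N k - gridMean N f) atTop (𝓝 0) := by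
    rw [Metric.tendsto_nhds]
    intro ε hε
    filter_upwards [h (ε / 2) (half_pos hε), eventually_ge_atTop 1] with N hN h1
    have hNr : (0 : ℝ) < N := by exact_mod_cast h1
    rw [dist_zero_right, gridMean, ← mul_sub, ← Finset.sum_sub_distrib, norm_mul, norm_inv,
      Complex.norm_natCast]
    have := norm_sum_le_of_le Finset.univ fun k _ => hN k
    rw [Finset.sum_const, Finset.card_univ, Fintype.card_fin, nsmul_eq_mul] at this
    calc (N : ℝ)⁻¹ * ‖∑ k, (a N k - f (gridPoint k))‖ ≤ (N : ℝ)⁻¹ * (N * (ε / 2)) := by gcongr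
      _ = ε / 2 := by field_simp
      _ < ε := by linarith
  simpa using h0.add (tendsto_gridMean f)

/-! ### Sums over injective families -/

theorem card_eq_at_le {ι : Type*} [Fintype ι] [DecidableEq ι] (N : ℕ) (i j : ι) (hij : i ≠ j) :
    (Finset.univ.filter fun u : ι → Fin N => u i = u j).card * N ≤ N ^ Fintype.card ι := by
  have h1 : (Finset.univ.filter fun u : ι → Fin N => u i = u j).card
      ≤ Fintype.card ({x // x ≠ i} → Fin N) := by
    rw [← Finset.card_univ]
    refine Finset.card_le_card_of_injOn (fun u x => u x) (fun _ _ => Finset.mem_univ _) ?_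
    intro u hu u' hu' h
    have hu : u i = u j := by simpa using hu
    have hu' : u' i = u' j := by simpa using hu'
    have hne : ∀ x, x ≠ i → u x = u' x := fun x hx => congr_fun h ⟨x, hx⟩
    funext x
    by_cases hx : x = i
    · subst hx; rw [hu, hu', hne j hij.symm]
    · exact hne x hx
  have hc : Fintype.card {x // x ≠ i} + 1 = Fintype.card ι := by
    have := Fintype.card_subtype_compl (fun x => x = i)
    rw [Fintype.card_subtype_eq] at this
    have hpos := Fintype.card_pos_iff.2 ⟨i⟩
    rw [this]; omega
  rw [Fintype.card_fun, Fintype.card_fin] at h1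
  calc _ ≤ N ^ Fintype.card {x // x ≠ i} * N := Nat.mul_le_mul_right _ h1
    _ = N ^ Fintype.card ι := by rw [← pow_succ, hc]

theorem card_eq_const_le {ι : Type*} [Fintype ι] [DecidableEq ι] (N : ℕ) (i : ι) (y : Fin N) :
    (Finset.univ.filter fun u : ι → Fin N => u i = y).card * N ≤ N ^ Fintype.card ι := by
  have h1 : (Finset.univ.filter fun u : ι → Fin N => u i = y).card
      ≤ Fintype.card ({x // x ≠ i} → Fin N) := by
    rw [← Finset.card_univ]
    refine Finset.card_le_card_of_injOn (fun u x => u x) (fun _ _ => Finset.mem_univ _) ?_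
    intro u hu u' hu' h
    have hu : u i = y := by simpa using hu
    have hu' : u' i = y := by simpa using hu'
    funext x
    by_cases hx : x = i
    · subst hx; rw [hu, hu']
    · exact congr_fun h ⟨x, hx⟩
  have hc : Fintype.card {x // x ≠ i} + 1 = Fintype.card ι := by
    have := Fintype.card_subtype_compl (fun x => x = i)
    rw [Fintype.card_subtype_eq] at this
    have hpos := Fintype.card_pos_iff.2 ⟨i⟩
    rw [this]; omega
  rw [Fintype.card_fun, Fintype.card_fin] at h1
  calc _ ≤ N ^ Fintype.card {x // x ≠ i} * N := Nat.mul_le_mul_right _ h1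
    _ = N ^ Fintype.card ι := by rw [← pow_succ, hc]

/-- Restricting to injective families that avoid one point changes an average by `O(1/N)`. -/
theorem norm_injective_sum_sub_le {ι : Type*} [Fintype ι] [DecidableEq ι] {N : ℕ} (hN : 1 ≤ N)
    (f : ι → CI) (k : Fin N) :
    ‖((N : ℂ) ^ Fintype.card ι)⁻¹ * (∑ u : ι → Fin N,
        if Function.Injective u ∧ ∀ i, u i ≠ k then ∏ i, f i (gridPoint (u i)) else 0)
      - ∏ i, gridMean N (f i)‖
      ≤ ((Fintype.card ι : ℝ) ^ 2 + Fintype.card ι) * (∏ i, ‖f i‖) / N := by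
  classical
  have hNr : (0 : ℝ) < N := by exact_mod_cast hN
  set q := Fintype.card ι with hq
  have h1 : ∏ i, gridMean N (f i)
      = ((N : ℂ) ^ q)⁻¹ * ∑ u : ι → Fin N, ∏ i, f i (gridPoint (u i)) := by
    simp only [gridMean]
    rw [Finset.prod_mul_distrib, Finset.prod_const, Finset.card_univ, ← hq, inv_pow,
      Finset.prod_univ_sum, Fintype.piFinset_univ]
  rw [h1, ← mul_sub, ← Finset.sum_sub_distrib, norm_mul, norm_inv, norm_pow, Complex.norm_natCast]
  set Bad : Finset (ι → Fin N) := Finset.univ.filter fun u =>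
    ¬(Function.Injective u ∧ ∀ i, u i ≠ k) with hBad
  have h2 : ‖∑ u : ι → Fin N, ((if Function.Injective u ∧ ∀ i, u i ≠ k then
      ∏ i, f i (gridPoint (u i)) else 0) - ∏ i, f i (gridPoint (u i)))‖
      ≤ Bad.card * ∏ i, ‖f i‖ := by
    rw [← nsmul_eq_mul, ← Finset.sum_const, hBad, Finset.sum_filter]
    refine norm_sum_le_of_le _ fun u _ => ?_
    by_cases h : Function.Injective u ∧ ∀ i, u i ≠ k
    · simp [h]
    · rw [if_neg h, if_pos h, zero_sub, norm_neg, norm_prod]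
      exact Finset.prod_le_prod (fun _ _ => norm_nonneg _) fun i _ => (f i).norm_coe_le_norm _
  -- A union bound over coincidences `u i = u j` and hits `u i = k`; each of these fixes one
  -- coordinate and so costs a factor `N`.
  have h3 : (Bad.card : ℝ) * N ≤ ((q : ℝ) ^ 2 + q) * (N : ℝ) ^ q := by
    have hsub : Bad ⊆ (Finset.univ.biUnion fun p : ι × ι => if p.1 = p.2 then ∅ else
        Finset.univ.filter fun u : ι → Fin N => u p.1 = u p.2) ∪
        Finset.univ.biUnion fun i => Finset.univ.filter fun u : ι → Fin N => u i = k := by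
      intro u hu
      have hu : ¬(Function.Injective u ∧ ∀ i, u i ≠ k) := by simpa [hBad] using hu
      rw [not_and_or] at hu
      rcases hu with hu | hu
      · rw [Function.Injective] at hu
        push Not at hu
        obtain ⟨i, j, he, hij⟩ := hu
        refine Finset.mem_union_left _ (Finset.mem_biUnion.2 ⟨(i, j), Finset.mem_univ _, ?_⟩)
        simp [hij, he]
      · push Not at hu
        obtain ⟨i, hi⟩ := hu
        exact Finset.mem_union_right _ (Finset.mem_biUnion.2 ⟨i, Finset.mem_univ _, by simp [hi]⟩)
    have hcard : Bad.card * N ≤ (q ^ 2 + q) * N ^ q := by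
      refine (Nat.mul_le_mul_right N ((Finset.card_le_card hsub).trans
        (Finset.card_union_le _ _))).trans ?_
      rw [add_mul, add_mul]
      refine add_le_add ?_ ?_
      · refine (Nat.mul_le_mul_right N Finset.card_biUnion_le).trans ?_
        rw [Finset.sum_mul]
        refine (Finset.sum_le_card_nsmul _ _ (N ^ q) fun p _ => ?_).trans ?_
        · split_ifs with h
          · simp
          · exact card_eq_at_le N _ _ h
        · rw [Finset.card_univ, Fintype.card_prod, smul_eq_mul, ← hq, sq]
      · refine (Nat.mul_le_mul_right N Finset.card_biUnion_le).trans ?_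
        rw [Finset.sum_mul]
        refine (Finset.sum_le_card_nsmul _ _ (N ^ q) fun i _ => card_eq_const_le N i k).trans ?_
        rw [Finset.card_univ, smul_eq_mul]
    exact_mod_cast hcard
  have hprod : 0 ≤ ∏ i, ‖f i‖ := Finset.prod_nonneg fun _ _ => norm_nonneg _
  rw [le_div_iff₀ hNr, mul_assoc, inv_mul_le_iff₀ (by positivity)]
  calc _ ≤ (Bad.card * ∏ i, ‖f i‖) * (N : ℝ) := by gcongr
    _ = (Bad.card * (N : ℝ)) * ∏ i, ‖f i‖ := by ring
    _ ≤ (((q : ℝ) ^ 2 + q) * (N : ℝ) ^ q) * ∏ i, ‖f i‖ := by gcongr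
    _ = _ := by ring

/-! ### Sums over functions with a given kernel -/

section Kernel

variable {m : ℕ} (π : SetPartition (m + 1))

/-- The blocks of `v` are those of `π`. -/
def IsKer {N : ℕ} (v : Fin (m + 1) → Fin N) : Prop := ∀ i j, v i = v j ↔ π.part i = π.part j

instance {N : ℕ} (v : Fin (m + 1) → Fin N) : Decidable (IsKer π v) := by
  unfold IsKer; infer_instance

theorem existsUnique_isKer {N : ℕ} (v : Fin (m + 1) → Fin N) : ∃! π, IsKer π v := by
  classical
  refine ⟨Finpartition.ofSetoid (Setoid.ker v), ?_, ?_⟩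
  · intro i j
    rw [← Finpartition.mem_part_iff_part_eq_part _ (Finset.mem_univ _) (Finset.mem_univ _),
      Finpartition.mem_part_ofSetoid_iff_rel]
    exact eq_comm
  · intro π h
    refine Finpartition.ext ?_
    have hpart : ∀ i, π.part i = (Finpartition.ofSetoid (Setoid.ker v)).part i := by
      intro i
      ext j
      rw [π.mem_part_iff_part_eq_part (Finset.mem_univ _) (Finset.mem_univ _), ← h,
        Finpartition.mem_part_ofSetoid_iff_rel]
      exact eq_comm
    ext S
    constructor
    · intro hS
      obtain ⟨i, hi⟩ := π.nonempty_of_mem_parts hS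
      rw [← π.part_eq_of_mem hS hi, hpart]
      exact (Finpartition.part_mem _).2 (Finset.mem_univ _)
    · intro hS
      obtain ⟨i, hi⟩ := Finpartition.nonempty_of_mem_parts _ hS
      rw [← Finpartition.part_eq_of_mem _ hS hi, ← hpart]
      exact (Finpartition.part_mem _).2 (Finset.mem_univ _)

theorem sum_eq_sum_isKer {N : ℕ} {A : Type*} [AddCommMonoid A] (F : (Fin (m + 1) → Fin N) → A) :
    ∑ v, F v = ∑ π : SetPartition (m + 1), ∑ v, if IsKer π v then F v else 0 := by
  rw [Finset.sum_comm]
  refine Finset.sum_congr rfl fun v _ => ?_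
  obtain ⟨π, hπ, hu⟩ := existsUnique_isKer v
  rw [Finset.sum_eq_single π]
  · rw [if_pos hπ]
  · intro π' _ hne
    rw [if_neg]
    exact fun h => hne (hu π' h)
  · simp

/-- Blocks correspond to their largest elements, which are exactly the points outside `J π`. -/
theorem card_parts_add_card_J : π.parts.card + (J π).card = m + 1 := by
  have h1 : π.parts.card = (Finset.univ \ J π).card := by
    refine Finset.card_bij (fun S hS => S.max' (π.nonempty_of_mem_parts hS)) ?_ ?_ ?_
    · intro S hS
      have hM := S.max'_mem (π.nonempty_of_mem_parts hS)
      simp only [J, Finset.mem_sdiff, Finset.mem_univ, Finset.mem_filter, true_and,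
        π.part_eq_of_mem hS hM]
      rintro ⟨k, hk, hlt⟩
      exact absurd (S.le_max' k hk) (not_le.2 hlt)
    · intro S hS S' hS' h
      have hM := S.max'_mem (π.nonempty_of_mem_parts hS)
      have hM' := S'.max'_mem (π.nonempty_of_mem_parts hS')
      rw [← h] at hM'
      rw [← π.part_eq_of_mem hS hM, ← π.part_eq_of_mem hS' hM']
    · intro j hj
      have hjp := π.mem_part (Finset.mem_univ j)
      have hP := π.part_mem.2 (Finset.mem_univ j)
      refine ⟨π.part j, hP, ?_⟩
      simp only [J, Finset.mem_sdiff, Finset.mem_univ, Finset.mem_filter, true_and] at hj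
      push Not at hj
      exact le_antisymm (Finset.max'_le _ _ _ hj) (Finset.le_max' _ _ hjp)
  rw [h1, Finset.card_sdiff_add_card_eq_card (Finset.subset_univ _), Finset.card_univ,
    Fintype.card_fin]

/-- The normalized sum over the functions with kernel `π` and value `k` at `0`. -/
noncomputable def kerSum {N : ℕ} (g : Fin (m + 1) → CI) (k : Fin N) : ℂ :=
  ((N : ℂ) ^ (π.parts.card - 1))⁻¹ * ∑ v : Fin (m + 1) → Fin N,
    if v 0 = k ∧ IsKer π v then ∏ j, g j (gridPoint (v j)) else 0

/-- A function with kernel `π` and value `k` at `0` amounts to distinct values, different from `k`,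
on the blocks other than that of `0`. The product regroups along the blocks. -/
theorem kerSum_eq {N : ℕ} (g : Fin (m + 1) → CI) (k : Fin N) :
    kerSum π g k = (∏ j ∈ π.part 0, g j (gridPoint k)) *
      (((N : ℂ) ^ Fintype.card ↥(π.parts.erase (π.part 0)))⁻¹ *
        ∑ u : ↥(π.parts.erase (π.part 0)) → Fin N,
          if Function.Injective u ∧ ∀ i, u i ≠ k then
            ∏ S : ↥(π.parts.erase (π.part 0)),
              (∏ j ∈ (S : Finset (Fin (m + 1))), g j : CI) (gridPoint (u S)) else 0) := by
  classical
  have h0 := π.part_mem.2 (Finset.mem_univ 0)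
  rw [kerSum, Fintype.card_coe, Finset.card_erase_of_mem h0, mul_left_comm]
  congr 1
  rw [Finset.mul_sum, ← Finset.sum_filter, ← Finset.sum_filter_of_ne (p := fun u :
    ↥(π.parts.erase (π.part 0)) → Fin N => Function.Injective u ∧ ∀ i, u i ≠ k)]
  swap
  · intro u _ hu
    by_contra h
    rw [if_neg h, mul_zero] at hu
    exact hu rfl
  have hmem : ∀ S : ↥(π.parts.erase (π.part 0)), ∃ j, π.part j = S := by
    rintro ⟨S, hS⟩
    obtain ⟨hne, hS⟩ := Finset.mem_erase.1 hS
    obtain ⟨j, hj⟩ := π.nonempty_of_mem_parts hS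
    exact ⟨j, π.part_eq_of_mem hS hj⟩
  choose rep hrep using hmem
  have hin : ∀ j, π.part j ≠ π.part 0 → π.part j ∈ π.parts.erase (π.part 0) := fun j hj =>
    Finset.mem_erase.2 ⟨hj, π.part_mem.2 (Finset.mem_univ j)⟩
  have hne0 : ∀ S : ↥(π.parts.erase (π.part 0)), (S : Finset (Fin (m + 1))) ≠ π.part 0 :=
    fun S => (Finset.mem_erase.1 S.2).1
  refine Finset.sum_bij' (fun v _ S => v (rep S))
    (fun u _ j => if h : π.part j = π.part 0 then k else u ⟨π.part j, hin j h⟩) ?_ ?_ ?_ ?_ ?_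
  · intro v hv
    obtain ⟨-, hv0, hv⟩ := Finset.mem_filter.1 hv
    refine Finset.mem_filter.2 ⟨Finset.mem_univ _, ?_, ?_⟩
    · intro S S' h
      have := (hv _ _).1 h
      rw [hrep, hrep] at this
      exact Subtype.ext this
    · intro S h
      rw [← hv0] at h
      have := (hv _ _).1 h
      rw [hrep] at this
      exact hne0 S this
  · intro u hu
    obtain ⟨-, hui, huk⟩ := Finset.mem_filter.1 hu
    refine Finset.mem_filter.2 ⟨Finset.mem_univ _, by simp, ?_⟩
    intro i j
    beta_reduce
    by_cases hi : π.part i = π.part 0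
    · by_cases hj : π.part j = π.part 0
      · simp [hi, hj]
      · rw [dif_pos hi, dif_neg hj, hi]
        exact ⟨fun h => absurd h.symm (huk _), fun h => absurd h.symm hj⟩
    · by_cases hj : π.part j = π.part 0
      · rw [dif_neg hi, dif_pos hj, hj]
        exact ⟨fun h => absurd h (huk _), fun h => absurd h hi⟩
      · rw [dif_neg hi, dif_neg hj, hui.eq_iff, Subtype.mk.injEq]
  · intro v hv
    obtain ⟨-, hv0, hv⟩ := Finset.mem_filter.1 hv
    funext j
    by_cases hj : π.part j = π.part 0
    · simp only [dif_pos hj]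
      rw [← hv0]
      exact ((hv _ _).2 hj).symm
    · simp only [dif_neg hj]
      exact (hv _ _).2 (hrep _)
  · intro u hu
    funext S
    have : π.part (rep S) ≠ π.part 0 := by rw [hrep]; exact hne0 S
    simp only [dif_neg this]
    congr 1
    exact Subtype.ext (hrep S)
  · intro v hv
    obtain ⟨-, hv0, hv⟩ := Finset.mem_filter.1 hv
    rw [if_pos]
    · have hprod : ∏ j, g j (gridPoint (v j))
          = ∏ S ∈ π.parts, ∏ j ∈ S, g j (gridPoint (v j)) := by
        have e := Finset.prod_biUnion (s := π.parts) (t := id)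
          (f := fun j => g j (gridPoint (v j))) π.disjoint
        rwa [π.biUnion_parts] at e
      rw [hprod, ← Finset.mul_prod_erase _ _ h0]
      congr 1
      · refine Finset.prod_congr rfl fun j hj => ?_
        rw [← hv0, (hv j 0).2 (π.part_eq_of_mem h0 hj)]
      · rw [← Finset.prod_coe_sort]
        refine Finset.prod_congr rfl fun S _ => ?_
        rw [ContinuousMap.coe_prod, Finset.prod_apply]
        refine Finset.prod_congr rfl fun j hj => ?_
        have := π.part_eq_of_mem (Finset.mem_erase.1 S.2).2 hj
        rw [(hv j (rep S)).2 (by rw [this, hrep])]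
    · refine ⟨?_, ?_⟩
      · intro S S' h
        have := (hv _ _).1 h
        rw [hrep, hrep] at this
        exact Subtype.ext this
      · intro S h
        rw [← hv0] at h
        have := (hv _ _).1 h
        rw [hrep] at this
        exact hne0 S this

/-- The normalized sums over the functions with kernel `π` converge uniformly to `Γ_π`. -/
theorem tendsto_kerSum (g : Fin (m + 1) → CI) {δ : ℝ} (hδ : 0 < δ) :
    ∀ᶠ N : ℕ in atTop, ∀ k : Fin N, ‖kerSum π g k - Gam π g (gridPoint k)‖ ≤ δ := by
  classical
  set f : ↥(π.parts.erase (π.part 0)) → CI := fun S => ∏ j ∈ (S : Finset (Fin (m + 1))), g j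
  set q := Fintype.card ↥(π.parts.erase (π.part 0))
  set A := ∏ j ∈ π.part 0, ‖g j‖
  have hA : 0 ≤ A := Finset.prod_nonneg fun _ _ => norm_nonneg _
  have h1 : Tendsto (fun N => ∏ S, gridMean N (f S)) atTop (𝓝 (∏ S, tau (f S))) :=
    tendsto_finsetProd _ fun S _ => tendsto_gridMean (f S)
  have h2 : Tendsto (fun N : ℕ => A * ((((q : ℝ) ^ 2 + q) * ∏ S, ‖f S‖) / N
      + ‖∏ S, gridMean N (f S) - ∏ S, tau (f S)‖)) atTop (𝓝 0) := by
    have := (h1.sub_const (∏ S, tau (f S))).norm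
    rw [sub_self, norm_zero] at this
    simpa using ((tendsto_const_div_atTop_nhds_zero_nat
      (((q : ℝ) ^ 2 + q) * ∏ S, ‖f S‖)).add this).const_mul A
  filter_upwards [h2.eventually (gt_mem_nhds hδ), eventually_ge_atTop 1] with N hN hN1 k
  have hG : Gam π g (gridPoint k) = (∏ j ∈ π.part 0, g j (gridPoint k)) * ∏ S, tau (f S) := by
    rw [Gam, ContinuousMap.smul_apply, smul_eq_mul, ContinuousMap.coe_prod, Finset.prod_apply,
      mul_comm, ← Finset.prod_coe_sort (π.parts.erase (π.part 0))]
    congr 1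
    refine Finset.prod_congr rfl fun S _ => ?_
    rw [ContinuousMap.coe_prod]
  rw [kerSum_eq, hG, ← mul_sub, norm_mul]
  have h3 := norm_injective_sum_sub_le hN1 f k
  have h4 : ‖∏ j ∈ π.part 0, g j (gridPoint k)‖ ≤ A := by
    rw [norm_prod]
    exact Finset.prod_le_prod (fun _ _ => norm_nonneg _) fun j _ => (g j).norm_coe_le_norm _
  refine le_trans (mul_le_mul h4 ?_ (norm_nonneg _) hA) hN.le
  refine (norm_sub_le_norm_sub_add_norm_sub _ (∏ S, gridMean N (f S)) _).trans ?_
  exact add_le_add h3 le_rfl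

end Kernel

/-! ### Limits of alternating moments -/

/-- The repeated end point is dropped on the right. This suits words starting with `X`, whose joints
are the bases and start at `k`. -/
theorem sum_closed_snoc {ι A : Type*} [Fintype ι] [DecidableEq ι] [AddCommMonoid A] {m : ℕ}
    (k : ι) (F : (Fin (m + 1) → ι) → (Fin (m + 1) → ι) → A) :
    (∑ K : Fin (m + 2) → ι, if K 0 = k ∧ K (Fin.last (m + 1)) = k then
        F (fun j => K j.castSucc) (fun j => K j.succ) else 0)
      = ∑ v : Fin (m + 1) → ι, if v 0 = k then F v (fun j => v (j + 1)) else 0 := by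
  rw [← Equiv.sum_comp (Fin.snocEquiv fun _ : Fin (m + 2) => ι), Fintype.sum_prod_type_right]
  refine Finset.sum_congr rfl fun v _ => ?_
  have h0 : ∀ x, (Fin.snocEquiv fun _ : Fin (m + 2) => ι) (x, v) 0 = v 0 := fun x => by
    exact Fin.snoc_castSucc (α := fun _ : Fin (m + 2) => ι) x v 0
  have h1 : ∀ x, (Fin.snocEquiv fun _ : Fin (m + 2) => ι) (x, v) (Fin.last _) = x := fun x =>
    Fin.snoc_last (α := fun _ : Fin (m + 2) => ι) ..
  have h2 : ∀ x j, (Fin.snocEquiv fun _ : Fin (m + 2) => ι) (x, v) (Fin.castSucc j) = v j :=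
    fun x j => Fin.snoc_castSucc (α := fun _ : Fin (m + 2) => ι) ..
  simp only [h0, h1, h2]
  rw [Finset.sum_eq_single k]
  · simp only [and_true]
    split_ifs with hk
    · congr 1
      funext j
      cases j using Fin.lastCases with
      | last => rw [Fin.succ_last, h1, Fin.last_add_one, hk]
      | cast i => rw [Fin.succ_castSucc, h2, Fin.coeSucc_eq_succ]
    · rfl
  · intro x _ hx; simp [hx]
  · simp

/-- The repeated end point is dropped on the left. This suits words starting with `X*`, whose joints
are the exponents; `blockSum` prescribes the last of them. -/
theorem sum_closed_cons {ι A : Type*} [Fintype ι] [DecidableEq ι] [AddCommMonoid A] {m : ℕ}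
    (k : ι) (F : (Fin (m + 1) → ι) → (Fin (m + 1) → ι) → A) :
    (∑ K : Fin (m + 2) → ι, if K 0 = k ∧ K (Fin.last (m + 1)) = k then
        F (fun j => K j.castSucc) (fun j => K j.succ) else 0)
      = ∑ e : Fin (m + 1) → ι, if e (Fin.last m) = k then F (fun j => e (j - 1)) e else 0 := by
  rw [← Equiv.sum_comp (Fin.consEquiv fun _ : Fin (m + 2) => ι), Fintype.sum_prod_type_right]
  refine Finset.sum_congr rfl fun v _ => ?_
  have h0 : ∀ x, (Fin.consEquiv fun _ : Fin (m + 2) => ι) (x, v) 0 = x := fun x => rfl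
  have h2 : ∀ x j, (Fin.consEquiv fun _ : Fin (m + 2) => ι) (x, v) (Fin.succ j) = v j :=
    fun x j => rfl
  simp only [h0, h2, ← Fin.succ_last]
  rw [Finset.sum_eq_single k]
  · simp only [true_and]
    split_ifs with hk
    · congr 1
      funext j
      cases j using Fin.cases with
      | zero => rw [Fin.castSucc_zero, h0, ← hk]; congr 1; exact eq_sub_of_add_eq (Fin.last_add_one m)
      | succ i =>
        rw [← Fin.succ_castSucc, h2]; congr 1
        exact eq_sub_of_add_eq (Fin.coeSucc_eq_succ)
    · rfl
  · intro x _ hx; simp [hx]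
  · simp

/-- The coefficient of the variable with index `v i` collects precisely the block of `i`. The
balance condition thus depends on `v` only through its kernel. -/
theorem IsKer.sum_single_eq_zero_iff {m N : ℕ} {π : SetPartition (m + 1)} {v : Fin (m + 1) → Fin N}
    (h : IsKer π v) (x : Fin (m + 1) → ℤ) :
    ∑ j, Pi.single (M := fun _ => ℤ) (v j) (x j) = 0 ↔ ∀ S ∈ π.parts, ∑ j ∈ S, x j = 0 := by
  have key : ∀ i, (∑ j, Pi.single (M := fun _ => ℤ) (v j) (x j)) (v i) = ∑ j ∈ π.part i, x j := by
    intro i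
    rw [Finset.sum_apply, ← Finset.sum_filter_of_ne (p := fun j => j ∈ π.part i)]
    · rw [Finset.filter_mem_eq_inter, Finset.univ_inter]
      refine Finset.sum_congr rfl fun j hj => ?_
      rw [(h i j).2 (π.part_eq_of_mem (π.part_mem.2 (Finset.mem_univ i)) hj).symm, Pi.single_eq_same]
    · intro j _ hj
      by_contra hn
      apply hj
      rw [Pi.single_eq_of_ne]
      intro he
      apply hn
      rw [(h i j).1 he]
      exact π.mem_part (Finset.mem_univ j)
  constructor
  · intro h0 S hS
    obtain ⟨i, hi⟩ := π.nonempty_of_mem_parts hS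
    rw [← π.part_eq_of_mem hS hi, ← key, h0, Pi.zero_apply]
  · intro h0
    funext y
    by_cases hy : ∃ i, v i = y
    · obtain ⟨i, rfl⟩ := hy
      rw [key]
      exact h0 _ (π.part_mem.2 (Finset.mem_univ i))
    · push Not at hy
      rw [Finset.sum_apply]
      exact Finset.sum_eq_zero fun j _ => Pi.single_eq_of_ne (fun h => hy j h.symm) _

/-- Cyclic summation by parts moves the shift from the bases to the exponents. -/
theorem sum_single_sub_single {N m : ℕ} (v e : Fin (m + 1) → Fin N) :
    ∑ j, (Pi.single (M := fun _ => ℤ) (v j) ((e j : ℤ) + 1)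
        - Pi.single (M := fun _ => ℤ) (v (j + 1)) ((e j : ℤ) + 1))
      = ∑ j, Pi.single (M := fun _ => ℤ) (v j) (diff (fun i => (e i : ℤ)) j) := by
  rw [Finset.sum_sub_distrib, ← Equiv.sum_comp (Equiv.subRight (1 : Fin (m + 1)))
    (fun j => Pi.single (M := fun _ => ℤ) (v (j + 1)) ((e j : ℤ) + 1)), ← Finset.sum_sub_distrib]
  refine Finset.sum_congr rfl fun j _ => ?_
  rw [Equiv.subRight_apply, sub_add_cancel, ← Pi.single_sub, diff]
  congr 1
  ring

theorem vandermonde_mul_star_apply {N : ℕ} (z : Fin N → Circle) (c d : CI) (k l : Fin N) :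
    evalAt z (incl c * X * incl d * star X) k l = ∑ e : Fin N, ((N : ℂ)⁻¹ * c (gridPoint k)
      * d (gridPoint e)) * monom z (Pi.single k ((e : ℤ) + 1) - Pi.single l ((e : ℤ) + 1)) := by
  have hX : evalAt z X = starPow (vandermonde z) false := evalAt_starPow z false
  have hXs : evalAt z (star X) = starPow (vandermonde z) true := evalAt_starPow z true
  have hs : ((Real.sqrt N : ℝ) : ℂ)⁻¹ * ((Real.sqrt N : ℝ) : ℂ)⁻¹ = (N : ℂ)⁻¹ := by
    rw [← mul_inv, ← Complex.ofReal_mul, Real.mul_self_sqrt (Nat.cast_nonneg N),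
      Complex.ofReal_natCast]
  rw [map_mul, map_mul, map_mul, evalAt_incl, evalAt_incl, hX, hXs, Matrix.mul_apply]
  refine Finset.sum_congr rfl fun e _ => ?_
  rw [sampleDiag, sampleDiag, Matrix.mul_diagonal, Matrix.diagonal_mul, starPow_vandermonde_apply,
    starPow_vandermonde_apply, sub_eq_add_neg, monom_add, ← hs]
  simp only [Bool.false_eq_true, if_false, if_true]
  ring

theorem star_mul_vandermonde_apply {N : ℕ} (z : Fin N → Circle) (c d : CI) (k l : Fin N) :
    evalAt z (incl c * star X * incl d * X) k l = ∑ v : Fin N, ((N : ℂ)⁻¹ * c (gridPoint k)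
      * d (gridPoint v)) * monom z (Pi.single v ((l : ℤ) + 1) - Pi.single v ((k : ℤ) + 1)) := by
  have hX : evalAt z X = starPow (vandermonde z) false := evalAt_starPow z false
  have hXs : evalAt z (star X) = starPow (vandermonde z) true := evalAt_starPow z true
  have hs : ((Real.sqrt N : ℝ) : ℂ)⁻¹ * ((Real.sqrt N : ℝ) : ℂ)⁻¹ = (N : ℂ)⁻¹ := by
    rw [← mul_inv, ← Complex.ofReal_mul, Real.mul_self_sqrt (Nat.cast_nonneg N),
      Complex.ofReal_natCast]
  rw [map_mul, map_mul, map_mul, evalAt_incl, evalAt_incl, hX, hXs, Matrix.mul_apply]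
  refine Finset.sum_congr rfl fun e _ => ?_
  rw [sampleDiag, sampleDiag, Matrix.mul_diagonal, Matrix.diagonal_mul, starPow_vandermonde_apply,
    starPow_vandermonde_apply, sub_eq_add_neg, monom_add, ← hs]
  simp only [Bool.false_eq_true, if_false, if_true]
  ring

/-- Integration of a diagonal entry of a product of matrices with monomial entries. -/
theorem integral_prod_ofFn_apply {N m : ℕ} {Θ : Type*} [Fintype Θ]
    (M : (Fin N → Circle) → Fin m → Matrix (Fin N) (Fin N) ℂ)
    (wt : Fin m → Fin N → Fin N → Θ → ℂ) (α : Fin N → Fin N → Θ → Fin N → ℤ)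
    (hM : ∀ z j k l, M z j k l = ∑ θ, wt j k l θ * monom z (α k l θ)) (k l : Fin N) :
    ∫ z, (List.ofFn (M z)).prod k l ∂torusHaar N
      = ∑ K : Fin (m + 1) → Fin N, if K 0 = k ∧ K (Fin.last m) = l then
          ∑ θ : Fin m → Θ, if ∑ j, α (K j.castSucc) (K j.succ) (θ j) = 0 then
            ∏ j, wt j (K j.castSucc) (K j.succ) (θ j) else 0 else 0 := by
  have hi : ∀ K : Fin (m + 1) → Fin N, (∫ z, ∏ j : Fin m, M z j (K j.castSucc) (K j.succ) ∂torusHaar N)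
      = ∑ θ : Fin m → Θ, if ∑ j, α (K j.castSucc) (K j.succ) (θ j) = 0 then
            ∏ j, wt j (K j.castSucc) (K j.succ) (θ j) else 0 := by
    intro K
    have := integral_prod_terms (N := N) (ι := Fin m) (Θ := fun _ => Θ) (fun _ _ => True)
      (fun j θ => wt j (K j.castSucc) (K j.succ) θ) (fun j θ => α (K j.castSucc) (K j.succ) θ)
    simp only [if_true, implies_true, true_and] at this
    simp_rw [hM]
    exact this
  simp_rw [prod_ofFn_apply]
  rw [integral_finsetSum]
  · refine Finset.sum_congr rfl fun K _ => ?_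
    split_ifs
    · exact hi K
    · simp
  · intro K _
    split_ifs
    · refine integrable_torus (continuous_finsetProd _ fun j _ => ?_)
      simp_rw [hM]
      exact continuous_finsetSum _ fun θ _ => (continuous_monom _).const_mul _
    · exact integrable_torus continuous_const

/-- Grouping the bases by their kernel decouples them from the exponents, which then only have to
satisfy the block equations. -/
theorem sum_closed_snoc_blocks {N m : ℕ} (wt : Fin (m + 1) → Fin N → Fin N → ℂ) (k : Fin N) :
    (∑ K : Fin (m + 2) → Fin N, if K 0 = k ∧ K (Fin.last (m + 1)) = k then
        ∑ e : Fin (m + 1) → Fin N, if ∑ j, (Pi.single (M := fun _ => ℤ) (K j.castSucc) ((e j : ℤ) + 1)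
          - Pi.single (M := fun _ => ℤ) (K j.succ) ((e j : ℤ) + 1)) = 0 then
            ∏ j, wt j (K j.castSucc) (e j) else 0 else 0)
      = ∑ π : SetPartition (m + 1), ∑ v : Fin (m + 1) → Fin N, if v 0 = k ∧ IsKer π v then
          ∑ e : Fin (m + 1) → Fin N, if ∀ S ∈ π.parts, ∑ j ∈ S, diff (fun i => (e i : ℤ)) j = 0 then
            ∏ j, wt j (v j) (e j) else 0 else 0 := by
  rw [sum_closed_snoc k fun (v w : Fin (m + 1) → Fin N) => ∑ e : Fin (m + 1) → Fin N,
    if ∑ j, (Pi.single (M := fun _ => ℤ) (v j) ((e j : ℤ) + 1)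
        - Pi.single (M := fun _ => ℤ) (w j) ((e j : ℤ) + 1)) = 0 then
      ∏ j, wt j (v j) (e j) else 0, sum_eq_sum_isKer]
  refine Finset.sum_congr rfl fun π _ => Finset.sum_congr rfl fun v _ => ?_
  by_cases hv : IsKer π v
  · simp_rw [sum_single_sub_single, hv.sum_single_eq_zero_iff, hv, if_true, and_true]
  · simp [hv]

theorem sum_closed_cons_blocks {N m : ℕ} (wt : Fin (m + 1) → Fin N → Fin N → ℂ) (k : Fin N) :
    (∑ K : Fin (m + 2) → Fin N, if K 0 = k ∧ K (Fin.last (m + 1)) = k then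
        ∑ v : Fin (m + 1) → Fin N, if ∑ j, (Pi.single (M := fun _ => ℤ) (v j) ((K j.succ : ℤ) + 1)
          - Pi.single (M := fun _ => ℤ) (v j) ((K j.castSucc : ℤ) + 1)) = 0 then
            ∏ j, wt j (K j.castSucc) (v j) else 0 else 0)
      = ∑ π : SetPartition (m + 1), ∑ v : Fin (m + 1) → Fin N, if IsKer π v then
          ∑ e : Fin (m + 1) → Fin N, if e (Fin.last m) = k ∧
            ∀ S ∈ π.parts, ∑ j ∈ S, diff (fun i => (e i : ℤ)) j = 0 then
            ∏ j, wt j (e (j - 1)) (v j) else 0 else 0 := by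
  rw [sum_closed_cons k fun (w e : Fin (m + 1) → Fin N) => ∑ v : Fin (m + 1) → Fin N,
    if ∑ j, (Pi.single (M := fun _ => ℤ) (v j) ((e j : ℤ) + 1)
        - Pi.single (M := fun _ => ℤ) (v j) ((w j : ℤ) + 1)) = 0 then
      ∏ j, wt j (w j) (v j) else 0]
  have h1 : ∀ e v : Fin (m + 1) → Fin N, ∑ j, (Pi.single (M := fun _ => ℤ) (v j) ((e j : ℤ) + 1)
        - Pi.single (M := fun _ => ℤ) (v j) ((e (j - 1) : ℤ) + 1))
      = ∑ j, Pi.single (M := fun _ => ℤ) (v j) (diff (fun i => (e i : ℤ)) j) := by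
    intro e v
    refine Finset.sum_congr rfl fun j _ => ?_
    rw [← Pi.single_sub, diff]
    congr 1
    ring
  simp_rw [h1]
  have h2 : ∀ e : Fin (m + 1) → Fin N, (if e (Fin.last m) = k then ∑ v : Fin (m + 1) → Fin N,
      (if ∑ j, Pi.single (M := fun _ => ℤ) (v j) (diff (fun i => (e i : ℤ)) j) = 0 then
        ∏ j, wt j (e (j - 1)) (v j) else 0) else 0)
      = ∑ v : Fin (m + 1) → Fin N, (if e (Fin.last m) = k ∧
        ∑ j, Pi.single (M := fun _ => ℤ) (v j) (diff (fun i => (e i : ℤ)) j) = 0 then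
        ∏ j, wt j (e (j - 1)) (v j) else 0) := by
    intro e
    split_ifs with h <;> simp [h]
  simp_rw [h2]
  rw [Finset.sum_comm, sum_eq_sum_isKer]
  refine Finset.sum_congr rfl fun π _ => Finset.sum_congr rfl fun v _ => ?_
  split_ifs with hv
  · simp_rw [hv.sum_single_eq_zero_iff]
  · rfl

/-- The normalization is shared out among the free parameters: one block per factor besides the
first block, one increment per element of `J π`, and one factor left over for an average. -/
theorem inv_pow_eq_card {N m : ℕ} (π : SetPartition (m + 1)) :
    ((N : ℂ)⁻¹) ^ (m + 1) = (N : ℂ)⁻¹ * ((N : ℂ) ^ (π.parts.card - 1))⁻¹ *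
      ((N : ℂ) ^ (J π).card)⁻¹ := by
  have hp1 : 1 ≤ π.parts.card := Finset.card_pos.2 ⟨_, π.part_mem.2 (Finset.mem_univ 0)⟩
  have hp := card_parts_add_card_J π
  have hp' : (π.parts.card - 1) + 1 + (J π).card = m + 1 := by omega
  rw [inv_pow, ← mul_inv, ← mul_inv, ← pow_succ', ← pow_add, hp']

/-- An exact formula at finite `N`. The first base is pinned to `k`, while the last exponent is free
and is averaged over; fixing its value gives a `blockSum`. -/
theorem integral_oneStar_diag {N m : ℕ} (c d : Fin (m + 1) → CI) (k : Fin N) :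
    ∫ z, evalAt z (List.ofFn fun j => incl (c j) * X * incl (d j) * star X).prod k k ∂torusHaar N
      = ∑ π : SetPartition (m + 1), kerSum π c k * ((N : ℂ)⁻¹ * ∑ k' : Fin N,
          blockSum π (fun p => d p.castSucc) k' * d (Fin.last m) (gridPoint k')) := by
  simp_rw [map_list_prod, List.map_ofFn, Function.comp_def]
  have h1 := integral_prod_ofFn_apply (N := N) (Θ := Fin N)
    (fun z j => evalAt z (incl (c j) * X * incl (d j) * star X))
    (fun j k l e => (N : ℂ)⁻¹ * c j (gridPoint k) * d j (gridPoint e))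
    (fun k l e => Pi.single (M := fun _ => ℤ) k ((e : ℤ) + 1) - Pi.single l ((e : ℤ) + 1))
    (fun z j k l => by rw [vandermonde_mul_star_apply z (c j) (d j) k l]) k k
  have h2 := sum_closed_snoc_blocks
    (fun j k e => (N : ℂ)⁻¹ * c j (gridPoint k) * d j (gridPoint e)) k
  rw [h1, h2]
  refine Finset.sum_congr rfl fun π _ => ?_
  have hd : (∑ k' : Fin N, blockSum π (fun p => d p.castSucc) k' * d (Fin.last m) (gridPoint k'))
      = ((N : ℂ) ^ (J π).card)⁻¹ * ∑ e : Fin (m + 1) → Fin N,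
        if ∀ S ∈ π.parts, ∑ j ∈ S, diff (fun i => (e i : ℤ)) j = 0 then
          ∏ j, d j (gridPoint (e j)) else 0 := by
    simp_rw [blockSum, mul_assoc, ← Finset.mul_sum, Finset.sum_mul]
    congr 1
    rw [Finset.sum_comm]
    refine Finset.sum_congr rfl fun e _ => ?_
    rw [Finset.sum_eq_single (e (Fin.last m)) (fun k' _ hk => by rw [if_neg (fun h => hk h.1.symm),
      zero_mul]) (by simp), Fin.prod_univ_castSucc]
    simp
  have h3 : ∀ v e : Fin (m + 1) → Fin N,
      ∏ j, ((N : ℂ)⁻¹ * c j (gridPoint (v j)) * d j (gridPoint (e j)))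
      = ((N : ℂ)⁻¹) ^ (m + 1) * (∏ j, c j (gridPoint (v j))) * ∏ j, d j (gridPoint (e j)) := by
    intro v e
    rw [Finset.prod_mul_distrib, Finset.prod_mul_distrib, Fin.prod_const]
  have h4 : ∀ v : Fin (m + 1) → Fin N, (if v 0 = k ∧ IsKer π v then
      ∑ e : Fin (m + 1) → Fin N, if ∀ S ∈ π.parts, ∑ j ∈ S, diff (fun i => (e i : ℤ)) j = 0 then
        ∏ j, ((N : ℂ)⁻¹ * c j (gridPoint (v j)) * d j (gridPoint (e j))) else 0 else 0)
      = ((N : ℂ)⁻¹) ^ (m + 1) * ((if v 0 = k ∧ IsKer π v then ∏ j, c j (gridPoint (v j)) else 0) *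
      ∑ e : Fin (m + 1) → Fin N, if ∀ S ∈ π.parts, ∑ j ∈ S, diff (fun i => (e i : ℤ)) j = 0 then
        ∏ j, d j (gridPoint (e j)) else 0) := by
    intro v
    split_ifs
    · simp_rw [h3, ← mul_ite_zero, ← Finset.mul_sum, mul_assoc]
    · simp
  simp_rw [h4, ← Finset.mul_sum, ← Finset.sum_mul]
  rw [hd, kerSum, inv_pow_eq_card π]
  ring

/-- Here the last exponent is pinned to `k`, and the base at `0` is averaged over. -/
theorem integral_starOne_diag {N m : ℕ} (c d : Fin (m + 1) → CI) (k : Fin N) :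
    ∫ z, evalAt z (List.ofFn fun j => incl (c j) * star X * incl (d j) * X).prod k k ∂torusHaar N
      = ∑ π : SetPartition (m + 1), c 0 (gridPoint k) * blockSum π (fun p => c p.succ) k *
          ((N : ℂ)⁻¹ * ∑ k' : Fin N, kerSum π d k') := by
  simp_rw [map_list_prod, List.map_ofFn, Function.comp_def]
  have h1 := integral_prod_ofFn_apply (N := N) (Θ := Fin N)
    (fun z j => evalAt z (incl (c j) * star X * incl (d j) * X))
    (fun j k l e => (N : ℂ)⁻¹ * c j (gridPoint k) * d j (gridPoint e))
    (fun k l e => Pi.single (M := fun _ => ℤ) e ((l : ℤ) + 1) - Pi.single e ((k : ℤ) + 1))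
    (fun z j k l => by rw [star_mul_vandermonde_apply z (c j) (d j) k l]) k k
  have h2 := sum_closed_cons_blocks
    (fun j k e => (N : ℂ)⁻¹ * c j (gridPoint k) * d j (gridPoint e)) k
  rw [h1, h2]
  refine Finset.sum_congr rfl fun π _ => ?_
  have hd : (∑ k' : Fin N, kerSum π d k')
      = ((N : ℂ) ^ (π.parts.card - 1))⁻¹ * ∑ v : Fin (m + 1) → Fin N,
        if IsKer π v then ∏ j, d j (gridPoint (v j)) else 0 := by
    simp_rw [kerSum, ← Finset.mul_sum]
    congr 1
    rw [Finset.sum_comm]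
    refine Finset.sum_congr rfl fun v _ => ?_
    rw [Finset.sum_eq_single (v 0) (fun k' _ hk => by rw [if_neg (fun h => hk h.1.symm)])
      (by simp)]
    simp
  have h3 : ∀ v e : Fin (m + 1) → Fin N,
      ∏ j, ((N : ℂ)⁻¹ * c j (gridPoint (e (j - 1))) * d j (gridPoint (v j)))
      = ((N : ℂ)⁻¹) ^ (m + 1) * (∏ j, d j (gridPoint (v j))) *
        (c 0 (gridPoint (e (Fin.last m))) * ∏ p : Fin m, c p.succ (gridPoint (e p.castSucc))) := by
    intro v e
    have e0 : (0 : Fin (m + 1)) - 1 = Fin.last m := by rw [sub_eq_iff_eq_add]; simp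
    have e1 : ∀ p : Fin m, p.succ - 1 = p.castSucc := fun p => by rw [sub_eq_iff_eq_add]; simp
    rw [Finset.prod_mul_distrib, Finset.prod_mul_distrib, Fin.prod_const,
      Fin.prod_univ_succ (fun j => c j (gridPoint (e (j - 1)))), e0]
    simp_rw [e1]
    ring
  have h5 : ∀ v : Fin (m + 1) → Fin N, (if IsKer π v then
      ∑ e : Fin (m + 1) → Fin N, if e (Fin.last m) = k ∧
        (∀ S ∈ π.parts, ∑ j ∈ S, diff (fun i => (e i : ℤ)) j = 0) then
        ∏ j, ((N : ℂ)⁻¹ * c j (gridPoint (e (j - 1))) * d j (gridPoint (v j))) else 0 else 0)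
      = ((N : ℂ)⁻¹) ^ (m + 1) * ((if IsKer π v then ∏ j, d j (gridPoint (v j)) else 0) *
      (c 0 (gridPoint k) * ∑ e : Fin (m + 1) → Fin N, if e (Fin.last m) = k ∧
        (∀ S ∈ π.parts, ∑ j ∈ S, diff (fun i => (e i : ℤ)) j = 0) then
        ∏ p : Fin m, c p.succ (gridPoint (e p.castSucc)) else 0)) := by
    intro v
    split_ifs
    · simp_rw [Finset.mul_sum]
      refine Finset.sum_congr rfl fun e _ => ?_
      split_ifs with he
      · rw [h3, he.1]; ring
      · simp
    · simp
  simp_rw [h5, ← Finset.mul_sum, ← Finset.sum_mul]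
  rw [hd, blockSum, inv_pow_eq_card π]
  ring

/-! ### Uniform approximation on the grid -/

/-- The families `A N` approximate the samples of `f` uniformly. -/
def UnifTo (A : ∀ N, Fin N → ℂ) (f : CI) : Prop :=
  ∀ δ : ℝ, 0 < δ → ∀ᶠ N : ℕ in atTop, ∀ k : Fin N, ‖A N k - f (gridPoint k)‖ ≤ δ

theorem unifTo_sample (f : CI) : UnifTo (fun _ k => f (gridPoint k)) f := fun δ hδ =>
  Eventually.of_forall fun N k => by rw [sub_self, norm_zero]; exact hδ.le

theorem unifTo_const {a : ℕ → ℂ} {c : ℂ} (h : Tendsto a atTop (𝓝 c)) :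
    UnifTo (fun N _ => a N) (algebraMap ℂ CI c) := fun δ hδ => by
  filter_upwards [(Metric.tendsto_nhds.1 h) δ hδ] with N hN k
  rw [dist_eq_norm] at hN
  exact hN.le

theorem UnifTo.mul {A A' : ∀ N, Fin N → ℂ} {f f' : CI} (h : UnifTo A f) (h' : UnifTo A' f') :
    UnifTo (fun N k => A N k * A' N k) (f * f') := fun δ hδ => by
  set M : ℝ := ‖f‖ + ‖f'‖ + 1 with hM
  have hM1 : 0 < M := by positivity
  set η : ℝ := min 1 (δ / (2 * M)) with hη
  have hη0 : 0 < η := by positivity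
  filter_upwards [h η hη0, h' η hη0] with N h1 h2 k
  have e : A N k * A' N k - (f * f') (gridPoint k)
      = (A N k - f (gridPoint k)) * A' N k + f (gridPoint k) * (A' N k - f' (gridPoint k)) := by
    rw [ContinuousMap.mul_apply]; ring
  have b1 : ‖A' N k‖ ≤ M := by
    have := norm_le_norm_add_norm_sub' (A' N k) (f' (gridPoint k))
    have h3 := f'.norm_coe_le_norm (gridPoint k)
    have h4 := (h2 k).trans (min_le_left _ _)
    have h5 := norm_nonneg f
    rw [hM]; linarith
  have b2 : ‖f (gridPoint k)‖ ≤ M := by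
    have h3 := f.norm_coe_le_norm (gridPoint k)
    have h5 := norm_nonneg f'
    rw [hM]; linarith
  have b3 : η ≤ δ / (2 * M) := min_le_right _ _
  rw [e]
  refine (norm_add_le _ _).trans ?_
  rw [norm_mul, norm_mul]
  calc ‖A N k - f (gridPoint k)‖ * ‖A' N k‖ + ‖f (gridPoint k)‖ * ‖A' N k - f' (gridPoint k)‖
      ≤ η * M + M * η := by
        gcongr
        · exact h1 k
        · exact h2 k
    _ = η * (2 * M) := by ring
    _ ≤ δ / (2 * M) * (2 * M) := by gcongr
    _ = δ := by field_simp

theorem UnifTo.sum {ι : Type*} (s : Finset ι) {A : ι → ∀ N, Fin N → ℂ} {f : ι → CI}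
    (h : ∀ i ∈ s, UnifTo (A i) (f i)) : UnifTo (fun N k => ∑ i ∈ s, A i N k) (∑ i ∈ s, f i) :=
    fun δ hδ => by
  have hc : 0 < (s.card : ℝ) + 1 := by positivity
  have := (Filter.eventually_all_finset s).2 fun i hi => h i hi (δ / (s.card + 1)) (by positivity)
  filter_upwards [this] with N hN k
  rw [ContinuousMap.coe_sum, Finset.sum_apply, ← Finset.sum_sub_distrib]
  refine (norm_sum_le_of_le s fun i hi => hN i hi k).trans ?_
  rw [Finset.sum_const, nsmul_eq_mul, mul_div_assoc', div_le_iff₀ hc]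
  nlinarith

/-- The diagonal entries of `a`, evaluated at the random Vandermonde matrices, are in expectation
close to the samples of `f`. -/
def HasDiag (a : NCPoly CI) (f : CI) : Prop :=
  UnifTo (fun N k => ∫ z, evalAt z a k k ∂torusHaar N) f

/-- `Λ_π` as a continuous function. -/
noncomputable def LamC {m : ℕ} (π : SetPartition (m + 1)) (g : Fin m → CI) : CI :=
  ⟨Lam π g, continuous_Lam π g⟩

theorem unifTo_blockSum {m : ℕ} (π : SetPartition (m + 1)) (g : Fin m → CI) :
    UnifTo (fun _ k => blockSum π g k) (LamC π g) := fun _ hδ => tendsto_blockSum π g hδ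

theorem unifTo_kerSum {m : ℕ} (π : SetPartition (m + 1)) (g : Fin (m + 1) → CI) :
    UnifTo (fun _ k => kerSum π g k) (Gam π g) := fun _ hδ => tendsto_kerSum π g hδ

theorem hasDiag_oneStar {m : ℕ} (c d : Fin (m + 1) → CI) :
    HasDiag (List.ofFn fun j => incl (c j) * X * incl (d j) * star X).prod
      (∑ π : SetPartition (m + 1), Gam π c *
        algebraMap ℂ CI (tau (LamC π (fun p => d p.castSucc) * d (Fin.last m)))) := by
  unfold HasDiag
  simp_rw [integral_oneStar_diag]
  refine UnifTo.sum _ fun π _ => (unifTo_kerSum π c).mul (unifTo_const ?_)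
  exact tendsto_gridMean_of_uniform
    (fun N k' => blockSum π (fun p => d p.castSucc) k' * d (Fin.last m) (gridPoint k')) _
    ((unifTo_blockSum π _).mul (unifTo_sample (d (Fin.last m))))

theorem hasDiag_starOne {m : ℕ} (c d : Fin (m + 1) → CI) :
    HasDiag (List.ofFn fun j => incl (c j) * star X * incl (d j) * X).prod
      (∑ π : SetPartition (m + 1), c 0 * LamC π (fun p => c p.succ) *
        algebraMap ℂ CI (tau (Gam π d))) := by
  unfold HasDiag
  simp_rw [integral_starOne_diag]
  refine UnifTo.sum _ fun π _ =>
    ((unifTo_sample (c 0)).mul (unifTo_blockSum π fun p => c p.succ)).mul (unifTo_const ?_)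
  exact tendsto_gridMean_of_uniform (fun N k' => kerSum π d k') _ (unifTo_kerSum π d)

/-! ### The symbol of an alternating word -/

/-- The alternating word with coefficients `b`, whose first letter is `X` if `t` is true. -/
noncomputable def altWord {m : ℕ} (t : Bool) (b : Fin m → CI) : NCPoly CI :=
  (List.ofFn fun j => incl (b j) * starPow X (!isBase t j)).prod

/-- The weight of a path. -/
noncomputable def pathWeight {N m : ℕ} (b : Fin m → CI) (K : Fin (m + 1) → Fin N) : ℂ :=
  ((Real.sqrt N : ℝ) : ℂ)⁻¹ ^ m * ∏ j : Fin m, b j (gridPoint (K j.castSucc))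

theorem integral_altWord {N m : ℕ} (t : Bool) (b : Fin m → CI) (k l : Fin N) :
    ∫ z, evalAt z (altWord t b) k l ∂torusHaar N
      = ∑ K : Fin (m + 1) → Fin N, if K 0 = k ∧ K (Fin.last m) = l ∧ altDeg t K = 0 then
          pathWeight b K else 0 := by
  unfold altWord
  simp_rw [evalAt_word_apply]
  rw [integral_finsetSum]
  · refine Finset.sum_congr rfl fun K _ => ?_
    by_cases hK : K 0 = k ∧ K (Fin.last m) = l
    · simp only [hK, true_and, if_true]
      rw [integral_const_mul, integral_monom, mul_ite, mul_one, mul_zero]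
      rfl
    · rw [if_neg fun h => hK ⟨h.1, h.2.1⟩]
      simp [hK]
  · intro K _
    split_ifs
    · exact (integrable_torus (continuous_monom _)).const_mul _
    · exact integrable_torus continuous_const

/-- Every interior exponent occurs once with each sign, so the total degree telescopes and only ends
with exponent role contribute. -/
theorem sum_altDeg {N m : ℕ} (t : Bool) (K : Fin (m + 1) → Fin N) :
    ∑ y, altDeg t K y = (if isBase t m then 0 else (K (Fin.last m) : ℤ) + 1)
      - (if t then 0 else (K 0 : ℤ) + 1) := by
  set φ : Fin (m + 1) → ℤ := fun j => if isBase t j then 0 else (K j : ℤ) + 1 with hφ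
  have htel : ∑ j : Fin m, (φ j.succ - φ j.castSucc) = φ (Fin.last m) - φ 0 := by
    rw [Finset.sum_sub_distrib]
    linarith [Fin.sum_univ_succ φ, Fin.sum_univ_castSucc φ]
  have h0 : φ (Fin.last m) - φ 0 = (if isBase t m then 0 else (K (Fin.last m) : ℤ) + 1)
      - (if t then 0 else (K 0 : ℤ) + 1) := by
    simp [hφ]
  rw [← h0, ← htel]
  unfold altDeg pathDeg
  simp only [Finset.sum_apply]
  rw [Finset.sum_comm]
  refine Finset.sum_congr rfl fun j _ => ?_
  simp only [hφ, Fin.val_succ, Fin.val_castSucc, isBase_succ]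
  by_cases h : isBase t j = true <;> simp [h]

theorem norm_pathWeight_le {N m : ℕ} (b : Fin m → CI) (K : Fin (m + 1) → Fin N) :
    ‖pathWeight b K‖ ≤ (Real.sqrt N)⁻¹ ^ m * ∏ j, ‖b j‖ := by
  rw [pathWeight, norm_mul, norm_pow, norm_inv, Complex.norm_real, Real.norm_of_nonneg (by positivity),
    norm_prod]
  exact mul_le_mul_of_nonneg_left (Finset.prod_le_prod (fun _ _ => norm_nonneg _)
    fun j _ => (b j).norm_coe_le_norm _) (by positivity)

theorem isBase_of_even {m : ℕ} (hm : Even m) (t : Bool) : isBase t m = t := by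
  obtain ⟨p, rfl⟩ := hm
  simp [isBase]

theorem isBase_of_odd {m : ℕ} (hm : Odd m) (t : Bool) : isBase t m = !t := by
  obtain ⟨p, rfl⟩ := hm
  rw [isBase_succ, isBase_of_even (even_two_mul p)]

/-- The sum over the balanced paths from `k` to `l` whose base values avoid `R` is close to the
`(k, l)` entry of the diagonal matrix of `f`, uniformly in `R` of bounded size. -/
def HasSymbol {m : ℕ} (t : Bool) (b : Fin m → CI) (f : CI) : Prop :=
  ∀ δ : ℝ, 0 < δ → ∀ r : ℕ, ∃ C : ℝ, 0 ≤ C ∧ ∀ᶠ N : ℕ in atTop, ∀ R : Finset (Fin N), R.card ≤ r →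
    ∀ k l : Fin N, ‖(∑ K : Fin (m + 1) → Fin N, if K 0 = k ∧ K (Fin.last m) = l ∧ altDeg t K = 0 ∧
        Disjoint (baseSet t K) R then pathWeight b K else 0)
      - (if k = l ∧ (t = true → k ∉ R) then f (gridPoint k) else 0)‖
      ≤ (if k = l then δ else 0) + C / N

/-- In odd length exactly one end has exponent role, so the total degree is plus or minus a single
exponent. This is nonzero because the exponents run from `1` to `N`. -/
theorem altDeg_ne_zero_of_odd {N m : ℕ} (hm : Odd m) (t : Bool) (K : Fin (m + 1) → Fin N) :
    altDeg t K ≠ 0 := by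
  intro h
  have h1 := sum_altDeg t K
  rw [h, isBase_of_odd hm t] at h1
  simp only [Pi.zero_apply, Finset.sum_const_zero] at h1
  cases t
  · simp only [Bool.not_false, if_true, Bool.false_eq_true, if_false] at h1
    omega
  · simp only [Bool.not_true, if_true, Bool.false_eq_true, if_false] at h1
    omega

theorem hasDiag_zero_of_odd {m : ℕ} (hm : Odd m) (t : Bool) (b : Fin m → CI) :
    HasDiag (altWord t b) 0 := by
  refine fun δ hδ => Eventually.of_forall fun N k => ?_
  beta_reduce
  rw [integral_altWord, Finset.sum_eq_zero]
  · simpa using hδ.le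
  · intro K _
    rw [if_neg]
    exact fun h => altDeg_ne_zero_of_odd hm t K h.2.2

theorem hasSymbol_zero_of_odd {m : ℕ} (hm : Odd m) (t : Bool) (b : Fin m → CI) :
    HasSymbol t b 0 := by
  intro δ hδ r
  refine ⟨0, le_rfl, Eventually.of_forall fun N R _ k l => ?_⟩
  rw [Finset.sum_eq_zero]
  · simp only [ContinuousMap.zero_apply, ite_self, sub_zero, norm_zero, zero_div, add_zero]
    split_ifs <;> linarith
  · intro K _
    rw [if_neg]
    exact fun h => altDeg_ne_zero_of_odd hm t K h.2.2.1

/-- The weight `N ^ (-m / 2)` just balances the number of paths with given ends when `Y` has one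
element fewer than assumed; the additional prescribed base gains `1 / N`. -/
theorem norm_sum_pathWeight_le {m : ℕ} (hm : Even m) (hm1 : 1 ≤ m) (t : Bool) (b : Fin m → CI) :
    ∃ C : ℝ, 0 ≤ C ∧ ∀ N : ℕ, 1 ≤ N → ∀ (k l : Fin N) (Y : Finset (Fin N)),
      (Y.card = if t then 2 else 1) → ∀ S : Finset (Fin (m + 1) → Fin N),
      (∀ K ∈ S, K 0 = k ∧ K (Fin.last m) = l ∧ altDeg t K = 0 ∧ Y ⊆ baseSet t K) →
      ‖∑ K ∈ S, pathWeight b K‖ ≤ C / N := by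
  obtain ⟨C, hC, h⟩ := card_path_le m t
  have hW : 0 ≤ ∏ j, ‖b j‖ := Finset.prod_nonneg fun _ _ => norm_nonneg _
  refine ⟨C * ∏ j, ‖b j‖, by positivity, fun N hN k l Y hY S hS => ?_⟩
  have hNr : (0 : ℝ) < N := by exact_mod_cast hN
  have h1 := h N hN k l Y S hS
  have h2 := card_innerPos m t (Or.inl hm1)
  have h3 : isBase t m = t := isBase_of_even hm t
  rw [h3] at h2
  obtain ⟨p, hp⟩ := hm
  have h4 : Fintype.card (InnerPos m t) + 1 + 1 = p + Y.card := by
    rw [hY]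
    cases t <;> simp at h2 ⊢ <;> omega
  have h5 : (S.card : ℝ) * (N : ℝ) ≤ C * (N : ℝ) ^ p := by
    have : ((S.card : ℝ) * N) * (N : ℝ) ^ Y.card ≤ (C * (N : ℝ) ^ p) * (N : ℝ) ^ Y.card := by
      calc ((S.card : ℝ) * N) * (N : ℝ) ^ Y.card = (S.card * (N : ℝ) ^ Y.card) * N := by ring
        _ ≤ (C * (N : ℝ) ^ (Fintype.card (InnerPos m t) + 1)) * N := by gcongr
        _ = C * (N : ℝ) ^ (Fintype.card (InnerPos m t) + 1 + 1) := by ring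
        _ = _ := by rw [h4]; ring
    exact le_of_mul_le_mul_right this (by positivity)
  have h6 : (Real.sqrt N)⁻¹ ^ m = ((N : ℝ) ^ p)⁻¹ := by
    rw [hp, inv_pow, ← two_mul, pow_mul, Real.sq_sqrt hNr.le]
  refine (norm_sum_le_of_le S fun K _ => norm_pathWeight_le b K).trans ?_
  rw [Finset.sum_const, nsmul_eq_mul, h6, le_div_iff₀ hNr]
  calc (S.card : ℝ) * (((N : ℝ) ^ p)⁻¹ * ∏ j, ‖b j‖) * N
      = (S.card * N) * ((N : ℝ) ^ p)⁻¹ * ∏ j, ‖b j‖ := by ring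
    _ ≤ (C * (N : ℝ) ^ p) * ((N : ℝ) ^ p)⁻¹ * ∏ j, ‖b j‖ := by gcongr
    _ = C * ∏ j, ‖b j‖ := by field_simp

/-- On the diagonal, avoiding `R` removes only paths through one of at most `r` prescribed bases,
each of which costs `O(1 / N)`. Off the diagonal, ends with base role are two distinct prescribed
bases, whereas ends with exponent role are forced to coincide by `sum_altDeg`. -/
theorem HasDiag.hasSymbol {m : ℕ} (hm : Even m) (hm1 : 1 ≤ m) {t : Bool} {b : Fin m → CI} {f : CI}
    (hf : HasDiag (altWord t b) f) : HasSymbol t b f := by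
  intro δ hδ r
  obtain ⟨C, hC, h⟩ := norm_sum_pathWeight_le hm hm1 t b
  refine ⟨(r + 1) * C, by positivity, ?_⟩
  filter_upwards [hf δ hδ, eventually_ge_atTop 1] with N hN hN1 R hR k l
  have hNr : (0 : ℝ) < N := by exact_mod_cast hN1
  have hmt : isBase t m = t := isBase_of_even hm t
  have hb0 : t = true → ∀ K : Fin (m + 1) → Fin N, K 0 ∈ baseSet t K := fun ht K =>
    mem_baseSet.2 ⟨0, by simp [ht], rfl⟩
  have hbl : t = true → ∀ K : Fin (m + 1) → Fin N, K (Fin.last m) ∈ baseSet t K := fun ht K =>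
    mem_baseSet.2 ⟨Fin.last m, by rw [Fin.val_last, hmt, ht], rfl⟩
  have hCN : C / N ≤ (r + 1) * C / N := by
    gcongr
    nlinarith
  by_cases hkl : k = l
  · subst hkl
    rw [if_pos rfl]
    by_cases hkR : t = true → k ∉ R
    · rw [if_pos ⟨rfl, hkR⟩]
      have hsplit : (∑ K : Fin (m + 1) → Fin N, if K 0 = k ∧ K (Fin.last m) = k ∧ altDeg t K = 0 ∧
          Disjoint (baseSet t K) R then pathWeight b K else 0)
          = (∫ z, evalAt z (altWord t b) k k ∂torusHaar N)
            - ∑ K : Fin (m + 1) → Fin N, if K 0 = k ∧ K (Fin.last m) = k ∧ altDeg t K = 0 ∧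
              ¬ Disjoint (baseSet t K) R then pathWeight b K else 0 := by
        rw [integral_altWord, ← Finset.sum_sub_distrib]
        refine Finset.sum_congr rfl fun K _ => ?_
        by_cases h1 : K 0 = k ∧ K (Fin.last m) = k ∧ altDeg t K = 0
        · by_cases h2 : Disjoint (baseSet t K) R
          · simp [h1, h2]
          · simp [h1, h2]
        · rw [if_neg fun h => h1 ⟨h.1, h.2.1, h.2.2.1⟩, if_neg h1,
            if_neg fun h => h1 ⟨h.1, h.2.1, h.2.2.1⟩, sub_zero]
      have hbad : ‖∑ K : Fin (m + 1) → Fin N, if K 0 = k ∧ K (Fin.last m) = k ∧ altDeg t K = 0 ∧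
              ¬ Disjoint (baseSet t K) R then pathWeight b K else 0‖ ≤ r * (C / N) := by
        classical
        rw [← Finset.sum_filter]
        set S : Finset (Fin (m + 1) → Fin N) := Finset.univ.filter fun K => K 0 = k ∧
          K (Fin.last m) = k ∧ altDeg t K = 0 ∧ ¬ Disjoint (baseSet t K) R with hS
        have hex : ∀ K, ∃ y, K ∈ S → y ∈ baseSet t K ∧ y ∈ R := by
          intro K
          by_cases hK : K ∈ S
          · obtain ⟨y, hy⟩ := Finset.not_disjoint_iff.1 (Finset.mem_filter.1 hK).2.2.2.2
            exact ⟨y, fun _ => hy⟩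
          · exact ⟨k, fun h => absurd h hK⟩
        choose c hc using hex
        rw [← Finset.sum_fiberwise_of_maps_to (t := R) (g := c) fun K hK => (hc K hK).2]
        refine (norm_sum_le_of_le (f := fun y => ∑ K ∈ S with c K = y, pathWeight b K) R
          (n := fun _ => C / N) fun y hy => ?_).trans ?_
        -- If the ends have base role, `k` is a base of every path and differs from `y`, since `k`
        -- is not in `R`.
        · refine h N hN1 k k (if t then {k, y} else {y}) ?_ _ fun K hK => ?_
          · by_cases ht : t = true
            · rw [if_pos ht, if_pos ht, Finset.card_pair]
              rintro rfl
              exact hkR ht hy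
            · rw [if_neg ht, if_neg ht, Finset.card_singleton]
          · obtain ⟨hKS, rfl⟩ := Finset.mem_filter.1 hK
            obtain ⟨-, h1, h2, h3, -⟩ := Finset.mem_filter.1 hKS
            refine ⟨h1, h2, h3, ?_⟩
            split_ifs with ht
            · rw [Finset.insert_subset_iff, Finset.singleton_subset_iff]
              exact ⟨by nth_rw 1 [← h1]; exact hb0 ht K, (hc K hKS).1⟩
            · rw [Finset.singleton_subset_iff]
              exact (hc K hKS).1
        · rw [Finset.sum_const, nsmul_eq_mul]
          gcongr
      rw [hsplit, sub_right_comm]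
      refine (norm_sub_le _ _).trans (add_le_add (hN k) (hbad.trans ?_))
      rw [mul_div_assoc]
      gcongr
      linarith
    · push Not at hkR
      rw [if_neg (by tauto), Finset.sum_eq_zero, sub_zero, norm_zero]
      · positivity
      · intro K _
        rw [if_neg]
        rintro ⟨h1, -, -, h4⟩
        exact Finset.disjoint_left.1 h4 (hb0 hkR.1 K) (h1 ▸ hkR.2)
  · rw [if_neg fun h => hkl h.1, if_neg hkl, sub_zero, zero_add, ← Finset.sum_filter]
    refine le_trans ?_ hCN
    by_cases ht : t = true
    · refine h N hN1 k l {k, l} (by rw [Finset.card_pair hkl, if_pos ht]) _ fun K hK => ?_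
      obtain ⟨-, h1, h2, h3, -⟩ := Finset.mem_filter.1 hK
      refine ⟨h1, h2, h3, ?_⟩
      rw [Finset.insert_subset_iff, Finset.singleton_subset_iff, ← h1, ← h2]
      exact ⟨hb0 ht K, hbl ht K⟩
    · rw [Finset.sum_eq_zero, norm_zero]
      · positivity
      · intro K hK
        obtain ⟨-, h1, h2, h3, -⟩ := Finset.mem_filter.1 hK
        exfalso
        have h4 := sum_altDeg t K
        rw [hmt, if_neg ht, if_neg ht, h3, h1, h2] at h4
        simp only [Pi.zero_apply, Finset.sum_const_zero] at h4
        exact hkl (Fin.ext (by omega))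

/-! ### Operator norm bounds -/

section OpNorm

open scoped Matrix.Norms.L2Operator

/-- The right-hand side is the squared Hilbert–Schmidt norm; Cauchy–Schwarz is applied to each row.
-/
theorem l2_opNorm_sq_le_trace {ι : Type*} [Fintype ι] [DecidableEq ι] (A : Matrix ι ι ℂ) :
    ‖A‖ ^ 2 ≤ (A * star A).trace.re := by
  have htr : (A * star A).trace.re = ∑ k, ∑ l, ‖A k l‖ ^ 2 := by
    simp only [Matrix.trace, Matrix.diag_apply, Matrix.mul_apply, Matrix.star_apply, Complex.re_sum,
      Complex.star_def, Complex.mul_conj, Complex.ofReal_re, Complex.normSq_eq_norm_sq]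
  rw [htr]
  have hS : 0 ≤ ∑ k, ∑ l, ‖A k l‖ ^ 2 := by positivity
  have h : ‖A‖ ≤ Real.sqrt (∑ k, ∑ l, ‖A k l‖ ^ 2) := by
    rw [← Matrix.l2_opNorm_toEuclideanCLM]
    refine ContinuousLinearMap.opNorm_le_bound _ (Real.sqrt_nonneg _) fun x => ?_
    rw [EuclideanSpace.norm_eq, EuclideanSpace.norm_eq x, ← Real.sqrt_mul hS]
    refine Real.sqrt_le_sqrt ?_
    rw [Finset.sum_mul]
    refine Finset.sum_le_sum fun k _ => ?_
    rw [Matrix.ofLp_toEuclideanCLM, Matrix.mulVec, dotProduct]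
    refine le_trans ?_ (Finset.sum_mul_sq_le_sq_mul_sq Finset.univ _ _)
    gcongr
    refine (norm_sum_le _ _).trans (le_of_eq ?_)
    simp_rw [norm_mul]
  calc ‖A‖ ^ 2 ≤ Real.sqrt (∑ k, ∑ l, ‖A k l‖ ^ 2) ^ 2 := by gcongr
    _ = _ := Real.sq_sqrt hS

/-- The preceding bound is applied to a power of `A * star A`. Powers of two allow repeated use of
the C*-identity. -/
theorem l2_opNorm_pow_le_trace {ι : Type*} [Fintype ι] [DecidableEq ι] (A : Matrix ι ι ℂ) (q : ℕ) :
    ‖A‖ ^ 2 ^ (q + 2) ≤ ((A * star A) ^ 2 ^ (q + 1)).trace.re := by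
  have hsa : IsSelfAdjoint (A * star A) := IsSelfAdjoint.mul_star_self A
  have h := l2_opNorm_sq_le_trace ((A * star A) ^ 2 ^ q)
  rw [(hsa.pow _).star_eq, ← pow_add, ← two_mul, ← pow_succ', hsa.norm_pow_two_pow,
    CStarRing.norm_self_mul_star] at h
  refine le_trans (le_of_eq ?_) h
  rw [← sq, ← pow_mul, ← pow_mul]
  congr 1
  ring

/-- The sum is the quadratic form of `A` at the all-ones vector, whose squared norm is `N`. -/
theorem norm_sum_entries_le {N : ℕ} (A : Matrix (Fin N) (Fin N) ℂ) :
    ‖∑ k, ∑ l, A k l‖ ≤ N * ‖A‖ := by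
  set u : EuclideanSpace ℂ (Fin N) := WithLp.toLp 2 fun _ => 1 with hu
  have hun : ‖u‖ = Real.sqrt N := by
    rw [EuclideanSpace.norm_eq]; simp [hu]
  have h1 : ∑ k, ∑ l, A k l = inner ℂ u (WithLp.toLp 2 (A.mulVec u.ofLp)) := by
    simp [hu, PiLp.inner_apply, Matrix.mulVec, dotProduct]
  rw [h1]
  refine (norm_inner_le_norm _ _).trans ?_
  have h2 := Matrix.l2_opNorm_mulVec A u
  have h3 : ‖u‖ * ‖u‖ = N := by rw [hun, Real.mul_self_sqrt (Nat.cast_nonneg N)]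
  calc ‖u‖ * ‖WithLp.toLp 2 (A.mulVec u.ofLp)‖ ≤ ‖u‖ * (‖A‖ * ‖u‖) :=
        mul_le_mul_of_nonneg_left h2 (norm_nonneg _)
    _ = (‖u‖ * ‖u‖) * ‖A‖ := by ring
    _ = N * ‖A‖ := by rw [h3]

theorem exists_norm_evalAt_le (a : NCPoly CI) : ∃ (K : ℝ) (n : ℕ), 0 ≤ K ∧
    ∀ (N : ℕ) (z : Fin N → Circle), ‖evalAt z a‖ ≤ K * (1 + ‖vandermonde z‖) ^ n := by
  have hincl : ∀ b : CI, ∃ (K : ℝ) (n : ℕ), 0 ≤ K ∧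
    ∀ (N : ℕ) (z : Fin N → Circle), ‖evalAt z (incl b)‖ ≤ K * (1 + ‖vandermonde z‖) ^ n := by
    refine fun b => ⟨‖b‖, 0, norm_nonneg _, fun N z => ?_⟩
    rw [evalAt_incl, sampleDiag, Matrix.l2_opNorm_diagonal, pow_zero, mul_one,
      pi_norm_le_iff_of_nonneg (norm_nonneg _)]
    exact fun k => b.norm_coe_le_norm _
  obtain ⟨x, rfl⟩ : ∃ x, NCPoly.mk x = a := RingQuot.mkAlgHom_surjective ℂ (Rel CI) a
  induction x using FreeAlgebra.induction with
  | grade0 r =>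
    have h : NCPoly.mk (algebraMap ℂ _ r) = incl (algebraMap ℂ CI r) := by
      rw [AlgHom.commutes]; exact (AlgHomClass.commutes (incl (B := CI)) r).symm
    rw [h]
    exact hincl _
  | grade1 g =>
    rcases g with b | s
    · exact hincl b
    · refine ⟨1, 1, zero_le_one, fun N z => ?_⟩
      have : evalAt z (NCPoly.mk (FreeAlgebra.ι ℂ (Sum.inr s))) = starPow (vandermonde z) s := by
        rw [← evalAt_starPow, starPow_X]; rfl
      rw [this, one_mul, pow_one]
      have h2 : ‖starPow (vandermonde z) s‖ = ‖vandermonde z‖ := by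
        cases s
        · rfl
        · exact norm_star _
      rw [h2]
      linarith
  | mul x y hx hy =>
    obtain ⟨K, n, hK, h⟩ := hx
    obtain ⟨K', n', hK', h'⟩ := hy
    refine ⟨K * K', n + n', by positivity, fun N z => ?_⟩
    rw [map_mul, map_mul]
    refine (norm_mul_le _ _).trans ?_
    refine (mul_le_mul (h N z) (h' N z) (norm_nonneg _) (by positivity)).trans (le_of_eq ?_)
    ring
  | add x y hx hy =>
    obtain ⟨K, n, hK, h⟩ := hx
    obtain ⟨K', n', hK', h'⟩ := hy
    refine ⟨K + K', n + n', by positivity, fun N z => ?_⟩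
    have h1 : (1 : ℝ) ≤ 1 + ‖vandermonde z‖ := by linarith [norm_nonneg (vandermonde z)]
    rw [map_add, map_add, add_mul]
    refine (norm_add_le _ _).trans (add_le_add ((h N z).trans ?_) ((h' N z).trans ?_))
    · exact mul_le_mul_of_nonneg_left (pow_le_pow_right₀ h1 (by omega)) hK
    · exact mul_le_mul_of_nonneg_left (pow_le_pow_right₀ h1 (by omega)) hK'

/-- The trace method: the power of the norm is at most the unnormalized trace of an alternating word
with trivial coefficients, whose expected diagonal entries are bounded by `HasDiag`. -/
theorem exists_integral_norm_pow_le (q : ℕ) : ∃ C : ℝ, 0 ≤ C ∧ ∀ᶠ N : ℕ in atTop,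
    ∫ z, ‖vandermonde z‖ ^ 2 ^ (q + 2) ∂torusHaar N ≤ C * N := by
  obtain ⟨M, hM⟩ : ∃ M, 2 ^ (q + 1) = M + 1 := ⟨2 ^ (q + 1) - 1, by
    have := Nat.two_pow_pos (q + 1); omega⟩
  set w : NCPoly CI := (List.ofFn fun _ : Fin (M + 1) => incl 1 * X * incl 1 * star X).prod with hw
  set f : CI := ∑ π : SetPartition (M + 1), Gam π (fun _ => 1) *
        algebraMap ℂ CI (tau (LamC π (fun _ => 1) * 1)) with hf
  have hd : HasDiag w f := hasDiag_oneStar (fun _ => 1) (fun _ => 1)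
  have hev : ∀ (N : ℕ) (z : Fin N → Circle),
      (vandermonde z * star (vandermonde z)) ^ 2 ^ (q + 1) = evalAt z w := by
    intro N z
    have hX : evalAt z X = vandermonde z := evalAt_starPow z false
    rw [hw, List.ofFn_const, List.prod_replicate, ← hM, map_one, one_mul, mul_one, map_pow, map_mul,
      evalAt_star, hX]
  refine ⟨‖f‖ + 1, by positivity, ?_⟩
  filter_upwards [hd 1 one_pos] with N hN
  have hc : Continuous fun z : Fin N → Circle => (evalAt z w).trace.re :=
    Complex.continuous_re.comp (continuous_evalAt w).matrix_trace
  have h1 : ∫ z, ‖vandermonde z‖ ^ 2 ^ (q + 2) ∂torusHaar N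
      ≤ ∫ z, (evalAt z w).trace.re ∂torusHaar N := by
    refine integral_mono (integrable_torus ((continuous_vandermonde N).norm.pow _))
      (integrable_torus hc) fun z => ?_
    beta_reduce
    rw [← hev]
    exact l2_opNorm_pow_le_trace _ q
  refine h1.trans ?_
  have h2 : ∫ z, (evalAt z w).trace.re ∂torusHaar N
      = (∑ k, ∫ z, evalAt z w k k ∂torusHaar N).re := by
    rw [← integral_finsetSum _ fun k _ => integrable_torus ((continuous_evalAt w).matrix_elem k k)]
    exact integral_re (𝕜 := ℂ) (integrable_torus (continuous_evalAt w).matrix_trace)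
  rw [h2]
  refine (Complex.re_le_norm _).trans ?_
  refine (norm_sum_le_of_le Finset.univ (n := fun _ => ‖f‖ + 1) fun k _ => ?_).trans ?_
  · have h3 := norm_le_norm_add_norm_sub' (∫ z, evalAt z w k k ∂torusHaar N) (f (gridPoint k))
    have h4 := f.norm_coe_le_norm (gridPoint k)
    linarith [hN k]
  · rw [Finset.sum_const, Finset.card_univ, Fintype.card_fin, nsmul_eq_mul, mul_comm]

/-- Arbitrarily high moments of the norm are `O(N)`. Passing to a moment of at least twice the order
and using `y ≤ s / 2 + y ^ 2 / (2 * s)` with `s = √N` improves this to `O(√N)`, which is enough. -/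
theorem exists_integral_one_add_norm_pow_le (n : ℕ) : ∃ C : ℝ, 0 ≤ C ∧ ∀ᶠ N : ℕ in atTop,
    ∫ z, (1 + ‖vandermonde z‖) ^ n ∂torusHaar N ≤ C * Real.sqrt N := by
  obtain ⟨C, hC, h⟩ := exists_integral_norm_pow_le (2 * n)
  set p := 2 ^ (2 * n + 2) with hp
  have hpn : n * 2 ≤ p := by
    rw [hp]
    have := (Nat.lt_two_pow_self (n := 2 * n + 2))
    omega
  -- The constant in the convexity inequality `(1 + x) ^ p ≤ 2 ^ (p - 1) * (1 + x ^ p)`.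
  set D : ℝ := 2 ^ (p - 1) with hD
  refine ⟨(1 + D * (1 + C)) / 2, by positivity, ?_⟩
  filter_upwards [h, eventually_ge_atTop 1] with N hN hN1
  have hNr : (1 : ℝ) ≤ N := by exact_mod_cast hN1
  set s := Real.sqrt N with hs
  have hs0 : 0 < s := Real.sqrt_pos.2 (by linarith)
  have hss : s * s = N := Real.mul_self_sqrt (by linarith)
  have hpt : ∀ z : Fin N → Circle, (1 + ‖vandermonde z‖) ^ n
      ≤ s / 2 + D / (2 * s) * (1 + ‖vandermonde z‖ ^ p) := by
    intro z
    set x := ‖vandermonde z‖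
    have hx : 0 ≤ x := norm_nonneg _
    have h1 : ((1 + x) ^ n) ^ 2 ≤ D * (1 + x ^ p) := by
      rw [← pow_mul]
      refine (pow_le_pow_right₀ (by linarith) hpn).trans ?_
      have := add_pow_le zero_le_one hx p
      rwa [one_pow] at this
    have h2 : 0 ≤ (s - (1 + x) ^ n) ^ 2 := sq_nonneg _
    have h3 : s / 2 + D / (2 * s) * (1 + x ^ p) = (s * s + D * (1 + x ^ p)) / (2 * s) := by
      field_simp
    rw [h3, le_div_iff₀ (by positivity)]
    nlinarith
  have hint : Integrable (fun z : Fin N → Circle => ‖vandermonde z‖ ^ p) (torusHaar N) :=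
    integrable_torus ((continuous_vandermonde N).norm.pow _)
  have h1 : ∫ z, (1 + ‖vandermonde z‖) ^ n ∂torusHaar N
      ≤ ∫ z, (s / 2 + D / (2 * s) * (1 + ‖vandermonde z‖ ^ p)) ∂torusHaar N :=
    integral_mono (integrable_torus ((continuous_const.add (continuous_vandermonde N).norm).pow _))
      ((integrable_const _).add (((integrable_const _).add hint).const_mul _)) hpt
  refine h1.trans ?_
  have h2 : ∫ z, (s / 2 + D / (2 * s) * (1 + ‖vandermonde z‖ ^ p)) ∂torusHaar N
      = s / 2 + D / (2 * s) * (1 + ∫ z, ‖vandermonde z‖ ^ p ∂torusHaar N) := by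
    have h3 : Integrable (fun z : Fin N → Circle => 1 + ‖vandermonde z‖ ^ p) (torusHaar N) :=
      (integrable_const _).add hint
    rw [integral_add (integrable_const _) (h3.const_mul _), integral_const_mul,
      integral_add (integrable_const _) hint]
    simp only [integral_const, probReal_univ, one_smul]
  rw [h2]
  calc s / 2 + D / (2 * s) * (1 + ∫ z, ‖vandermonde z‖ ^ p ∂torusHaar N)
      ≤ s / 2 + D / (2 * s) * (s * s + C * (s * s)) := by
        rw [hss]; gcongr
    _ = _ := by field_simp

end OpNorm

/-- The normalized sum of all entries of a polynomial in the random matrices is negligible. -/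
theorem tendsto_sum_entries (a : NCPoly CI) :
    Tendsto (fun N : ℕ => ((N : ℝ)⁻¹) ^ 2 * ‖∑ k : Fin N, ∑ l : Fin N,
      ∫ z, evalAt z a k l ∂torusHaar N‖) atTop (𝓝 0) := by
  open scoped Matrix.Norms.L2Operator in
  obtain ⟨K, n, hK, h⟩ := exists_norm_evalAt_le a
  obtain ⟨C, hC, h'⟩ := exists_integral_one_add_norm_pow_le n
  have hlim : Tendsto (fun N : ℕ => K * C * (Real.sqrt N)⁻¹) atTop (𝓝 0) := by
    have h0 : Tendsto (fun N : ℕ => (Real.sqrt N)⁻¹) atTop (𝓝 0) := tendsto_inv_atTop_zero.comp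
      (Real.tendsto_sqrt_atTop.comp tendsto_natCast_atTop_atTop)
    simpa using h0.const_mul (K * C)
  refine squeeze_zero' (Eventually.of_forall fun N => by positivity) ?_ hlim
  filter_upwards [h', eventually_ge_atTop 1] with N hN hN1
  have hNr : (0 : ℝ) < N := by exact_mod_cast hN1
  have e1 : ∑ k : Fin N, ∑ l : Fin N, ∫ z, evalAt z a k l ∂torusHaar N
      = ∫ z, ∑ k : Fin N, ∑ l : Fin N, evalAt z a k l ∂torusHaar N := by
    rw [integral_finsetSum _ fun k _ => integrable_torus
      (continuous_finsetSum _ fun l _ => (continuous_evalAt a).matrix_elem k l)]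
    refine Finset.sum_congr rfl fun k _ => ?_
    rw [integral_finsetSum _ fun l _ => integrable_torus ((continuous_evalAt a).matrix_elem k l)]
  have e2 : ‖∫ z, ∑ k : Fin N, ∑ l : Fin N, evalAt z a k l ∂torusHaar N‖
      ≤ ∫ z, N * K * (1 + ‖vandermonde z‖) ^ n ∂torusHaar N := by
    refine norm_integral_le_of_norm_le ((integrable_torus
      ((continuous_const.add (continuous_vandermonde N).norm).pow _)).const_mul _)
      (Eventually.of_forall fun z => ?_)
    refine (norm_sum_entries_le _).trans ?_
    rw [mul_assoc]
    gcongr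
    exact h N z
  have hs : Real.sqrt N * Real.sqrt N = N := Real.mul_self_sqrt hNr.le
  have hs0 : 0 < Real.sqrt N := Real.sqrt_pos.2 hNr
  rw [integral_const_mul] at e2
  rw [e1]
  calc ((N : ℝ)⁻¹) ^ 2 * ‖∫ z, ∑ k : Fin N, ∑ l : Fin N, evalAt z a k l ∂torusHaar N‖
      ≤ ((N : ℝ)⁻¹) ^ 2 * (N * K * (C * Real.sqrt N)) := by
        gcongr
        exact e2.trans (by gcongr)
    _ = K * C * (Real.sqrt N)⁻¹ := by
        field_simp
        rw [sq, hs]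
        ring

/-! ### Expansion of traces of products -/

section Isolated

variable {N s : ℕ} {Θ : Fin (s + 1) → Type*} (B : ∀ i, Θ i → Finset (Fin N))

/-- The base values of `θ I` are disjoint from those of the other terms. -/
def IsIsolated (θ : ∀ i, Θ i) (i : Fin (s + 1)) : Prop :=
  ∀ j, j ≠ i → Disjoint (B i (θ i)) (B j (θ j))

open scoped Classical in
/-- Splitting a sum according to the first isolated index. -/
theorem ite_eq_add_sum_isolated (θ : ∀ i, Θ i) (F : Prop) [Decidable F] (x : ℂ) :
    (if F then x else 0) = (if F ∧ ∀ i, ¬ IsIsolated B θ i then x else 0)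
      + ∑ I, if F ∧ IsIsolated B θ I ∧ ∀ j < I, ¬ IsIsolated B θ j then x else 0 := by
  by_cases hF : F
  · by_cases h : ∀ i, ¬ IsIsolated B θ i
    · simp [h]
    · push Not at h
      set S : Finset (Fin (s + 1)) := Finset.univ.filter fun i => IsIsolated B θ i with hS
      have hne : S.Nonempty := by
        obtain ⟨i, hi⟩ := h
        exact ⟨i, Finset.mem_filter.2 ⟨Finset.mem_univ _, hi⟩⟩
      have hmem := (Finset.mem_filter.1 (S.min'_mem hne)).2
      have hmin : ∀ j < S.min' hne, ¬ IsIsolated B θ j := fun j hj hij =>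
        absurd (S.min'_le j (Finset.mem_filter.2 ⟨Finset.mem_univ _, hij⟩)) (not_le.2 hj)
      rw [if_pos hF, if_neg (by rintro ⟨-, h'⟩; exact h' _ hmem), zero_add,
        Finset.sum_eq_single (S.min' hne)]
      · rw [if_pos ⟨hF, hmem, hmin⟩]
      · intro I _ hI
        rw [if_neg]
        rintro ⟨-, h1, h2⟩
        rcases lt_or_gt_of_ne hI with h3 | h3
        · exact hmin I h3 h1
        · exact h2 _ h3 hmem
      · simp
  · simp [hF]

end Isolated

section Expansion

variable {N s : ℕ} {Θ : Fin (s + 1) → Type*} [∀ i, Fintype (Θ i)]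
  (st en : ∀ i, Θ i → Fin N) (wt : ∀ i, Θ i → ℂ) (deg : ∀ i, Θ i → Fin N → ℤ)
  (B : ∀ i, Θ i → Finset (Fin N))

theorem trace_prod_ofFn {R ι : Type*} [CommSemiring R] [Fintype ι] [DecidableEq ι] {m : ℕ}
    (M : Fin m → Matrix ι ι R) :
    (List.ofFn M).prod.trace = ∑ κ : Fin (m + 1) → ι,
      if κ 0 = κ (Fin.last m) then ∏ j : Fin m, M j (κ j.castSucc) (κ j.succ) else 0 := by
  simp only [Matrix.trace, Matrix.diag_apply, prod_ofFn_apply]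
  rw [Finset.sum_comm]
  refine Finset.sum_congr rfl fun κ _ => ?_
  rw [Finset.sum_eq_single (κ 0)]
  · simp [eq_comm]
  · intro k _ hk
    rw [if_neg fun h => hk h.1.symm]
  · simp

/-- The trace of a product of matrices with monomial entries, as a sum over closed chains. -/
theorem integral_trace_prod (M : (Fin N → Circle) → Fin (s + 1) → Matrix (Fin N) (Fin N) ℂ)
    (hM : ∀ z i k l, M z i k l
      = ∑ θ, if st i θ = k ∧ en i θ = l then wt i θ * monom z (deg i θ) else 0) :
    ∫ z, (List.ofFn (M z)).prod.trace ∂torusHaar N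
      = ∑ κ : Fin (s + 2) → Fin N, if κ 0 = κ (Fin.last _) then
        ∑ θ : ∀ i, Θ i, if (∀ i, st i (θ i) = κ i.castSucc ∧ en i (θ i) = κ i.succ) ∧
          ∑ i, deg i (θ i) = 0 then ∏ i, wt i (θ i) else 0 else 0 := by
  simp_rw [trace_prod_ofFn]
  rw [integral_finsetSum]
  · refine Finset.sum_congr rfl fun κ _ => ?_
    split_ifs
    · simp_rw [hM]
      rw [integral_prod_terms (fun i θ => st i θ = κ i.castSucc ∧ en i θ = κ i.succ) wt deg]
      exact Finset.sum_congr rfl fun θ _ => by congr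
    · simp
  · intro κ _
    split_ifs
    · refine integrable_torus (continuous_finsetProd _ fun j _ => ?_)
      simp_rw [hM]
      refine continuous_finsetSum _ fun θ _ => ?_
      split_ifs
      · exact (continuous_monom _).const_mul _
      · exact continuous_const
    · exact integrable_torus continuous_const

variable (I : Fin (s + 1))

open scoped Classical in
/-- The terms for which `I` is the first isolated index contribute at most the sum in which the
term at `I` is replaced by a bound for its partial sums. -/
theorem norm_sum_isolated_le (hdeg : ∀ i θ y, y ∉ B i θ → deg i θ y = 0)
    {r : ℕ} (hr : ∀ θ : ∀ j : {j // j ≠ I}, Θ j,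
      (Finset.univ.biUnion fun j : {j // j ≠ I} => B j (θ j)).card ≤ r)
    (h : Fin N → Fin N → ℝ) (hh : ∀ R : Finset (Fin N), R.card ≤ r → ∀ k l,
      ‖∑ θ : Θ I, if (st I θ = k ∧ en I θ = l) ∧ deg I θ = 0 ∧ Disjoint (B I θ) R then
        wt I θ else 0‖ ≤ h k l) (κ : Fin (s + 2) → Fin N) :
    ‖∑ θ : ∀ i, Θ i, if ((∀ i, st i (θ i) = κ i.castSucc ∧ en i (θ i) = κ i.succ) ∧
          ∑ i, deg i (θ i) = 0) ∧ IsIsolated B θ I ∧ ∀ j < I, ¬ IsIsolated B θ j then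
        ∏ i, wt i (θ i) else 0‖
      ≤ h (κ I.castSucc) (κ I.succ) * ∑ θ : ∀ j : {j // j ≠ I}, Θ j,
        if (∀ j : {j // j ≠ I}, st j (θ j) = κ j.1.castSucc ∧ en j (θ j) = κ j.1.succ) ∧
          ∑ j : {j // j ≠ I}, deg j (θ j) = 0 then ∏ j : {j // j ≠ I}, ‖wt j (θ j)‖ else 0 := by
  set k := κ I.castSucc
  set l := κ I.succ
  set R : (∀ j : {j // j ≠ I}, Θ j) → Finset (Fin N) := fun φ =>
    Finset.univ.biUnion fun j : {j // j ≠ I} => B j (φ j) with hR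
  set rest : (∀ j : {j // j ≠ I}, Θ j) → Prop := fun φ =>
    (∀ j : {j // j ≠ I}, st j (φ j) = κ j.1.castSucc ∧ en j (φ j) = κ j.1.succ) ∧
      ∑ j : {j // j ≠ I}, deg j (φ j) = 0 with hrest
  -- Minimality of `I`, expressed without the term at `I`. This is possible because the bases of
  -- that term meet no others; consequently the sum over it can be carried out first.
  set cond : (∀ j : {j // j ≠ I}, Θ j) → Prop := fun φ => ∀ j : {j // j ≠ I}, j.1 < I →
    ∃ j' : {j // j ≠ I}, j' ≠ j ∧ ¬ Disjoint (B j (φ j)) (B j' (φ j')) with hcond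
  have hkey : ∀ (x : Θ I) (φ : ∀ j : {j // j ≠ I}, Θ j),
      (if ((∀ i, st i ((Equiv.piSplitAt I Θ).symm (x, φ) i) = κ i.castSucc ∧
          en i ((Equiv.piSplitAt I Θ).symm (x, φ) i) = κ i.succ) ∧
          ∑ i, deg i ((Equiv.piSplitAt I Θ).symm (x, φ) i) = 0) ∧
          IsIsolated B ((Equiv.piSplitAt I Θ).symm (x, φ)) I ∧
          ∀ j < I, ¬ IsIsolated B ((Equiv.piSplitAt I Θ).symm (x, φ)) j then
        ∏ i, wt i ((Equiv.piSplitAt I Θ).symm (x, φ) i) else 0)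
      = (if rest φ ∧ cond φ then ∏ j : {j // j ≠ I}, wt j (φ j) else 0) *
        (if (st I x = k ∧ en I x = l) ∧ deg I x = 0 ∧ Disjoint (B I x) (R φ) then
          wt I x else 0) := by
    intro x φ
    set θ := (Equiv.piSplitAt I Θ).symm (x, φ) with hθ
    have h1 : θ I = x := by simp [hθ, Equiv.piSplitAt]
    have h2 : ∀ j : {j // j ≠ I}, θ j = φ j := by
      intro j; simp [hθ, Equiv.piSplitAt, j.2]
    have hiso : IsIsolated B θ I ↔ Disjoint (B I x) (R φ) := by
      rw [hR, Finset.disjoint_biUnion_right]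
      constructor
      · intro h j _
        rw [← h1, ← h2]
        exact h j j.2
      · intro h j hj
        have := h ⟨j, hj⟩ (Finset.mem_univ _)
        rwa [← h1, ← h2] at this
    have hends : (∀ i, st i (θ i) = κ i.castSucc ∧ en i (θ i) = κ i.succ) ↔
        (∀ j : {j // j ≠ I}, st j (φ j) = κ j.1.castSucc ∧ en j (φ j) = κ j.1.succ) ∧
          (st I x = k ∧ en I x = l) := by
      constructor
      · intro h
        refine ⟨fun j => ?_, ?_⟩
        · rw [← h2]; exact h j
        · rw [← h1]; exact h I
      · rintro ⟨h, h'⟩ i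
        by_cases hi : i = I
        · subst hi; rw [h1]; exact h'
        · have := h ⟨i, hi⟩
          rwa [← h2] at this
    have hsum : ∑ i, deg i (θ i) = deg I x + ∑ j : {j // j ≠ I}, deg j (φ j) := by
      rw [Fintype.sum_eq_add_sum_subtype_ne (fun i => deg i (θ i)) I, h1]
      simp_rw [h2]
    -- Degrees are supported on the base sets, so on disjoint supports the total degree vanishes
    -- only if both parts do.
    have hbal : Disjoint (B I x) (R φ) → (∑ i, deg i (θ i) = 0 ↔
        deg I x = 0 ∧ ∑ j : {j // j ≠ I}, deg j (φ j) = 0) := by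
      intro hd
      rw [hsum]
      constructor
      · intro h0
        have hx : deg I x = 0 := by
          funext y
          by_cases hy : y ∈ B I x
          · have h3 := congrFun h0 y
            rw [Pi.add_apply, Finset.sum_apply, Finset.sum_eq_zero, add_zero] at h3
            · exact h3
            · intro j _
              refine hdeg j _ y fun hyj => ?_
              exact Finset.disjoint_left.1 hd hy (Finset.mem_biUnion.2 ⟨j, Finset.mem_univ _, hyj⟩)
          · exact hdeg I x y hy
        rw [hx, zero_add] at h0
        exact ⟨hx, h0⟩
      · rintro ⟨h3, h4⟩
        rw [h3, h4, add_zero]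
    have hco : Disjoint (B I x) (R φ) → ((∀ j < I, ¬ IsIsolated B θ j) ↔ cond φ) := by
      intro hd
      have hdj : ∀ j : {j // j ≠ I}, Disjoint (B j (φ j)) (B I x) := fun j =>
        ((Finset.disjoint_biUnion_right _ _ _).1 hd j (Finset.mem_univ _)).symm
      constructor
      · intro h j hj
        have h3 := h j hj
        unfold IsIsolated at h3
        push Not at h3
        obtain ⟨j', hne, h4⟩ := h3
        have hj' : j' ≠ I := by
          rintro rfl
          rw [h2, h1] at h4
          exact h4 (hdj j)
        refine ⟨⟨j', hj'⟩, fun h5 => hne (congrArg Subtype.val h5), ?_⟩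
        rwa [← h2, ← h2]
      · intro h j hj h3
        obtain ⟨j', hne, h4⟩ := h ⟨j, hj.ne⟩ hj
        rw [← h2, ← h2] at h4
        exact h4 (h3 j' fun h5 => hne (Subtype.ext h5))
    have hprod : ∏ i, wt i (θ i) = wt I x * ∏ j : {j // j ≠ I}, wt j (φ j) := by
      rw [Fintype.prod_eq_mul_prod_subtype_ne (fun i => wt i (θ i)) I, h1]
      simp_rw [h2]
    rw [ite_zero_mul_ite_zero, hprod, mul_comm (wt I x)]
    refine if_congr ?_ rfl rfl
    rw [hends, hiso]
    by_cases hd : Disjoint (B I x) (R φ)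
    · rw [hbal hd, hco hd]
      simp only [hrest]
      tauto
    · tauto
  rw [← Equiv.sum_comp (Equiv.piSplitAt I Θ).symm, Fintype.sum_prod_type_right]
  simp_rw [hkey, ← Finset.mul_sum]
  rw [Finset.mul_sum]
  refine norm_sum_le_of_le _ fun φ _ => ?_
  rw [norm_mul]
  have hb := hh (R φ) (hr φ) k l
  have hh0 : 0 ≤ h k l := (norm_nonneg _).trans hb
  rw [mul_comm]
  refine mul_le_mul hb ?_ (norm_nonneg _) hh0
  by_cases h1 : rest φ
  · rw [if_pos h1]
    split_ifs
    · rw [norm_prod]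
    · rw [norm_zero]; positivity
  · rw [if_neg h1, if_neg fun h => h1 h.1, norm_zero]

theorem trace_prod_ofFn_update {R ι : Type*} [CommSemiring R] [Fintype ι] [DecidableEq ι]
    (M : Fin (s + 1) → Matrix ι ι R) (H : Matrix ι ι R) :
    (List.ofFn (Function.update M I H)).prod.trace = ∑ κ : Fin (s + 2) → ι,
      if κ 0 = κ (Fin.last _) then H (κ I.castSucc) (κ I.succ) *
        ∏ j : {j // j ≠ I}, M j (κ j.1.castSucc) (κ j.1.succ) else 0 := by
  rw [trace_prod_ofFn]
  refine Finset.sum_congr rfl fun κ _ => ?_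
  congr 1
  rw [Fintype.prod_eq_mul_prod_subtype_ne _ I, Function.update_self]
  congr 1
  refine Finset.prod_congr rfl fun j _ => ?_
  rw [Function.update_of_ne j.2]

/-- After the other weights are replaced by their absolute values, all terms are nonnegative and the
conditions on isolation of earlier indices can be dropped. What remains is again the expected trace
of a product of matrices. -/
theorem norm_sum_sum_isolated_le (hdeg : ∀ i θ y, y ∉ B i θ → deg i θ y = 0)
    {r : ℕ} (hr : ∀ θ : ∀ j : {j // j ≠ I}, Θ j,
      (Finset.univ.biUnion fun j : {j // j ≠ I} => B j (θ j)).card ≤ r)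
    (h : Fin N → Fin N → ℝ) (hh : ∀ R : Finset (Fin N), R.card ≤ r → ∀ k l,
      ‖∑ θ : Θ I, if (st I θ = k ∧ en I θ = l) ∧ deg I θ = 0 ∧ Disjoint (B I θ) R then
        wt I θ else 0‖ ≤ h k l)
    (M : (Fin N → Circle) → Fin (s + 1) → Matrix (Fin N) (Fin N) ℂ)
    (hM : ∀ z i k l, M z i k l
      = ∑ θ, if st i θ = k ∧ en i θ = l then (‖wt i θ‖ : ℂ) * monom z (deg i θ) else 0) :
    open scoped Classical in
    ‖∑ κ : Fin (s + 2) → Fin N, if κ 0 = κ (Fin.last _) then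
      ∑ θ : ∀ i, Θ i, if ((∀ i, st i (θ i) = κ i.castSucc ∧ en i (θ i) = κ i.succ) ∧
          ∑ i, deg i (θ i) = 0) ∧ IsIsolated B θ I ∧ ∀ j < I, ¬ IsIsolated B θ j then
        ∏ i, wt i (θ i) else 0 else 0‖
      ≤ ‖∫ z, (List.ofFn (Function.update (M z) I
          (Matrix.of fun k l => (h k l : ℂ)))).prod.trace ∂torusHaar N‖ := by
  classical
  set Q : (Fin (s + 2) → Fin N) → ℝ := fun κ => if κ 0 = κ (Fin.last _) then
    h (κ I.castSucc) (κ I.succ) * ∑ θ : ∀ j : {j // j ≠ I}, Θ j,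
        if (∀ j : {j // j ≠ I}, st j (θ j) = κ j.1.castSucc ∧ en j (θ j) = κ j.1.succ) ∧
          ∑ j : {j // j ≠ I}, deg j (θ j) = 0 then ∏ j : {j // j ≠ I}, ‖wt j (θ j)‖ else 0
    else 0 with hQ
  have h1 : ∫ z, (List.ofFn (Function.update (M z) I
          (Matrix.of fun k l => (h k l : ℂ)))).prod.trace ∂torusHaar N = ((∑ κ, Q κ : ℝ) : ℂ) := by
    simp_rw [trace_prod_ofFn_update, Matrix.of_apply, hM]
    rw [Complex.ofReal_sum, integral_finsetSum]
    · refine Finset.sum_congr rfl fun κ _ => ?_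
      simp only [hQ]
      split_ifs
      · rw [integral_const_mul, integral_prod_terms
          (fun (j : {j // j ≠ I}) θ => st j θ = κ j.1.castSucc ∧ en j θ = κ j.1.succ)
          (fun j θ => (‖wt j θ‖ : ℂ)) (fun j => deg j)]
        rw [Complex.ofReal_mul, Complex.ofReal_sum]
        congr 1
        refine Finset.sum_congr rfl fun θ _ => ?_
        split_ifs
        · rw [Complex.ofReal_prod]
        · simp
      · simp
    · intro κ _
      split_ifs
      · refine integrable_torus (continuous_const.mul (continuous_finsetProd _ fun j _ => ?_))
        refine continuous_finsetSum _ fun θ _ => ?_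
        split_ifs
        · exact (continuous_monom _).const_mul _
        · exact continuous_const
      · exact integrable_torus continuous_const
  rw [h1, Complex.norm_real]
  refine le_trans ?_ (le_abs_self _)
  refine norm_sum_le_of_le _ fun κ _ => ?_
  simp only [hQ]
  split_ifs
  · convert norm_sum_isolated_le st en wt deg B I hdeg hr h hh κ using 2
  · simp

end Expansion

/-! ### The terms of a centered alternating word -/

/-- The terms in the expansion of an entry of a centered alternating word of length `m`: the paths
of length `m`, and the paths of length `0` (for the centering). -/
abbrev Term (N m : ℕ) := Σ c : Bool, (Fin (cond c m 0 + 1) → Fin N)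

/-- The weight of a term. -/
noncomputable def termWeight {N m : ℕ} (b : Fin m → CI) (f : CI) : Term N m → ℂ
  | ⟨true, K⟩ => pathWeight (m := m) b K
  | ⟨false, K⟩ => -f (gridPoint (K 0))

theorem altDeg_eq_zero {N m : ℕ} (t : Bool) (K : Fin (m + 1) → Fin N) {y : Fin N}
    (hy : y ∉ baseSet t K) : altDeg t K y = 0 := by
  unfold altDeg pathDeg
  rw [Finset.sum_apply]
  refine Finset.sum_eq_zero fun j _ => ?_
  by_cases h : isBase t j = true
  · simp only [h, Bool.not_true, Bool.false_eq_true, if_false]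
    refine Pi.single_eq_of_ne (fun he => hy (mem_baseSet.2 ⟨j.castSucc, h, he.symm⟩)) _
  · simp only [h, Bool.not_false, if_true]
    rw [Pi.neg_apply, Pi.single_eq_of_ne, neg_zero]
    refine fun he => hy (mem_baseSet.2 ⟨j.succ, ?_, he.symm⟩)
    rw [Fin.val_succ, isBase_succ]
    simpa using h

theorem sum_fin_one {N : ℕ} {A : Type*} [AddCommMonoid A] (F : (Fin (0 + 1) → Fin N) → A) :
    ∑ K, F K = ∑ k : Fin N, F fun _ => k :=
  (Equiv.sum_comp (Equiv.funUnique (Fin 1) (Fin N)).symm F).symm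

theorem baseSet_const {N : ℕ} (t : Bool) (k : Fin N) :
    baseSet t (fun _ : Fin (0 + 1) => k) = if t = true then {k} else ∅ := by
  ext y
  rw [mem_baseSet]
  cases t <;> simp [isBase, eq_comm]

/-- The centering is encoded by paths of length zero: they have trivial degree and sit on the
diagonal. -/
theorem evalAt_sub_incl_apply {N m : ℕ} (t : Bool) (b : Fin m → CI) (f : CI) (z : Fin N → Circle)
    (k l : Fin N) :
    evalAt z (altWord t b - incl f) k l = ∑ θ : Term N m,
      if θ.2 0 = k ∧ θ.2 (Fin.last _) = l then
        termWeight b f θ * monom z (altDeg t θ.2) else 0 := by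
  rw [Fintype.sum_sigma, Fintype.sum_bool, map_sub, Matrix.sub_apply, sub_eq_add_neg]
  congr 1
  · unfold altWord
    rw [evalAt_word_apply]
    rfl
  · have h1 : ∀ K : Fin (0 + 1) → Fin N, altDeg t K = 0 := fun K => by
      unfold altDeg pathDeg; rfl
    have h2 : ∑ K : Fin (cond false m 0 + 1) → Fin N, (if K 0 = k ∧ K (Fin.last _) = l then
        termWeight b f ⟨false, K⟩ * monom z (altDeg t K) else 0)
        = ∑ K : Fin (0 + 1) → Fin N, if K 0 = k ∧ K (Fin.last _) = l then
          -f (gridPoint (K 0)) * monom z (altDeg t K) else 0 := rfl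
    rw [h2]
    simp_rw [h1, monom_zero, mul_one]
    rw [sum_fin_one, evalAt_incl, sampleDiag, Matrix.diagonal_apply, Finset.sum_eq_single k]
    · by_cases h : k = l <;> simp [h]
    · intro x _ hx; simp [hx]
    · simp

/-- A path of length zero at `k` has `k` as a base only if its point has base role. This explains
the condition `t = true → k ∉ R` in `HasSymbol`. -/
theorem sum_termWeight {N m : ℕ} (t : Bool) (b : Fin m → CI) (f : CI) (R : Finset (Fin N))
    (k l : Fin N) :
    (∑ θ : Term N m, if (θ.2 0 = k ∧ θ.2 (Fin.last _) = l) ∧ altDeg t θ.2 = 0 ∧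
        Disjoint (baseSet t θ.2) R then termWeight b f θ else 0)
      = (∑ K : Fin (m + 1) → Fin N, if K 0 = k ∧ K (Fin.last m) = l ∧ altDeg t K = 0 ∧
        Disjoint (baseSet t K) R then pathWeight b K else 0)
      - (if k = l ∧ (t = true → k ∉ R) then f (gridPoint k) else 0) := by
  rw [Fintype.sum_sigma, Fintype.sum_bool, sub_eq_add_neg]
  congr 1
  · refine Finset.sum_congr rfl fun K _ => ?_
    exact if_congr and_assoc rfl rfl
  · have h1 : ∀ K : Fin (0 + 1) → Fin N, altDeg t K = 0 := fun K => by
      unfold altDeg pathDeg; rfl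
    have h2 : ∑ K : Fin (cond false m 0 + 1) → Fin N, (if (K 0 = k ∧ K (Fin.last _) = l) ∧
        altDeg t K = 0 ∧ Disjoint (baseSet t K) R then termWeight b f ⟨false, K⟩ else 0)
        = ∑ K : Fin (0 + 1) → Fin N, if (K 0 = k ∧ K (Fin.last _) = l) ∧
        altDeg t K = 0 ∧ Disjoint (baseSet t K) R then -f (gridPoint (K 0)) else 0 := rfl
    rw [h2, sum_fin_one, Finset.sum_eq_single k]
    · simp only [h1, true_and, baseSet_const]
      by_cases h : k = l
      · cases t
        · simp [h]
        · by_cases h3 : l ∈ R <;> simp [h, h3]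
      · simp [h]
    · intro x _ hx; simp [hx]
    · simp

/-- The absolute value of a continuous function. -/
noncomputable def absC (f : CI) : CI := ⟨fun x => (‖f x‖ : ℂ), by fun_prop⟩

/-- Absolute values of weights are again weights, for the coefficients `|b j|` and the centering
`-|f|`. The majorant therefore remains a polynomial in the random matrices, accessible to the
induction. -/
theorem termWeight_abs {N m : ℕ} (b : Fin m → CI) (f : CI) (θ : Term N m) :
    termWeight (fun j => absC (b j)) (-absC f) θ = (‖termWeight b f θ‖ : ℂ) := by
  obtain ⟨c, K⟩ := θ
  cases c
  · simp [termWeight, absC]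
  · simp only [termWeight, pathWeight, absC, ContinuousMap.coe_mk, norm_mul, norm_pow, norm_inv,
      Complex.norm_real, norm_prod, Complex.ofReal_mul, Complex.ofReal_pow, Complex.ofReal_inv,
      Complex.ofReal_prod]
    rw [Real.norm_of_nonneg (Real.sqrt_nonneg _)]

theorem norm_termWeight_le {N m : ℕ} (b : Fin m → CI) (f : CI) (θ : Term N m) :
    ‖termWeight b f θ‖ ≤ (Real.sqrt N)⁻¹ ^ (cond θ.1 m 0) * (∏ j, ‖b j‖ + ‖f‖) := by
  have hW : 0 ≤ ∏ j, ‖b j‖ := Finset.prod_nonneg fun _ _ => norm_nonneg _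
  obtain ⟨c, K⟩ := θ
  cases c
  · simp only [termWeight, cond_false, pow_zero, one_mul, norm_neg]
    linarith [f.norm_coe_le_norm (gridPoint (K 0))]
  · refine (norm_pathWeight_le b K).trans ?_
    simp only [cond_true]
    gcongr
    linarith [norm_nonneg f]

/-! ### Replacing one factor of a product -/

section Update

variable {s : ℕ}

theorem ofFn_update {A : Type*} (M : Fin s → A) (I : Fin s) (x : A) :
    List.ofFn (Function.update M I x) = (List.ofFn M).set I x := by
  refine List.ext_getElem (by simp) fun n h1 h2 => ?_
  rw [List.getElem_ofFn, List.getElem_set, List.getElem_ofFn]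
  by_cases h : (I : ℕ) = n
  · subst h; simp
  · rw [if_neg h, Function.update_of_ne]
    intro h3
    exact h (by rw [← h3])

theorem prod_ofFn_update {A : Type*} [Monoid A] (M : Fin s → A) (I : Fin s) (x : A) :
    (List.ofFn (Function.update M I x)).prod
      = ((List.ofFn M).take I).prod * x * ((List.ofFn M).drop (I + 1)).prod := by
  rw [ofFn_update, List.prod_set, if_pos]
  simp

/-- The product of the factors other than the one at `I`, in cyclic order starting after `I`. -/
noncomputable def cyclicProd {A : Type*} [Monoid A] (a : Fin s → A) (I : Fin s) : A :=
  ((List.ofFn a).drop (I + 1)).prod * ((List.ofFn a).take I).prod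

/-- Cyclicity of the trace isolates the replaced factor. -/
theorem trace_update {N : ℕ} (z : Fin N → Circle) (a : Fin s → NCPoly CI) (I : Fin s)
    (H : Matrix (Fin N) (Fin N) ℂ) :
    (List.ofFn (Function.update (fun i => evalAt z (a i)) I H)).prod.trace
      = ∑ k, ∑ l, H k l * evalAt z (cyclicProd a I) l k := by
  have h1 : List.ofFn (fun i => evalAt z (a i)) = (List.ofFn a).map (evalAt z) := by
    rw [List.map_ofFn]; rfl
  rw [prod_ofFn_update, Matrix.trace_mul_comm, ← mul_assoc, Matrix.trace_mul_comm, h1,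
    ← List.map_take, ← List.map_drop, ← map_list_prod, ← map_list_prod, ← map_mul]
  simp only [Matrix.trace, Matrix.diag_apply, Matrix.mul_apply]
  rfl

theorem list_prod_mem_shortWords {ι : Type*} (a : ι → NCPoly CI) (m : ι → ℕ)
    (h : ∀ i, a i ∈ shortWords CI (m i + 1)) (L : List ι) :
    (L.map a).prod ∈ shortWords CI ((L.map m).sum + 1) := by
  induction L with
  | nil =>
    have := incl_mem (B := CI) (n := 1) one_pos 1
    rwa [map_one] at this
  | cons i L ih =>
    rw [List.map_cons, List.map_cons, List.prod_cons, List.sum_cons]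
    exact mul_mem_shortWords (by omega) (h i) ih

/-- Removing a factor of positive length leaves words that are strictly shorter than the full
product, so that the induction hypothesis covers them. -/
theorem cyclicProd_mem {a : Fin s → NCPoly CI} {m : Fin s → ℕ}
    (h : ∀ i, a i ∈ shortWords CI (m i + 1)) (hm : ∀ i, 1 ≤ m i) (I : Fin s) :
    cyclicProd a I ∈ shortWords CI (∑ i, m i) := by
  have e : List.ofFn a = (List.finRange s).map a := List.ofFn_eq_map
  have hs : ((List.finRange s).map m).sum = ∑ i, m i := by
    rw [← List.ofFn_eq_map, List.sum_ofFn]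
  have h1 := List.sum_take_add_sum_drop ((List.finRange s).map m) I
  rw [List.drop_eq_getElem_cons (by simp), List.sum_cons, hs] at h1
  simp only [List.getElem_map, List.getElem_finRange, Fin.cast_mk, Fin.eta] at h1
  rw [← List.map_take, ← List.map_drop] at h1
  rw [cyclicProd, e, ← List.map_drop, ← List.map_take]
  have h2 := hm I
  exact mul_mem_shortWords (by omega) (list_prod_mem_shortWords a m h _)
    (list_prod_mem_shortWords a m h _)

end Update

/-! ### Centered products -/

section Centered

variable {s : ℕ} {m : Fin (s + 1) → ℕ} {t : Fin (s + 1) → Bool} {b : ∀ i, Fin (m i) → CI}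
  {f : Fin (s + 1) → CI}

theorem isBase_cond {m : ℕ} {t : Bool} {c : Bool} (h : c = false → Even m) :
    isBase t (cond c m 0) = isBase t m := by
  cases c
  · rw [cond_false, isBase_zero, isBase_of_even (h rfl)]
  · rfl

theorem termWeight_zero {N m : ℕ} (b : Fin m → CI) {θ : Term N m} (h : θ.1 = false) :
    termWeight b 0 θ = 0 := by
  obtain ⟨c, K⟩ := θ
  simp only at h
  subst h
  simp [termWeight]

theorem baseSet_eq_empty {N m : ℕ} {t : Bool} {θ : Term N m} (h : θ.1 = false) (ht : t = false) :
    baseSet t θ.2 = ∅ := by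
  obtain ⟨c, K⟩ := θ
  simp only at h
  subst h
  refine Finset.eq_empty_of_forall_notMem fun y hy => ?_
  obtain ⟨p, hp, -⟩ := mem_baseSet.1 hy
  have hp0 : (p : ℕ) = 0 := by
    have := p.2
    simp only [cond_false] at this
    omega
  rw [hp0, isBase_zero, ht] at hp
  exact absurd hp (by simp)

open scoped Classical in
/-- The balanced closed families of terms in which no term is isolated. -/
noncomputable def nonIsolated (m : Fin (s + 1) → ℕ) (t : Fin (s + 1) → Bool) (N : ℕ) :
    Finset (∀ i, Term N (m i)) :=
  {θ | (∃ κ : Fin (s + 2) → Fin N, κ 0 = κ (Fin.last _) ∧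
      ∀ i, (θ i).2 0 = κ i.castSucc ∧ (θ i).2 (Fin.last _) = κ i.succ) ∧
    ∑ i, altDeg (t i) (θ i).2 = 0 ∧
    ∀ i, ¬ IsIsolated (fun i (θ : Term N (m i)) => baseSet (t i) θ.2) θ i}

-- The pattern `c` says which factors use a path and which the centering, the latter counting as a
-- path of length zero. Evenness ensures that shrinking a path preserves the roles of its ends, and
-- `t i = true` makes the remaining point a base.
open scoped Classical in
theorem card_nonIsolated_le {T : Fin (s + 2) → Bool} (hT : ∀ i, T i.castSucc = t i)
    (hT' : ∀ i, isBase (t i) (m i) = !T i.succ) (hm : ∀ i, 1 ≤ m i)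
    (c : Fin (s + 1) → Bool) (hc : ∀ i, c i = false → t i = true ∧ Even (m i)) :
    ∃ C : ℝ, 0 ≤ C ∧ ∀ N : ℕ, 1 ≤ N →
      (((nonIsolated m t N).filter fun θ => (fun i => (θ i).1) = c).card : ℝ)
        ≤ C * Real.sqrt N ^ (∑ i, cond (c i) (m i) 0 + 1) := by
  obtain ⟨C, hC, h⟩ := card_noniso_le (fun i => cond (c i) (m i) 0) t (fun i => by
    cases hci : c i
    · exact Or.inr (hc i hci).1
    · exact Or.inl (hm i)) T hT (fun i => by
    rw [← hT' i]
    exact isBase_cond fun h => (hc i h).2)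
  refine ⟨C, hC, fun N hN => ?_⟩
  set emb : (∀ i, Fin (cond (c i) (m i) 0 + 1) → Fin N) → ∀ i, Term N (m i) :=
    fun K i => ⟨c i, K i⟩ with hemb
  set 𝒦 : Finset (∀ i, Fin (cond (c i) (m i) 0 + 1) → Fin N) :=
    Finset.univ.filter fun K => emb K ∈ nonIsolated m t N with h𝒦
  have hsub : ((nonIsolated m t N).filter fun θ => (fun i => (θ i).1) = c) ⊆ 𝒦.image emb := by
    intro θ hθ
    obtain ⟨hθ', hcθ⟩ := Finset.mem_filter.1 hθ
    subst hcθ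
    exact Finset.mem_image.2 ⟨fun i => (θ i).2, Finset.mem_filter.2 ⟨Finset.mem_univ _, hθ'⟩, rfl⟩
  refine le_trans ?_ (h N hN 𝒦 fun K hK => ?_)
  · exact_mod_cast (Finset.card_le_card hsub).trans Finset.card_image_le
  · obtain ⟨-, h1, h2, h3⟩ := Finset.mem_filter.1 (Finset.mem_filter.1 hK).2
    refine ⟨h1, h2, fun i => ?_⟩
    have := h3 i
    unfold IsIsolated at this
    push Not at this
    exact this

theorem prod_termWeight_eq_zero (hodd : ∀ i, Odd (m i) → f i = 0) {N : ℕ}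
    {θ : ∀ i, Term N (m i)} (hθ : ¬ ∀ i, (θ i).1 = false → Even (m i)) :
    ∏ i, termWeight (b i) (f i) (θ i) = 0 := by
  push Not at hθ
  obtain ⟨i, h1, h2⟩ := hθ
  refine Finset.prod_eq_zero (Finset.mem_univ i) ?_
  rw [hodd i (Nat.not_even_iff_odd.1 h2)]
  exact termWeight_zero _ h1

-- Per pattern, the weights are of order `√N` to minus the total length, and the number of families
-- is of order `√N` to the total length plus one.
open scoped Classical in
theorem exists_sum_nonIsolated_le {T : Fin (s + 2) → Bool} (hT : ∀ i, T i.castSucc = t i)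
    (hT' : ∀ i, isBase (t i) (m i) = !T i.succ) (hm : ∀ i, 1 ≤ m i)
    (hodd : ∀ i, Odd (m i) → f i = 0) :
    ∃ C : ℝ, 0 ≤ C ∧ ∀ N : ℕ, 1 ≤ N →
      ∑ θ ∈ nonIsolated m t N, ‖∏ i, termWeight (b i) (f i) (θ i)‖ ≤ C * Real.sqrt N := by
  have key : ∀ c : Fin (s + 1) → Bool, ∃ C : ℝ, 0 ≤ C ∧ ∀ N : ℕ, 1 ≤ N →
      ∑ θ ∈ (nonIsolated m t N).filter (fun θ => (fun i => (θ i).1) = c),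
        ‖∏ i, termWeight (b i) (f i) (θ i)‖ ≤ C * Real.sqrt N := by
    intro c
    by_cases hc : ∀ i, c i = false → t i = true ∧ Even (m i)
    · obtain ⟨C, hC, h⟩ := card_nonIsolated_le hT hT' hm c hc
      set W : ℝ := ∏ i, (∏ j, ‖b i j‖ + ‖f i‖) with hW
      have hW0 : 0 ≤ W := Finset.prod_nonneg fun i _ =>
        add_nonneg (Finset.prod_nonneg fun _ _ => norm_nonneg _) (norm_nonneg _)
      refine ⟨C * W, by positivity, fun N hN => ?_⟩
      have hs0 : 0 < Real.sqrt N := Real.sqrt_pos.2 (by exact_mod_cast hN)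
      set n := ∑ i, cond (c i) (m i) 0
      refine (Finset.sum_le_card_nsmul _ _ ((Real.sqrt N)⁻¹ ^ n * W) ?_).trans ?_
      · intro θ hθ
        obtain ⟨-, hcθ⟩ := Finset.mem_filter.1 hθ
        rw [norm_prod]
        refine (Finset.prod_le_prod (fun _ _ => norm_nonneg _) fun i _ =>
          norm_termWeight_le (b i) (f i) (θ i)).trans (le_of_eq ?_)
        rw [Finset.prod_mul_distrib, Finset.prod_pow_eq_pow_sum]
        subst hcθ
        rfl
      · rw [nsmul_eq_mul]
        calc _ ≤ (C * Real.sqrt N ^ (n + 1)) * ((Real.sqrt N)⁻¹ ^ n * W) := by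
              gcongr
              exact h N hN
          _ = (Real.sqrt N * (Real.sqrt N)⁻¹) ^ n * (C * W * Real.sqrt N) := by
              rw [mul_pow]; ring
          _ = C * W * Real.sqrt N := by rw [mul_inv_cancel₀ hs0.ne', one_pow, one_mul]
    -- The other patterns contribute nothing: an odd factor has centering zero, and a centering term
    -- without bases is isolated.
    · refine ⟨0, le_rfl, fun N _ => ?_⟩
      rw [Finset.sum_eq_zero, zero_mul]
      intro θ hθ
      obtain ⟨hθ, hcθ⟩ := Finset.mem_filter.1 hθ
      rw [prod_termWeight_eq_zero hodd, norm_zero]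
      intro hev
      apply hc
      intro i hi
      rw [← hcθ] at hi
      refine ⟨?_, hev i hi⟩
      by_contra hti
      refine (Finset.mem_filter.1 hθ).2.2.2 i fun j _ => ?_
      have h0 : baseSet (t i) (θ i).2 = ∅ :=
        baseSet_eq_empty hi (by simpa using hti)
      simp only [h0, Finset.disjoint_empty_left]
  choose C hC h using key
  refine ⟨∑ c, C c, Finset.sum_nonneg fun c _ => hC c, fun N hN => ?_⟩
  rw [← Finset.sum_fiberwise (nonIsolated m t N) (fun θ i => (θ i).1), Finset.sum_mul]
  exact Finset.sum_le_sum fun c _ => h c N hN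

-- The ends of the terms determine the chain `κ`, so each family is counted once.
open scoped Classical in
theorem norm_sum_sum_nonIsolated_le (N : ℕ) :
    ‖∑ κ : Fin (s + 2) → Fin N, if κ 0 = κ (Fin.last _) then
      ∑ θ : ∀ i, Term N (m i), if ((∀ i, (θ i).2 0 = κ i.castSucc ∧
          (θ i).2 (Fin.last _) = κ i.succ) ∧ ∑ i, altDeg (t i) (θ i).2 = 0) ∧
          ∀ i, ¬ IsIsolated (fun i (θ : Term N (m i)) => baseSet (t i) θ.2) θ i then
        ∏ i, termWeight (b i) (f i) (θ i) else 0 else 0‖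
      ≤ ∑ θ ∈ nonIsolated m t N, ‖∏ i, termWeight (b i) (f i) (θ i)‖ := by
  set F : (Fin (s + 2) → Fin N) → (∀ i, Term N (m i)) → Prop := fun κ θ =>
    κ 0 = κ (Fin.last _) ∧ ∀ i, (θ i).2 0 = κ i.castSucc ∧ (θ i).2 (Fin.last _) = κ i.succ with hF
  have huniq : ∀ θ κ κ', F κ θ → F κ' θ → κ = κ' := by
    rintro θ κ κ' ⟨h1, h2⟩ ⟨h1', h2'⟩
    funext j
    cases j using Fin.lastCases with
    | last => rw [← Fin.succ_last, ← (h2 _).2, ← (h2' _).2]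
    | cast i => rw [← (h2 i).1, ← (h2' i).1]
  have e : ∀ κ : Fin (s + 2) → Fin N, (if κ 0 = κ (Fin.last _) then
      ∑ θ : ∀ i, Term N (m i), if ((∀ i, (θ i).2 0 = κ i.castSucc ∧
          (θ i).2 (Fin.last _) = κ i.succ) ∧ ∑ i, altDeg (t i) (θ i).2 = 0) ∧
          ∀ i, ¬ IsIsolated (fun i (θ : Term N (m i)) => baseSet (t i) θ.2) θ i then
        ∏ i, termWeight (b i) (f i) (θ i) else 0 else 0)
      = ∑ θ ∈ nonIsolated m t N, if F κ θ then ∏ i, termWeight (b i) (f i) (θ i) else 0 := by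
    intro κ
    rw [nonIsolated, Finset.sum_filter]
    by_cases hκ : κ 0 = κ (Fin.last _)
    · rw [if_pos hκ]
      refine Finset.sum_congr rfl fun θ _ => ?_
      by_cases hf : ∀ i, (θ i).2 0 = κ i.castSucc ∧ (θ i).2 (Fin.last _) = κ i.succ
      · have hex : ∃ κ : Fin (s + 2) → Fin N, κ 0 = κ (Fin.last _) ∧
          ∀ i, (θ i).2 0 = κ i.castSucc ∧ (θ i).2 (Fin.last _) = κ i.succ := ⟨κ, hκ, hf⟩
        rw [if_pos (show F κ θ from ⟨hκ, hf⟩)]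
        refine if_congr ?_ rfl rfl
        tauto
      · rw [if_neg fun h => hf h.1.1, if_neg (show ¬ F κ θ from fun h => hf h.2), ite_self]
    · rw [if_neg hκ]
      symm
      refine Finset.sum_eq_zero fun θ _ => ?_
      rw [if_neg (show ¬ F κ θ from fun h => hκ h.1), ite_self]
  simp_rw [e]
  rw [Finset.sum_comm]
  refine norm_sum_le_of_le _ fun θ hθ => ?_
  obtain ⟨κ, hκ⟩ := (Finset.mem_filter.1 hθ).2.1
  rw [Finset.sum_eq_single κ]
  · rw [if_pos hκ]
  · intro κ' _ hne
    rw [if_neg fun h => hne (huniq θ _ _ h hκ)]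
  · simp

end Centered

section CenteredLimit

variable {s : ℕ} {m : Fin (s + 1) → ℕ} {t : Fin (s + 1) → Bool} {b : ∀ i, Fin (m i) → CI}
  {f : Fin (s + 1) → CI}

theorem altWord_mem {m : ℕ} (t : Bool) (b : Fin m → CI) : altWord t b ∈ shortWords CI (m + 1) := by
  rw [altWord, ← letterWord_ofFn]
  exact letterWord_mem (by simp)

theorem card_baseSet_term_le {N m : ℕ} (t : Bool) (θ : Term N m) :
    (baseSet t θ.2).card ≤ m + 1 := by
  refine Finset.card_image_le.trans ((Finset.card_le_univ _).trans ?_)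
  rw [Fintype.card_fin]
  cases θ.1 <;> simp

/-- The contribution of the families whose first isolated index is `I`. -/
noncomputable def isolatedSum (t : Fin (s + 1) → Bool) (b : ∀ i, Fin (m i) → CI)
    (f : Fin (s + 1) → CI) (N : ℕ) (I : Fin (s + 1)) : ℂ :=
  open scoped Classical in
  ∑ κ : Fin (s + 2) → Fin N, if κ 0 = κ (Fin.last _) then
    ∑ θ : ∀ i, Term N (m i), if ((∀ i, (θ i).2 0 = κ i.castSucc ∧
        (θ i).2 (Fin.last _) = κ i.succ) ∧ ∑ i, altDeg (t i) (θ i).2 = 0) ∧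
        IsIsolated (fun i (θ : Term N (m i)) => baseSet (t i) θ.2) θ I ∧
        ∀ j < I, ¬ IsIsolated (fun i (θ : Term N (m i)) => baseSet (t i) θ.2) θ j then
      ∏ i, termWeight (b i) (f i) (θ i) else 0 else 0

theorem norm_isolatedSum_le (I : Fin (s + 1)) {N : ℕ} (h : Fin N → Fin N → ℝ)
    (hh : ∀ R : Finset (Fin N), R.card ≤ ∑ j : {j // j ≠ I}, (m j + 1) → ∀ k l,
      ‖(∑ K : Fin (m I + 1) → Fin N, if K 0 = k ∧ K (Fin.last _) = l ∧ altDeg (t I) K = 0 ∧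
        Disjoint (baseSet (t I) K) R then pathWeight (b I) K else 0)
      - (if k = l ∧ (t I = true → k ∉ R) then f I (gridPoint k) else 0)‖ ≤ h k l) :
    ‖isolatedSum t b f N I‖ ≤ ‖∑ k, ∑ l, (h k l : ℂ) * ∫ z, evalAt z (cyclicProd (fun i =>
      altWord (t i) (fun j => absC (b i j)) - incl (-absC (f i))) I) l k ∂torusHaar N‖ := by
  have h0 := norm_sum_sum_isolated_le (Θ := fun i => Term N (m i)) (fun i θ => θ.2 0)
    (fun i θ => θ.2 (Fin.last _)) (fun i => termWeight (b i) (f i)) (fun i θ => altDeg (t i) θ.2)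
    (fun i θ => baseSet (t i) θ.2) I (fun i θ y hy => altDeg_eq_zero _ _ hy)
    (r := ∑ j : {j // j ≠ I}, (m j + 1))
    (fun θ => Finset.card_biUnion_le.trans
      (Finset.sum_le_sum fun j _ => card_baseSet_term_le _ _)) h
    (fun R hR k l => by
      have := hh R hR k l
      rw [← sum_termWeight] at this
      convert this using 3)
    (fun z i => evalAt z (altWord (t i) (fun j => absC (b i j)) - incl (-absC (f i))))
    (fun z i k l => by
      rw [evalAt_sub_incl_apply]
      simp_rw [termWeight_abs])
  refine h0.trans (le_of_eq ?_)
  congr 1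
  simp_rw [trace_update, Matrix.of_apply]
  have hint : ∀ k l, Integrable (fun z => (h k l : ℂ) * evalAt z (cyclicProd (fun i =>
      altWord (t i) (fun j => absC (b i j)) - incl (-absC (f i))) I) l k) (torusHaar N) :=
    fun k l => (integrable_torus ((continuous_evalAt _).matrix_elem l k)).const_mul _
  rw [integral_finsetSum _ fun k _ => integrable_finsetSum _ fun l _ => hint k l]
  refine Finset.sum_congr rfl fun k _ => ?_
  rw [integral_finsetSum _ fun l _ => hint k l]
  exact Finset.sum_congr rfl fun l _ => integral_const_mul _ _

/-- The majorant `δ` on the diagonal plus `C / N` everywhere produces `δ` times a normalized trace,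
bounded by `hbdd`, and `C` times the quantity of `tendsto_sum_entries`. -/
theorem tendsto_isolatedSum (I : Fin (s + 1)) (hm : ∀ i, 1 ≤ m i)
    (hsym : HasSymbol (t I) (b I) (f I))
    (hbdd : ∀ a ∈ shortWords CI (∑ i, m i), ∃ C : ℝ, ∀ᶠ N : ℕ in atTop,
      ‖∫ z, ntrace (evalAt z a) ∂torusHaar N‖ ≤ C) :
    Tendsto (fun N : ℕ => (N : ℂ)⁻¹ * isolatedSum t b f N I) atTop (𝓝 0) := by
  set a := cyclicProd (fun i => altWord (t i) (fun j => absC (b i j)) - incl (-absC (f i))) I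
    with ha
  have hamem : a ∈ shortWords CI (∑ i, m i) := cyclicProd_mem
    (fun i => Submodule.sub_mem _ (altWord_mem _ _) (incl_mem (Nat.succ_pos _) _)) hm I
  obtain ⟨D, hD⟩ := hbdd a hamem
  have hD0 : 0 ≤ D := by
    obtain ⟨N, hN⟩ := hD.exists
    exact (norm_nonneg _).trans hN
  rw [Metric.tendsto_nhds]
  intro ε hε
  -- Chosen so that `δ * D ≤ ε / 2`, also when `D = 0`. The constant `C` comes after `δ`, which is
  -- harmless since its contribution vanishes as `N` grows.
  set δ := ε / (2 * (D + 1)) with hδ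
  have hδ0 : 0 < δ := by positivity
  obtain ⟨C, hC, hs⟩ := hsym δ hδ0 (∑ j : {j // j ≠ I}, (m j + 1))
  have hlim : Tendsto (fun N : ℕ => C * (((N : ℝ)⁻¹) ^ 2 * ‖∑ k : Fin N, ∑ l : Fin N,
      ∫ z, evalAt z a k l ∂torusHaar N‖)) atTop (𝓝 0) := by
    simpa using (tendsto_sum_entries a).const_mul C
  filter_upwards [hD, hs, hlim.eventually (gt_mem_nhds (half_pos hε)), eventually_ge_atTop 1]
    with N hDN hsN hlN hN1
  have hNr : (0 : ℝ) < N := by exact_mod_cast hN1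
  have h1 := norm_isolatedSum_le (t := t) (b := b) (f := f) I
    (fun k l : Fin N => (if k = l then δ else 0) + C / N) hsN
  rw [← ha] at h1
  have h2 : ∑ k : Fin N, ∑ l, (((if k = l then δ else 0) + C / N : ℝ) : ℂ)
      * ∫ z, evalAt z a l k ∂torusHaar N
      = δ * ∑ k, ∫ z, evalAt z a k k ∂torusHaar N
        + (C / N : ℝ) * ∑ k, ∑ l, ∫ z, evalAt z a k l ∂torusHaar N := by
    simp_rw [Complex.ofReal_add, add_mul, Finset.sum_add_distrib, ← Finset.mul_sum]
    congr 1
    · rw [Finset.mul_sum]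
      refine Finset.sum_congr rfl fun k _ => ?_
      rw [Finset.sum_eq_single k]
      · rw [if_pos rfl]
      · intro l _ hl
        rw [if_neg hl.symm, Complex.ofReal_zero, zero_mul]
      · simp
    · rw [Finset.sum_comm]
  have h3 : ∫ z, ntrace (evalAt z a) ∂torusHaar N
      = (N : ℂ)⁻¹ * ∑ k, ∫ z, evalAt z a k k ∂torusHaar N := by
    unfold ntrace Matrix.trace
    rw [integral_const_mul, integral_finsetSum _ fun k _ => by
      simpa using integrable_torus ((continuous_evalAt a).matrix_elem k k)]
    rfl
  rw [h3] at hDN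
  rw [h2] at h1
  rw [dist_zero_right, norm_mul, norm_inv, Complex.norm_natCast]
  rw [norm_mul, norm_inv, Complex.norm_natCast] at hDN
  calc (N : ℝ)⁻¹ * ‖isolatedSum t b f N I‖
      ≤ (N : ℝ)⁻¹ * (δ * ‖∑ k, ∫ z, evalAt z a k k ∂torusHaar N‖
        + C / N * ‖∑ k, ∑ l, ∫ z, evalAt z a k l ∂torusHaar N‖) := by
        gcongr
        refine h1.trans ((norm_add_le _ _).trans (le_of_eq ?_))
        rw [norm_mul, norm_mul, Complex.norm_real, Complex.norm_real, Real.norm_of_nonneg hδ0.le,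
          Real.norm_of_nonneg (by positivity)]
    _ = δ * ((N : ℝ)⁻¹ * ‖∑ k, ∫ z, evalAt z a k k ∂torusHaar N‖) + C * (((N : ℝ)⁻¹) ^ 2 *
        ‖∑ k, ∑ l, ∫ z, evalAt z a k l ∂torusHaar N‖) := by ring
    _ < δ * D + ε / 2 := by
        refine add_lt_add_of_le_of_lt ?_ hlN
        gcongr
    _ ≤ ε / 2 + ε / 2 := by
        gcongr
        rw [hδ, div_mul_eq_mul_div, div_le_div_iff₀ (by positivity) two_pos]
        nlinarith
    _ = ε := by ring

/-- Alternating words, centered by the limits of their diagonal entries, have a product whose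
normalized trace is negligible, provided that consecutive words meet in equal letters. -/
theorem tendsto_ntrace_centered {T : Fin (s + 2) → Bool} (hT : ∀ i, T i.castSucc = t i)
    (hT' : ∀ i, isBase (t i) (m i) = !T i.succ) (hm : ∀ i, 1 ≤ m i)
    (hodd : ∀ i, Odd (m i) → f i = 0) (hsym : ∀ i, HasSymbol (t i) (b i) (f i))
    (hbdd : ∀ a ∈ shortWords CI (∑ i, m i), ∃ C : ℝ, ∀ᶠ N : ℕ in atTop,
      ‖∫ z, ntrace (evalAt z a) ∂torusHaar N‖ ≤ C) :
    Tendsto (fun N : ℕ => ∫ z, ntrace (evalAt z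
      (List.ofFn fun i => altWord (t i) (b i) - incl (f i)).prod) ∂torusHaar N) atTop (𝓝 0) := by
  classical
  obtain ⟨C, hC, hnon⟩ := exists_sum_nonIsolated_le (b := b) hT hT' hm hodd
  set S : ℕ → ℂ := fun N => ∑ κ : Fin (s + 2) → Fin N, if κ 0 = κ (Fin.last _) then
      ∑ θ : ∀ i, Term N (m i), if ((∀ i, (θ i).2 0 = κ i.castSucc ∧
          (θ i).2 (Fin.last _) = κ i.succ) ∧ ∑ i, altDeg (t i) (θ i).2 = 0) ∧
          ∀ i, ¬ IsIsolated (fun i (θ : Term N (m i)) => baseSet (t i) θ.2) θ i then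
        ∏ i, termWeight (b i) (f i) (θ i) else 0 else 0 with hS
  have hexp : ∀ N, ∫ z, ntrace (evalAt z
      (List.ofFn fun i => altWord (t i) (b i) - incl (f i)).prod) ∂torusHaar N
      = (N : ℂ)⁻¹ * S N + ∑ I, (N : ℂ)⁻¹ * isolatedSum t b f N I := by
    intro N
    have h1 : ∀ z : Fin N → Circle, evalAt z
        (List.ofFn fun i => altWord (t i) (b i) - incl (f i)).prod
        = (List.ofFn fun i => evalAt z (altWord (t i) (b i) - incl (f i))).prod := by
      intro z
      rw [map_list_prod, List.map_ofFn]
      rfl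
    unfold ntrace
    simp_rw [h1]
    rw [integral_const_mul, integral_trace_prod (Θ := fun i => Term N (m i)) (fun i θ => θ.2 0)
      (fun i θ => θ.2 (Fin.last _)) (fun i => termWeight (b i) (f i))
      (fun i θ => altDeg (t i) θ.2) _ (fun z i k l => evalAt_sub_incl_apply _ _ _ z k l),
      ← Finset.mul_sum, ← mul_add]
    congr 1
    simp only [hS, isolatedSum]
    rw [Finset.sum_comm, ← Finset.sum_add_distrib]
    refine Finset.sum_congr rfl fun κ _ => ?_
    by_cases hκ : κ 0 = κ (Fin.last _)
    · simp only [if_pos hκ]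
      rw [Finset.sum_comm, ← Finset.sum_add_distrib]
      refine Finset.sum_congr rfl fun θ _ => ?_
      rw [ite_eq_add_sum_isolated (fun i (θ : Term N (m i)) => baseSet (t i) θ.2) θ]
    · simp [hκ]
  simp_rw [hexp]
  have hS0 : Tendsto (fun N : ℕ => (N : ℂ)⁻¹ * S N) atTop (𝓝 0) := by
    rw [tendsto_zero_iff_norm_tendsto_zero]
    have h0 : Tendsto (fun N : ℕ => C * (Real.sqrt N)⁻¹) atTop (𝓝 0) := by
      have h0 : Tendsto (fun N : ℕ => (Real.sqrt N)⁻¹) atTop (𝓝 0) := tendsto_inv_atTop_zero.comp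
        (Real.tendsto_sqrt_atTop.comp tendsto_natCast_atTop_atTop)
      simpa using h0.const_mul C
    refine squeeze_zero' (Eventually.of_forall fun N => norm_nonneg _) ?_ h0
    filter_upwards [eventually_ge_atTop 1] with N hN1
    have hNr : (0 : ℝ) < N := by exact_mod_cast hN1
    have hs : Real.sqrt N * Real.sqrt N = N := Real.mul_self_sqrt hNr.le
    have hs0 : 0 < Real.sqrt N := Real.sqrt_pos.2 hNr
    have h2 : ‖S N‖ ≤ C * Real.sqrt N := by
      refine le_trans ?_ (hnon N hN1)
      convert norm_sum_sum_nonIsolated_le (m := m) (t := t) (b := b) (f := f) N using 2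
    rw [norm_mul, norm_inv, Complex.norm_natCast, inv_mul_le_iff₀ hNr]
    refine h2.trans (le_of_eq ?_)
    nth_rw 2 [← hs]
    field_simp
  have := hS0.add (tendsto_finsetSum Finset.univ fun I _ =>
    tendsto_isolatedSum (t := t) (b := b) (f := f) I hm (hsym I) hbdd)
  simpa using this

end CenteredLimit

/-! ### Weak limits -/

theorem integrable_CI (f : CI) : Integrable f :=
  f.continuous.integrable_of_hasCompactSupport (HasCompactSupport.of_compactSpace f)

theorem tau_add (f g : CI) : tau (f + g : CI) = tau f + tau g :=
  integral_add (integrable_CI f) (integrable_CI g)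

theorem tau_smul (c : ℂ) (f : CI) : tau (c • f : CI) = c * tau f :=
  integral_const_mul c f

theorem tau_star (f : CI) : tau (star f : CI) = star (tau f) :=
  integral_conj (f := f)

theorem eq_zero_of_tau_star_mul {g : CI} (h : tau (star g * g : CI) = 0) : g = 0 := by
  by_contra hg
  have hne : ∃ x, g x ≠ 0 := by
    by_contra hx
    push Not at hx
    exact hg (ContinuousMap.ext hx)
  obtain ⟨x, hx⟩ := hne
  have hc : Continuous (Set.IccExtend zero_le_one g) := g.continuous.Icc_extend'
  have h1 : tau (star g * g : CI)
      = ((∫ y in (0 : ℝ)..1, ‖Set.IccExtend zero_le_one g y‖ ^ 2 : ℝ) : ℂ) := by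
    rw [tau_eq_interval, ← intervalIntegral.integral_ofReal]
    refine intervalIntegral.integral_congr fun y _ => ?_
    simp only [Set.IccExtend, Function.comp_apply, ContinuousMap.mul_apply, ContinuousMap.star_apply]
    rw [Complex.star_def, mul_comm, Complex.mul_conj, Complex.normSq_eq_norm_sq]
  have h2 : 0 < ∫ y in (0 : ℝ)..1, ‖Set.IccExtend zero_le_one g y‖ ^ 2 := by
    refine intervalIntegral.integral_pos one_pos (hc.norm.pow 2).continuousOn
      (fun y _ => by positivity) ⟨x, x.2, ?_⟩
    rw [Set.IccExtend_val]
    positivity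
  rw [h1] at h
  exact h2.ne' (by exact_mod_cast h)

/-- The normalized traces of `a`, evaluated at the random Vandermonde matrices, against the diagonal
matrices converge in expectation to those of `f`. -/
def HasLim (a : NCPoly CI) (f : CI) : Prop :=
  ∀ c : CI, Tendsto (fun N : ℕ => ∫ z, ntrace (evalAt z (incl c * a)) ∂torusHaar N) atTop
    (𝓝 (tau (c * f : CI)))

theorem continuous_ntrace {N : ℕ} (a : NCPoly CI) :
    Continuous fun z : Fin N → Circle => ntrace (evalAt z a) :=
  continuous_const.mul (continuous_evalAt a).matrix_trace

/-- Testing against `star (f - g)` and using faithfulness of `tau`. -/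
theorem HasLim.unique {a : NCPoly CI} {f g : CI} (hf : HasLim a f) (hg : HasLim a g) : f = g := by
  rw [← sub_eq_zero]
  refine eq_zero_of_tau_star_mul ?_
  have h := tendsto_nhds_unique (hf (star (f - g))) (hg (star (f - g)))
  have e : star (f - g) * f = star (f - g) * (f - g) + star (f - g) * g := by ring
  rw [e, tau_add] at h
  simpa using h

theorem HasLim.add {a a' : NCPoly CI} {f f' : CI} (h : HasLim a f) (h' : HasLim a' f') :
    HasLim (a + a') (f + f') := by
  intro c
  have e : c * (f + f') = c * f + c * f' := mul_add c f f'
  rw [e, tau_add]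
  refine ((h c).add (h' c)).congr fun N => ?_
  rw [← integral_add (integrable_torus (continuous_ntrace _)) (integrable_torus (continuous_ntrace _))]
  congr 1
  funext z
  rw [mul_add, map_add, ntrace, ntrace, ntrace, Matrix.trace_add, mul_add]

theorem HasLim.smul {a : NCPoly CI} {f : CI} (h : HasLim a f) (r : ℂ) :
    HasLim (r • a) (r • f) := by
  intro c
  have e : c * (r • f) = r • (c * f) := mul_smul_comm r c f
  rw [e, tau_smul]
  refine ((h c).const_mul r).congr fun N => ?_
  rw [← integral_const_mul]
  congr 1
  funext z
  rw [mul_smul_comm, map_smul, ntrace, ntrace, Matrix.trace_smul, smul_eq_mul]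
  ring

theorem HasLim.sub {a a' : NCPoly CI} {f f' : CI} (h : HasLim a f) (h' : HasLim a' f') :
    HasLim (a - a') (f - f') := by
  have e : f - f' = f + (-1 : ℂ) • f' := by
    ext x
    simp [sub_eq_add_neg]
  have e' : a - a' = a + (-1 : ℂ) • a' := by rw [neg_one_smul, sub_eq_add_neg]
  rw [e, e']
  exact h.add (h'.smul (-1))

theorem HasLim.incl_mul {a : NCPoly CI} {f : CI} (h : HasLim a f) (b : CI) :
    HasLim (incl b * a) (b * f) := by
  intro c
  rw [← mul_assoc, ← mul_assoc, ← map_mul]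
  exact h (c * b)

theorem ntrace_mul_comm {N : ℕ} (A A' : Matrix (Fin N) (Fin N) ℂ) :
    ntrace (A * A') = ntrace (A' * A) := by
  rw [ntrace, ntrace, Matrix.trace_mul_comm]

/-- By traciality the right coefficient moves into the test function, since `C[0,1]` is commutative.
-/
theorem HasLim.mul_incl {a : NCPoly CI} {f : CI} (h : HasLim a f) (b : CI) :
    HasLim (a * incl b) (f * b) := by
  intro c
  have e : c * (f * b) = b * c * f := by ring
  rw [e]
  refine (h (b * c)).congr fun N => ?_
  congr 1
  funext z
  rw [← mul_assoc, map_mul _ (incl c * a), ntrace_mul_comm, ← map_mul, ← mul_assoc, map_mul incl]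

theorem HasLim.star {a : NCPoly CI} {f : CI} (h : HasLim a f) : HasLim (star a) (star f) := by
  intro c
  have e : c * Star.star f = Star.star (Star.star c * f) := by
    rw [star_mul, star_star, mul_comm]
  rw [e, tau_star]
  refine ((continuous_star.tendsto _).comp (h (Star.star c))).congr fun N => ?_
  rw [Function.comp_apply, Complex.star_def, ← integral_conj]
  congr 1
  funext z
  have e2 : incl c * Star.star a = Star.star (a * incl (Star.star c)) := by
    rw [star_mul, ← map_star, star_star]
  rw [e2, evalAt_star, map_mul, ntrace_mul_comm, ← map_mul, ntrace, ntrace,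
    Matrix.star_eq_conjTranspose, Matrix.trace_conjTranspose, map_mul, map_inv₀, Complex.conj_natCast]
  rfl

theorem HasDiag.hasLim {a : NCPoly CI} {f : CI} (h : HasDiag a f) : HasLim a f := by
  intro c
  refine (tendsto_gridMean_of_uniform
    (fun N k => c (gridPoint k) * ∫ z, evalAt z a k k ∂torusHaar N) _
    ((unifTo_sample c).mul h)).congr fun N => ?_
  unfold ntrace
  rw [integral_const_mul]
  congr 1
  unfold Matrix.trace
  rw [integral_finsetSum]
  · refine Finset.sum_congr rfl fun k _ => ?_
    rw [← integral_const_mul]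
    congr 1
    funext z
    rw [Matrix.diag_apply, map_mul, evalAt_incl, sampleDiag, Matrix.diagonal_mul]
  · intro k _
    exact integrable_torus ((continuous_evalAt _).matrix_elem k k)

theorem hasLim_incl (c : CI) : HasLim (incl c) c := by
  refine HasDiag.hasLim fun δ hδ => Eventually.of_forall fun N k => ?_
  simp only [evalAt_incl, sampleDiag, Matrix.diagonal_apply_eq, integral_const, probReal_univ,
    one_smul, sub_self, norm_zero]
  exact hδ.le

theorem HasLim.tendsto {a : NCPoly CI} {f : CI} (h : HasLim a f) :
    Tendsto (fun N : ℕ => ∫ z, ntrace (evalAt z a) ∂torusHaar N) atTop (𝓝 (tau f)) := by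
  have := h 1
  simpa using this

/-! ### Alternating lists of letters -/

/-- Whether the first letter of the word is `X`. -/
def startsWithX (L : List (CI × Bool)) : Bool := !((L.map Prod.snd).head?.getD false)

theorem NCPoly.IsAlternating.letter_eq {L : List (CI × Bool)} (h : IsAlternating L) (j : ℕ)
    (hj : j < L.length) : L[j].2 = !isBase (startsWithX L) j := by
  induction j with
  | zero =>
    obtain ⟨p, T, rfl⟩ := List.exists_cons_of_ne_nil (List.ne_nil_of_length_pos hj)
    simp [startsWithX]
  | succ j ih =>
    have h1 := (List.isChain_iff_getElem.1 h) j hj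
    rw [ih (by omega)] at h1
    rw [isBase_succ, Bool.not_not]
    cases h2 : isBase (startsWithX L) j <;> simp_all

theorem NCPoly.IsAlternating.letterWord_eq {L : List (CI × Bool)} (h : IsAlternating L) :
    letterWord L = altWord (startsWithX L) fun j : Fin L.length => L[j].1 := by
  rw [altWord, ← letterWord_ofFn]
  congr 1
  refine List.ext_getElem (by simp) fun j h1 h2 => ?_
  rw [List.getElem_ofFn]
  exact Prod.ext rfl (h.letter_eq j h1)

theorem exists_hasDiag {L : List (CI × Bool)} (h : IsAlternating L) (hne : L ≠ []) :
    ∃ f, HasDiag (letterWord L) f := by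
  rcases Nat.even_or_odd L.length with hl | hl
  · obtain ⟨⟨b, ε⟩, T, rfl⟩ := List.exists_cons_of_ne_nil hne
    obtain ⟨h1, h2⟩ := alternating_cases T b ε h
    rw [List.length_cons] at hl
    cases ε
    · rcases h2 rfl with ⟨P, hP, -, hw⟩ | ⟨P, c, hc, -⟩
      · rw [hw, oneStarWord_eq_ofFn]
        obtain ⟨m, hm⟩ : ∃ m, P.length = m + 1 :=
          Nat.exists_eq_succ_of_ne_zero (by simpa using hP)
        generalize P.get = g
        revert g
        rw [hm]
        exact fun g => ⟨_, hasDiag_oneStar (fun j => (g j).1) (fun j => (g j).2)⟩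
      · rw [hc] at hl
        exact absurd hl (by simp)
    · rcases h1 rfl with ⟨P, hP, -, hw⟩ | ⟨P, c, hc, -⟩
      · rw [hw, starOneWord_eq_ofFn]
        obtain ⟨m, hm⟩ : ∃ m, P.length = m + 1 :=
          Nat.exists_eq_succ_of_ne_zero (by simpa using hP)
        generalize P.get = g
        revert g
        rw [hm]
        exact fun g => ⟨_, hasDiag_starOne (fun j => (g j).1) (fun j => (g j).2)⟩
      · rw [hc] at hl
        exact absurd hl (by simp)
  · rw [h.letterWord_eq]
    exact ⟨0, hasDiag_zero_of_odd hl _ _⟩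

theorem HasDiag.eq_zero_of_odd {L : List (CI × Bool)} (h : IsAlternating L) (hl : Odd L.length)
    {f : CI} (hf : HasDiag (letterWord L) f) : f = 0 := by
  rw [h.letterWord_eq] at hf
  exact hf.hasLim.unique (hasDiag_zero_of_odd hl _ _).hasLim

theorem HasDiag.hasSymbol_list {L : List (CI × Bool)} (h : IsAlternating L) (hne : L ≠ [])
    {f : CI} (hf : HasDiag (letterWord L) f) :
    HasSymbol (startsWithX L) (fun j : Fin L.length => L[j].1) f := by
  rcases Nat.even_or_odd L.length with hl | hl
  · rw [h.letterWord_eq] at hf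
    exact hf.hasSymbol hl (List.length_pos_of_ne_nil hne)
  · rw [hf.eq_zero_of_odd h hl]
    exact hasSymbol_zero_of_odd hl _ _

/-- The last letter of `L` is the first letter of `L'`. -/
def Meets (L L' : List (CI × Bool)) : Prop :=
  (L.map Prod.snd).getLast? = (L'.map Prod.snd).head?

/-- When equal letters meet, the index between them is a column for one and a row for the other, so
it has base role on exactly one side. This is the hypothesis on `T` in the count of non-isolated
families. -/
theorem Meets.isBase_eq {L L' : List (CI × Bool)} (h : Meets L L') (hL : IsAlternating L)
    (hne : L ≠ []) : isBase (startsWithX L) L.length = !startsWithX L' := by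
  have hl : 0 < L.length := List.length_pos_of_ne_nil hne
  obtain ⟨n, hn⟩ : ∃ n, L.length = n + 1 := ⟨L.length - 1, by omega⟩
  have h1 := hL.letter_eq n (by omega)
  rw [hn, isBase_succ, ← h1, startsWithX, ← h, Bool.not_not, List.getLast?_eq_getElem?]
  simp [hn]

theorem tendsto_centered_list {s : ℕ} (L : Fin (s + 1) → List (CI × Bool)) (f : Fin (s + 1) → CI)
    (hL : ∀ i, IsAlternating (L i)) (hne : ∀ i, L i ≠ [])
    (hmeet : ∀ i : Fin s, Meets (L i.castSucc) (L i.succ))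
    (hf : ∀ i, HasDiag (letterWord (L i)) (f i))
    (hlim : ∀ a ∈ shortWords CI (∑ i, (L i).length), ∃ g, HasLim a g) :
    Tendsto (fun N : ℕ => ∫ z, ntrace (evalAt z
      (List.ofFn fun i => letterWord (L i) - incl (f i)).prod) ∂torusHaar N) atTop (𝓝 0) := by
  have e : (fun i => letterWord (L i) - incl (f i)) = fun i =>
      altWord (startsWithX (L i)) (fun j : Fin (L i).length => (L i)[j].1) - incl (f i) := by
    funext i
    rw [(hL i).letterWord_eq]
  rw [e]
  -- The extra last value of `T` is chosen to match the end of the last word. No relation to the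
  -- first word is required, because the closing joint is unrestricted.
  refine tendsto_ntrace_centered (T := Fin.snoc (α := fun _ => Bool) (fun i => startsWithX (L i))
    (!isBase (startsWithX (L (Fin.last s))) (L (Fin.last s)).length))
    (fun i => Fin.snoc_castSucc ..) (fun i => ?_) (fun i => List.length_pos_of_ne_nil (hne i))
    (fun i hi => (hf i).eq_zero_of_odd (hL i) hi) (fun i => (hf i).hasSymbol_list (hL i) (hne i))
    fun a ha => ?_
  · cases i using Fin.lastCases with
    | last => rw [Fin.succ_last, Fin.snoc_last, Bool.not_not]
    | cast i =>
      rw [Fin.succ_castSucc, Fin.snoc_castSucc]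
      exact (hmeet i).isBase_eq (hL _) (hne _)
  · obtain ⟨g, hg⟩ := hlim a ha
    refine ⟨‖tau g‖ + 1, ?_⟩
    exact (hg.tendsto.norm.eventually (gt_mem_nhds (lt_add_one _))).mono fun N h => h.le

theorem HasDiag.incl_mul {a : NCPoly CI} {f : CI} (h : HasDiag a f) (c : CI) :
    HasDiag (incl c * a) (c * f) := by
  have e : (fun (N : ℕ) (k : Fin N) => ∫ z, evalAt z (incl c * a) k k ∂torusHaar N)
      = fun N k => c (gridPoint k) * ∫ z, evalAt z a k k ∂torusHaar N := by
    funext N k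
    rw [← integral_const_mul]
    congr 1
    funext z
    rw [map_mul, evalAt_incl, sampleDiag, Matrix.diagonal_mul]
  unfold HasDiag
  rw [e]
  exact (unifTo_sample c).mul h

/-- The first coefficient of the word multiplied by `c`. -/
noncomputable def scaleHead (c : CI) (L : List (CI × Bool)) : List (CI × Bool) :=
  L.modifyHead fun p => (c * p.1, p.2)

theorem scaleHead_ne_nil {c : CI} {L : List (CI × Bool)} (h : L ≠ []) : scaleHead c L ≠ [] := by
  simpa [scaleHead] using h

theorem map_snd_scaleHead (c : CI) (L : List (CI × Bool)) :
    (scaleHead c L).map Prod.snd = L.map Prod.snd := by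
  cases L <;> simp [scaleHead]

theorem length_scaleHead (c : CI) (L : List (CI × Bool)) : (scaleHead c L).length = L.length := by
  simp [scaleHead]

theorem isAlternating_scaleHead {c : CI} {L : List (CI × Bool)} (h : IsAlternating L) :
    IsAlternating (scaleHead c L) := by
  have e : ∀ L : List (CI × Bool), IsAlternating L ↔ (L.map Prod.snd).IsChain (· ≠ ·) := fun L => by
    rw [List.isChain_map]; rfl
  rw [e, map_snd_scaleHead, ← e]
  exact h

theorem letterWord_scaleHead (c : CI) {L : List (CI × Bool)} (h : L ≠ []) :
    letterWord (scaleHead c L) = incl c * letterWord L := by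
  obtain ⟨p, T, rfl⟩ := List.exists_cons_of_ne_nil h
  simp [scaleHead, mul_assoc]

/-- The test function is absorbed into the first word and its centering alike, so the weak statement
follows from vanishing traces of centered products. -/
theorem hasLim_centered {L : List (CI × Bool)} {Ls : List (List (CI × Bool))}
    {F : List (CI × Bool) → CI} (halt : ∀ L' ∈ L :: Ls, IsAlternating L') (hne : [] ∉ L :: Ls)
    (hmeet : (L :: Ls).IsChain Meets) (hF : ∀ L' ∈ L :: Ls, HasDiag (letterWord L') (F L'))
    (hlim : ∀ a ∈ shortWords CI (L :: Ls).flatten.length, ∃ g, HasLim a g) :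
    HasLim ((L :: Ls).map fun L' => letterWord L' - incl (F L')).prod 0 := by
  intro c
  have h0 : L ≠ [] := fun h => hne (by simp [h])
  have hne' : ∀ i : Fin Ls.length, Ls[i] ≠ [] := fun i h =>
    hne (List.mem_cons_of_mem _ (h ▸ List.getElem_mem i.2))
  have hmem : ∀ i : Fin Ls.length, Ls[i] ∈ L :: Ls := fun i =>
    List.mem_cons_of_mem _ (List.getElem_mem i.2)
  have hm' : (scaleHead c L :: Ls).IsChain Meets := by
    rw [List.isChain_cons] at hmeet ⊢
    refine ⟨fun L' hL' => ?_, hmeet.2⟩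
    have := hmeet.1 L' hL'
    rwa [Meets, map_snd_scaleHead]
  have key := tendsto_centered_list (s := Ls.length) (fun i => (scaleHead c L :: Ls)[i])
    (Fin.cons (c * F L) fun i => F Ls[i])
    (Fin.cases (isAlternating_scaleHead (halt L (by simp))) fun i => halt _ (hmem i))
    (Fin.cases (scaleHead_ne_nil h0) hne')
    (fun i => (List.isChain_iff_getElem.1 hm') i (by simp))
    (Fin.cases (by
      have := (hF L (by simp)).incl_mul c
      rwa [← letterWord_scaleHead c h0] at this) fun i => hF _ (hmem i))
    (by
      have e : ∑ i : Fin (Ls.length + 1), ((scaleHead c L :: Ls)[i]).length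
          = (L :: Ls).flatten.length := by
        rw [Fin.sum_univ_succ, List.flatten_cons, List.length_append, List.length_flatten,
          ← List.sum_ofFn]
        congr 1
        · exact length_scaleHead c L
        · congr 1
          conv_rhs => rw [← List.ofFn_getElem (xs := Ls), List.map_ofFn]
          rfl
      rw [e]
      exact hlim)
  have e1 : (List.ofFn fun i : Fin (Ls.length + 1) => letterWord (scaleHead c L :: Ls)[i]
      - incl ((Fin.cons (c * F L) fun i : Fin Ls.length => F Ls[i] : Fin (Ls.length + 1) → CI) i)).prod
      = incl c * ((L :: Ls).map fun L' => letterWord L' - incl (F L')).prod := by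
    rw [List.ofFn_succ, List.prod_cons, List.map_cons, List.prod_cons, ← mul_assoc]
    congr 1
    · rw [mul_sub, ← map_mul, ← letterWord_scaleHead c h0]
      rfl
    · congr 1
      conv_rhs => rw [← List.ofFn_getElem (xs := Ls), List.map_ofFn]
      rfl
  rw [e1] at key
  have e2 : tau (c * 0 : CI) = 0 := by simp [tau]
  rw [e2]
  exact key

/-- Maximality of the intervals means that the letters at a cut are equal. -/
theorem isChain_meets_intervals {n : ℕ} (b : Fin n → CI) (ε : Fin n → Bool) :
    (intervals b ε).IsChain Meets := by
  rw [intervals, List.isChain_map]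
  refine (List.isChain_getLast_head_splitBy _ _).imp ?_
  rintro I I' ⟨hI, hI', h⟩
  rw [Meets, List.map_map, List.map_map, List.getLast?_map, List.head?_map,
    List.getLast?_eq_some_getLast hI, List.head?_eq_some_head hI']
  simpa using h

/-- The product of the centered alternating intervals of a nonempty word has limit zero. -/
theorem hasLim_centered_intervals {n : ℕ} (b : Fin n → CI) (ε : Fin n → Bool) (hn : 1 ≤ n)
    {F : List (CI × Bool) → CI}
    (hF : ∀ L, IsAlternating L → L ≠ [] → HasDiag (letterWord L) (F L))
    (hlim : ∀ a ∈ shortWords CI n, ∃ g, HasLim a g) :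
    HasLim ((intervals b ε).map fun L => letterWord L - incl (F L)).prod 0 := by
  have hfl : (intervals b ε).flatten.length = n := by rw [flatten_intervals, List.length_ofFn]
  obtain ⟨L, Ls, hLs⟩ : ∃ L Ls, intervals b ε = L :: Ls := by
    refine List.exists_cons_of_ne_nil fun h => ?_
    rw [h] at hfl
    simp at hfl
    omega
  have halt : ∀ L' ∈ intervals b ε, IsAlternating L' := fun L' => isAlternating_of_mem_intervals
  have hne := nil_notMem_intervals b ε
  have hch := isChain_meets_intervals b ε
  rw [← hfl] at hlim
  rw [hLs] at halt hne hch hlim ⊢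
  exact hasLim_centered halt hne hch
    (fun L' h => hF L' (halt L' h) fun h' => hne (h' ▸ h)) hlim

/-! ### Existence of the limiting distribution -/

theorem exists_hasDiag_fun : ∃ F : List (CI × Bool) → CI,
    ∀ L, IsAlternating L → L ≠ [] → HasDiag (letterWord L) (F L) := by
  classical
  refine ⟨fun L => if h : IsAlternating L ∧ L ≠ [] then (exists_hasDiag h.1 h.2).choose else 0,
    fun L h h' => ?_⟩
  beta_reduce
  rw [dif_pos ⟨h, h'⟩]
  exact (exists_hasDiag h h').choose_spec

/-- The induction mirrors the uniqueness proof. The hypothesis for shorter words is used twice: for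
the remainder, and for the boundedness of traces needed to show that the centered product vanishes.
-/
theorem exists_hasLim_shortWords (n : ℕ) : ∀ a ∈ shortWords CI n, ∃ f, HasLim a f := by
  obtain ⟨F, hF⟩ := exists_hasDiag_fun
  have h0 : HasLim 0 0 := by simpa using hasLim_incl 0
  induction n with
  | zero =>
    intro a ha
    have : a ∈ (⊥ : Submodule ℂ (NCPoly CI)) := by simpa [shortWords] using ha
    rw [(Submodule.mem_bot ℂ).1 this]
    exact ⟨0, h0⟩
  | succ n ih =>
    intro a ha
    induction ha using Submodule.span_induction with
    | zero => exact ⟨0, h0⟩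
    | add x y _ _ hx hy =>
      obtain ⟨f, hf⟩ := hx
      obtain ⟨g, hg⟩ := hy
      exact ⟨_, hf.add hg⟩
    | smul r x _ hx =>
      obtain ⟨f, hf⟩ := hx
      exact ⟨_, hf.smul r⟩
    | mem x hx =>
      obtain ⟨L, c, hL, rfl⟩ := hx
      suffices h : ∃ f, HasLim (letterWord L) f by
        obtain ⟨f, hf⟩ := h
        exact ⟨_, hf.mul_incl c⟩
      rcases Nat.lt_succ_iff_lt_or_eq.1 hL with hL | hL
      · exact ih _ (letterWord_mem hL)
      · rcases Nat.eq_zero_or_pos n with h | h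
        · rw [List.length_eq_zero_iff.1 (hL.trans h)]
          exact ⟨1, by simpa using hasLim_incl 1⟩
        · subst hL
          have e : L = List.ofFn fun j : Fin L.length => (L[j].1, L[j].2) :=
            (List.ofFn_getElem (xs := L)).symm
          have hc := hasLim_centered_intervals (fun j => L[j].1) (fun j => L[j].2) h hF ih
          have hd := prod_centered_sub_mem F (intervals (fun j : Fin L.length => L[j].1)
            fun j => L[j].2) (nil_notMem_intervals _ _)
          rw [flatten_intervals, ← e] at hd
          obtain ⟨g, hg⟩ := ih _ hd
          have := hc.sub hg
          rw [sub_sub_cancel] at this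
          exact ⟨_, this⟩

theorem exists_hasLim (a : NCPoly CI) : ∃ f, HasLim a f := by
  obtain ⟨n, hn⟩ := exists_mem_shortWords a
  exact exists_hasLim_shortWords n a hn

/-- The limiting distribution. -/
noncomputable def limitDistribution : NCPoly CI →ₗ[ℂ] CI where
  toFun a := (exists_hasLim a).choose
  map_add' a b := (exists_hasLim (a + b)).choose_spec.unique
    ((exists_hasLim a).choose_spec.add (exists_hasLim b).choose_spec)
  map_smul' r a := (exists_hasLim (r • a)).choose_spec.unique
    ((exists_hasLim a).choose_spec.smul r)

theorem hasLim_limitDistribution (a : NCPoly CI) : HasLim a (limitDistribution a) :=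
  (exists_hasLim a).choose_spec

theorem HasLim.limitDistribution_eq {a : NCPoly CI} {f : CI} (h : HasLim a f) :
    limitDistribution a = f :=
  (hasLim_limitDistribution a).unique h

theorem hasDiag_limitDistribution {L : List (CI × Bool)} (h : IsAlternating L) (hne : L ≠ []) :
    HasDiag (letterWord L) (limitDistribution (letterWord L)) := by
  obtain ⟨f, hf⟩ := exists_hasDiag h hne
  rwa [hf.hasLim.limitDistribution_eq]

/-- Converts the words of the first R-diagonality condition into alternating lists of odd length,
whose diagonal limits are zero. -/
theorem exists_isAlternating_starOneWord (P : List (CI × CI)) :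
    ∃ L : List (CI × Bool), IsAlternating L ∧ Odd L.length ∧ L.head? = some (1, false) ∧
      letterWord L = X * starOneWord P := by
  suffices h : ∀ c : CI, ∃ L : List (CI × Bool), IsAlternating L ∧ Odd L.length ∧
      L.head? = some (c, false) ∧ letterWord L = incl c * (X * starOneWord P) by
    obtain ⟨L, h1, h2, h3, h4⟩ := h 1
    exact ⟨L, h1, h2, h3, by rw [h4, map_one, one_mul]⟩
  induction P with
  | nil => exact fun c => ⟨[(c, false)], by simp [IsAlternating], by simp, rfl, by simp [starPow]⟩
  | cons p P ih =>
    intro c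
    obtain ⟨L, h1, h2, h3, h4⟩ := ih p.2
    refine ⟨(c, false) :: (p.1, true) :: L, ?_, ?_, rfl, ?_⟩
    · refine List.isChain_cons_cons.2 ⟨by simp, List.isChain_cons.2 ⟨?_, h1⟩⟩
      rw [h3]
      simp
    · rw [List.length_cons, List.length_cons, add_assoc]
      exact h2.add_even even_two
    · rw [letterWord_cons, letterWord_cons, h4, starOneWord_cons]
      simp [starPow, mul_assoc]

/-- Each property holds because the candidate value has been shown to be a weak limit, and weak
limits are unique. -/
theorem isLimitDistribution_limitDistribution : IsLimitDistribution limitDistribution where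
  condExp :=
    { map_incl := fun b => (hasLim_incl b).limitDistribution_eq
      bimodular := fun b a c =>
        (((hasLim_limitDistribution a).incl_mul b).mul_incl c).limitDistribution_eq
      map_star := fun a => (hasLim_limitDistribution a).star.limitDistribution_eq }
  rDiagonal :=
    { odd_alternating := fun k c d => by
        obtain ⟨L, h1, h2, -, h4⟩ := exists_isAlternating_starOneWord (List.ofFn fun j => (c j, d j))
        have hne : L ≠ [] := by rintro rfl; simp at h2
        have := (hasDiag_limitDistribution h1 hne).eq_zero_of_odd h1 h2
        rw [h4, starOneWord, List.map_ofFn] at this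
        exact this
      centered := fun n hn ε b => by
        rw [prod_centered_intervals]
        exact (hasLim_centered_intervals b ε hn (F := fun L => limitDistribution (letterWord L))
          (fun L h h' => hasDiag_limitDistribution h h')
          (fun a _ => exists_hasLim a)).limitDistribution_eq }
  moment_star_one m c d t := by
    rw [(hasDiag_starOne c d).hasLim.limitDistribution_eq, ContinuousMap.sum_apply]
    rfl
  moment_one_star m c d t := by
    rw [(hasDiag_oneStar c d).hasLim.limitDistribution_eq, ContinuousMap.sum_apply]
    rfl

/-! ### From independent random variables to Haar measure on the torus -/

theorem map_eq_torusHaar {N : ℕ} {Ω : Type*} [MeasurableSpace Ω] {P : Measure Ω}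
    [IsProbabilityMeasure P] {ζ : Fin N → Ω → Circle} (hm : ∀ i, Measurable (ζ i))
    (hi : iIndepFun ζ P) (hl : ∀ i, P.map (ζ i) = circleHaar) :
    P.map (fun ω i => ζ i ω) = torusHaar N := by
  rw [(iIndepFun_iff_map_fun_eq_pi_map fun i => (hm i).aemeasurable).1 hi, torusHaar]
  simp_rw [hl]

theorem integral_eq_torusHaar {N : ℕ} {Ω : Type*} [MeasurableSpace Ω] {P : Measure Ω}
    [IsProbabilityMeasure P] {ζ : Fin N → Ω → Circle} (hm : ∀ i, Measurable (ζ i))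
    (hi : iIndepFun ζ P) (hl : ∀ i, P.map (ζ i) = circleHaar) {f : (Fin N → Circle) → ℂ}
    (hf : Continuous f) : ∫ ω, f (fun i => ζ i ω) ∂P = ∫ z, f z ∂torusHaar N := by
  rw [← map_eq_torusHaar hm hi hl, integral_map (measurable_pi_lambda _ hm).aemeasurable]
  rw [map_eq_torusHaar hm hi hl]
  exact (integrable_torus hf).aestronglyMeasurable

end RandomVandermonde

theorem mainTheorem1 :
    (∃! E : RandomVandermonde.NCPoly RandomVandermonde.CI →ₗ[ℂ] RandomVandermonde.CI,
      RandomVandermonde.IsLimitDistribution E) ∧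
    ∀ E : RandomVandermonde.NCPoly RandomVandermonde.CI →ₗ[ℂ] RandomVandermonde.CI,
      RandomVandermonde.IsLimitDistribution E →
    ∀ (Ω : ℕ → Type*) [∀ N, MeasurableSpace (Ω N)]
      (P : ∀ N, Measure (Ω N)) [∀ N, IsProbabilityMeasure (P N)]
      (ζ : ∀ N, Fin N → Ω N → Circle),
      (∀ N i, Measurable (ζ N i)) →
      (∀ N, iIndepFun (ζ N) (P N)) →
      (∀ N i, (P N).map (ζ N i) = RandomVandermonde.circleHaar) →
    ∀ (n : ℕ) (ε : Fin n → Bool) (b : Fin n → RandomVandermonde.CI),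
      Tendsto
        (fun N : ℕ => ∫ ω, RandomVandermonde.ntrace
          (List.ofFn fun k : Fin n => RandomVandermonde.sampleDiag N (b k) *
            RandomVandermonde.starPow
              (RandomVandermonde.vandermonde fun i => ζ N i ω) (ε k)).prod ∂(P N))
        atTop
        (𝓝 (RandomVandermonde.tau (E
          (List.ofFn fun k : Fin n => RandomVandermonde.NCPoly.incl (b k) *
            RandomVandermonde.starPow RandomVandermonde.NCPoly.X (ε k)).prod))) := by
  refine ⟨⟨_, RandomVandermonde.isLimitDistribution_limitDistribution, fun E hE =>
    hE.unique RandomVandermonde.isLimitDistribution_limitDistribution⟩, ?_⟩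
  intro E hE Ω _ P _ ζ hm hi hl n ε b
  -- By uniqueness `E` is the weak limit itself, so the convergence is its defining property with
  -- test function `1`.
  rw [hE.unique RandomVandermonde.isLimitDistribution_limitDistribution]
  refine (RandomVandermonde.hasLim_limitDistribution _).tendsto.congr fun N => ?_
  rw [← RandomVandermonde.integral_eq_torusHaar (hm N) (hi N) (hl N)
    (RandomVandermonde.continuous_ntrace _)]
  congr 1
  funext ω
  rw [RandomVandermonde.evalAt_word]
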